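/- Let $K$ be a field. Every persistence module $X=(X_r)_{r\in\mathbb R}$ (with transition maps $\varphi_r^s$) is isomorphic to a finite direct sum of interval modules on pairwise distinct intervals $[b,d)$, $b\in\mathbb R$, $b<d\le\infty$. A vineyard module $\mathcal V$ over $[a,b]$ consists of persistence modules $V_t$, $t\in[a,b]$, and, for $s<t$, $(t-s)$-morphisms $\alpha^{s\to t}:V_s\to V_t$ and $\beta^{t\to s}:V_t\to V_s$ that form a $(t-s)$-interleaving and commute with each other and with the transition maps. Its vines $\gamma_1,\dots,\gamma_N$ are families $t\mapsto\gamma_i(t)$ of persistence diagrams with at most one point, bottleneck-continuous, with support a non-empty interval, such that for every $t$ the intervals of $V_t$ are exactly the $\gamma_i(t)=[b_i(t),d_i(t))$ with $i\in S_t:=\{i: t\in\operatorname{supp}\gamma_i\}$. The critical values at time $t$ are the real numbers among the $b_i(t),d_i(t)$, where for a vine that appears or disappears at $t$ the limiting values are used. A time is critical if two of these values coincide or a vine appears or disappears. Assume that there are finitely many critical times and that at each time at most one pair of critical values coincides. A segment is the restriction of $\mathcal V$ to $[T_0,T_1]$, $T_0<T_1$, with no critical time in $(T_0,T_1)$, such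 that either (i) neither $T_0$ nor $T_1$ is critical and $T_1-T_0\le\varepsilon/4$, with $\varepsilon$ the smallest distance between distinct critical values at $T_0$, or the smallest such distance at $T_1$; or (ii) exactly one $T\in\{T_0,T_1\}$ is critical and $T_1-T_0\le\varepsilon/4$, with $\varepsilon$ the smallest distance between distinct critical values at $T$ (if there is no pair of distinct critical values, there is no bound). A family of (extended) bases $B_t=(x_1^t,\dots,x_N^t)$ consists, for each $t$, of elements $x_i^t\in V_t$ with $x_i^t$ born at $b_i(t)$ and dying at $d_i(t)$ for $i\in S_t$, such that at every height $r$ the images of the $x_i^t$ with $b_i(t)\le r<d_i(t)$ form a basis of the space of $V_t$ at height $r$, and $x_i^t=0$ for $i\notin S_t$. For an $\epsilon$-morphism $\alpha$, column $i$ of $\mathrm{Mat}_{B}^{B'}(\alpha)$ contains the coordinates of $\alpha(x_i)$ in the images of those $x'_j$ whose interval contains $b_i+\epsilon$, and zeros otherwise. A matrix $M$ is a basis transformation matrix for $B_t$ if, for all $i,j\in S_t$, $M_{ii}\ne0$, and $M_{ji}\neq 0$ implies $b_j(t)\le b_i(t)$ and $d_j(t)\le d_i(t)$; then $M(B_t)$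 is the basis with elements $\sum_j M_{ji}\,\varphi_{b_j(t)}^{b_i(t)}(x^t_j)$ for $i\in S_t$ (the sum over $j\in S_t$ with $b_j(t)\le b_i(t)$) and $0$ for $i\notin S_t$. Let $\pi_S$ be the diagonal projection matrix onto the coordinates in $S$ and $e^\mu_{lk}$ the identity matrix with the additional entry $\mu$ at position $(l,k)$. $\mathcal V$ is forwards incompatible at $s$ by $(\gamma_k,\gamma_l)$ if both vines are present at $s$, $\gamma_l(s)\le\gamma_k(s)$ in the product order on $(b,d)$, and $\gamma_l(t)\not\le\gamma_k(t)$ for all $t\in(s,s+\delta)$, for some $\delta>0$; otherwise $s$ is forwards compatible. Then any vineyard module segment can be forward simplified: for every segment over $[T_0,T_1]$ and every initial family of bases $\{B_t^{old}\}$ there is a family of bases $\{B_t^{new}\}$ such that, with $A=\mathrm{Mat}_{B^{new}_{T_0}}^{B^{old}_{T_1}}(\alpha^{T_0\to T_1})$: (1) $B^{new}_{T_0}=B^{old}_{T_0}$; (2) $\mathrm{Mat}_{B^{new}_s}^{B^{new}_t}(\alpha^{s\to t})=\pi_{S_s\cap S_t}$ for all $T_0<s<t\le T_1$ sufficiently close,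 that is, each $r\in(T_0,T_1)$ has a neighbourhood such that this holds for all $s<t$ in it, and it holds for $t=T_1$ and all $s<T_1$ close enough to $T_1$; (3) if $T_0$ is forwards compatible, then $\tilde A$, which is $A$ with each zero diagonal entry replaced by $1$, is a basis transformation matrix for $B^{old}_{T_1}$, $B^{new}_{T_1}=\tilde A(B^{old}_{T_1})$, and $\mathrm{Mat}_{B^{new}_{T_0}}^{B^{new}_t}(\alpha^{T_0\to t})=\pi_{S_{T_0}\cap S_t}$ for all $t>T_0$ close enough to $T_0$; (4) if $T_0$ is forwards incompatible by $(\gamma_k,\gamma_l)$ and $\lambda=A_{lk}/A_{ll}$, then $Ae^{-\lambda}_{lk}$ is a basis transformation matrix for $B^{old}_{T_1}$, $B^{new}_{T_1}=(Ae^{-\lambda}_{lk})(B^{old}_{T_1})$, and $\mathrm{Mat}_{B^{new}_{T_0}}^{B^{new}_t}(\alpha^{T_0\to t})=e^{\lambda}_{lk}\,\pi_{S_{T_0}}$ for all $t>T_0$ close enough to $T_0$. -/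

import Mathlib

open Set Filter Topology

universe u v v'

noncomputable section

namespace Vineyards

/-! Persistence modules and their building blocks -/

/-- A persistence module over the field `K`, indexed by `ℝ`. -/
structure PersistenceModule (K : Type u) [Field K] where
  obj : ℝ → Type v
  [addCommGroup : ∀ t, AddCommGroup (obj t)]
  [module : ∀ t, Module K (obj t)]
  map : ∀ {s t : ℝ}, s ≤ t → (obj s →ₗ[K] obj t)
  map_refl : ∀ (s : ℝ) (x : obj s), map (le_refl s) x = x
  map_map : ∀ {r s t : ℝ} (h₁ : r ≤ s) (h₂ : s ≤ t) (x : obj r),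
    map h₂ (map h₁ x) = map (h₁.trans h₂) x

attribute [instance] PersistenceModule.addCommGroup PersistenceModule.module

/-- A bar `[birth, death)`, with finite birth and finite or infinite death. -/
@[ext]
structure Bar where
  birth : ℝ
  death : EReal
  birth_lt_death : (birth : EReal) < death

/-- The product order on bars, regarded as points `(birth, death)` of the plane. -/
instance : LE Bar := ⟨fun I J => I.birth ≤ J.birth ∧ I.death ≤ J.death⟩

/-- The birth of an optional bar. The value for the missing bar is a dummy. -/
def birthOf : Option Bar → ℝ
  | none => 0
  | some I => I.birth

/-- The death of an optional bar. The value for the missing bar is a dummy. -/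
def deathOf : Option Bar → EReal
  | none => 0
  | some I => I.death

/-- The bar is present and contains the height `r`. -/
def Alive (o : Option Bar) (r : ℝ) : Prop :=
  ∃ I, o = some I ∧ I.birth ≤ r ∧ (r : EReal) < I.death

theorem Alive.birthOf_le {o : Option Bar} {r : ℝ} (h : Alive o r) : birthOf o ≤ r := by
  obtain ⟨I, rfl, h, -⟩ := h
  exact h

theorem Alive.between {o : Option Bar} {r s t : ℝ} (hr : Alive o r) (ht : Alive o t)
    (h₁ : r ≤ s) (h₂ : s ≤ t) : Alive o s := by
  obtain ⟨I, rfl, h, -⟩ := hr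
  obtain ⟨J, hJ, -, h'⟩ := ht
  obtain rfl : I = J := by simpa using hJ
  exact ⟨I, rfl, h.trans h₁, lt_of_le_of_lt (by exact_mod_cast h₂) h'⟩

section

variable (K : Type u) [Field K]

/-- The space at height `r` of an interval module: `K` if the bar contains `r`, else `0`. -/
def barSpace (o : Option Bar) (r : ℝ) : Submodule K K where
  carrier := {x | ¬ Alive o r → x = 0}
  add_mem' := by
    intro x y hx hy h
    rw [hx h, hy h, add_zero]
  zero_mem' := fun _ => rfl
  smul_mem' := by
    intro c x hx h
    rw [hx h, smul_zero]

open Classical in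
/-- The interval module of a bar (the zero module if there is no bar): the transition maps are the
identity between two heights in the bar and zero otherwise. -/
def barModule (o : Option Bar) : PersistenceModule.{u, u} K where
  obj r := barSpace K o r
  map {s t} _ :=
    { toFun := fun x => ⟨if Alive o t then (x : K) else 0, fun h => if_neg h⟩
      map_add' := by
        intro x y
        ext
        by_cases h : Alive o t <;> simp [h]
      map_smul' := by
        intro c x
        ext
        by_cases h : Alive o t <;> simp [h] }
  map_refl := by
    rintro s ⟨x, hx⟩
    ext
    by_cases h : Alive o s
    · simp [h]
    · simp [h, hx h]
  map_map := by
    rintro r s t h₁ h₂ ⟨x, hx⟩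
    ext
    by_cases ht : Alive o t
    · by_cases hs : Alive o s
      · simp [hs, ht]
      · have hr : ¬ Alive o r := fun hr => hs (hr.between ht h₁ h₂)
        simp [hs, hx hr]
    · simp [ht]

variable {K}

/-- The direct sum of finitely many persistence modules. -/
def directSum {N : ℕ} (M : Fin N → PersistenceModule.{u, v} K) : PersistenceModule.{u, v} K where
  obj r := ∀ i, (M i).obj r
  map h := LinearMap.pi fun i => (M i).map h ∘ₗ LinearMap.proj i
  map_refl := by
    intro s x
    funext i
    exact (M i).map_refl s (x i)
  map_map := by
    intro r s t h₁ h₂ x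
    funext i
    exact (M i).map_map h₁ h₂ (x i)

/-- Isomorphism of persistence modules. -/
def IsIsomorphic (X : PersistenceModule.{u, v} K) (Y : PersistenceModule.{u, v'} K) : Prop :=
  ∃ e : ∀ r, X.obj r ≃ₗ[K] Y.obj r,
    ∀ {r s : ℝ} (h : r ≤ s) (x : X.obj r), e s (X.map h x) = Y.map h (e r x)

/-- An `ε`-morphism of persistence modules. -/
structure ShiftMorphism (X : PersistenceModule.{u, v} K) (Y : PersistenceModule.{u, v'} K)
    (ε : ℝ) where
  app : ∀ r : ℝ, X.obj r →ₗ[K] Y.obj (r + ε)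
  naturality : ∀ {r s : ℝ} (h : r ≤ s) (x : X.obj r),
    app s (X.map h x) = Y.map (add_le_add_left h ε) (app r x)

/-- The two `ε`-morphisms form an `ε`-interleaving. -/
def IsInterleaving {X : PersistenceModule.{u, v} K} {Y : PersistenceModule.{u, v'} K} {ε : ℝ}
    (hε : 0 ≤ ε) (α : ShiftMorphism X Y ε) (β : ShiftMorphism Y X ε) : Prop :=
  (∀ (r : ℝ) (x : X.obj r),
    β.app (r + ε) (α.app r x) = X.map (show r ≤ r + ε + ε by linarith) x) ∧
  (∀ (r : ℝ) (y : Y.obj r),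
    α.app (r + ε) (β.app r y) = Y.map (show r ≤ r + ε + ε by linarith) y)

/-! Bases and matrices -/

/-- `x` is born at the height `t` at which it lives: it is not in the image of an earlier space. -/
def PersistenceModule.IsBorn (X : PersistenceModule.{u, v} K) {t : ℝ} (x : X.obj t) : Prop :=
  ∀ (s : ℝ) (h : s < t), x ∉ LinearMap.range (X.map h.le)

/-- The death of an element `x` living at its birth height `t`. -/
def PersistenceModule.death (X : PersistenceModule.{u, v} K) {t : ℝ} (x : X.obj t) : EReal :=
  sInf ((fun s : ℝ => (s : EReal)) '' {s | ∃ h : t < s, X.map h.le x = 0})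

/-- An extended basis of `X` with respect to the labelled barcode `c`: for each label `i` that
carries a bar, an element at the birth height of that bar, and a zero element for the other labels.
-/
structure ExtBasis {N : ℕ} (X : PersistenceModule.{u, v} K) (c : Fin N → Option Bar) where
  elt : ∀ i, X.obj (birthOf (c i))
  elt_zero : ∀ i, c i = none → elt i = 0
  isBorn : ∀ i, c i ≠ none → X.IsBorn (elt i)
  death_eq : ∀ i, c i ≠ none → X.death (elt i) = deathOf (c i)
  linearIndependent : ∀ r : ℝ,
    LinearIndependent K fun i : {i // Alive (c i) r} => X.map i.2.birthOf_le (elt i.1)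
  span_eq : ∀ r : ℝ, ⊤ ≤ Submodule.span K
    (Set.range fun i : {i // Alive (c i) r} => X.map i.2.birthOf_le (elt i.1))

/-- The basis of the vector space at height `r` given by the elements whose bars contain `r`. -/
def ExtBasis.basisAt {N : ℕ} {X : PersistenceModule.{u, v} K} {c : Fin N → Option Bar}
    (B : ExtBasis X c) (r : ℝ) : Module.Basis {i // Alive (c i) r} K (X.obj r) :=
  Module.Basis.mk (B.linearIndependent r) (B.span_eq r)

open Classical in
/-- The matrix of an `ε`-morphism with respect to extended bases. Column `i` holds the coordinates
of the image of the `i`-th basis element. -/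
def matrixOf {N : ℕ} {X : PersistenceModule.{u, v} K} {Y : PersistenceModule.{u, v'} K} {ε : ℝ}
    {c c' : Fin N → Option Bar} (B : ExtBasis X c) (B' : ExtBasis Y c')
    (α : ShiftMorphism X Y ε) : Matrix (Fin N) (Fin N) K :=
  Matrix.of fun j i =>
    if h : Alive (c' j) (birthOf (c i) + ε) then
      (B'.basisAt (birthOf (c i) + ε)).repr (α.app (birthOf (c i)) (B.elt i)) ⟨j, h⟩
    else 0

/-- `A`, restricted to the labels that carry a bar, is a basis transformation matrix. -/
def IsBasisTransformation {N : ℕ} (c : Fin N → Option Bar) (A : Matrix (Fin N) (Fin N) K) : Prop :=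
  (∀ i, c i ≠ none → A i i ≠ 0) ∧
  (∀ i j I J, c i = some I → c j = some J → A j i ≠ 0 → J ≤ I)

open Classical in
/-- The transformed elements `A(B)`: for a label `i` that carries a bar this is the sum over `j` of
`A j i` times the image of the `j`-th element; the other labels keep zero elements. -/
def transform {N : ℕ} {X : PersistenceModule.{u, v} K} {c : Fin N → Option Bar}
    (A : Matrix (Fin N) (Fin N) K) (B : ExtBasis X c) (i : Fin N) : X.obj (birthOf (c i)) :=
  if c i = none then 0
  else ∑ j, if h : birthOf (c j) ≤ birthOf (c i) then A j i • X.map h (B.elt j) else 0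

/-- `B' = A(B)`, where `A` is an (extended) basis transformation matrix. -/
def IsTransformOf {N : ℕ} {X : PersistenceModule.{u, v} K} {c : Fin N → Option Bar}
    (B' : ExtBasis X c) (A : Matrix (Fin N) (Fin N) K) (B : ExtBasis X c) : Prop :=
  IsBasisTransformation c A ∧ ∀ i, B'.elt i = transform A B i

open Classical in
/-- The diagonal projection matrix onto the coordinates in `S`. -/
def projMatrix {N : ℕ} (S : Set (Fin N)) : Matrix (Fin N) (Fin N) K :=
  Matrix.diagonal fun i => if i ∈ S then 1 else 0

/-- The elementary matrix with ones on the diagonal and the additional entry `μ` at `(l, k)`: right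
multiplication by it adds `μ` times column `l` to column `k`. -/
def elemMatrix {N : ℕ} (l k : Fin N) (μ : K) : Matrix (Fin N) (Fin N) K :=
  1 + Matrix.single l k μ

open Classical in
/-- The matrix `A` with `1` added to each zero diagonal element. -/
def fillDiagonal {N : ℕ} (A : Matrix (Fin N) (Fin N) K) : Matrix (Fin N) (Fin N) K :=
  A + Matrix.diagonal fun i => if A i i = 0 then 1 else 0

end

/-! Vineyard modules, vines and segments -/

/-- A (1-Lipschitz) vineyard module over the time interval `[a, b]`. Composites of interleaving maps
are compared along transition maps between equal heights. -/
structure VineyardModule (K : Type u) [Field K] (a b : ℝ) where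
  mod : Icc a b → PersistenceModule.{u, v} K
  α : ∀ {s t : Icc a b}, s < t → ShiftMorphism (mod s) (mod t) ((t : ℝ) - s)
  β : ∀ {s t : Icc a b}, s < t → ShiftMorphism (mod t) (mod s) ((t : ℝ) - s)
  interleaving : ∀ {s t : Icc a b} (h : s < t),
    IsInterleaving (sub_nonneg.2 (Subtype.coe_le_coe.2 h.le)) (α h) (β h)
  α_comp : ∀ {s t w : Icc a b} (h₁ : s < t) (h₂ : t < w) (r : ℝ) (x : (mod s).obj r),
    (mod w).map (show r + ((t : ℝ) - s) + ((w : ℝ) - t) ≤ r + ((w : ℝ) - s) by linarith)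
      ((α h₂).app _ ((α h₁).app r x)) = (α (h₁.trans h₂)).app r x
  β_comp : ∀ {s t w : Icc a b} (h₁ : s < t) (h₂ : t < w) (r : ℝ) (x : (mod w).obj r),
    (mod s).map (show r + ((w : ℝ) - t) + ((t : ℝ) - s) ≤ r + ((w : ℝ) - s) by linarith)
      ((β h₁).app _ ((β h₂).app r x)) = (β (h₁.trans h₂)).app r x

/-- The persistence diagrams `X` and `Y` admit a transportation plan of cost at most `ε`. -/
def BottleneckLE (X Y : Set Bar) (ε : ℝ) : Prop :=
  ∃ M : Set (Bar × Bar), M ⊆ X ×ˢ Y ∧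
    (∀ p ∈ M, ∀ q ∈ M, (p.1 = q.1 ∨ p.2 = q.2) → p = q) ∧
    (∀ p ∈ M, |p.1.birth - p.2.birth| ≤ ε ∧
      p.1.death ≤ p.2.death + (ε : EReal) ∧ p.2.death ≤ p.1.death + (ε : EReal)) ∧
    (∀ x ∈ X, (∀ p ∈ M, p.1 ≠ x) → x.death ≤ ((x.birth + 2 * ε : ℝ) : EReal)) ∧
    (∀ y ∈ Y, (∀ p ∈ M, p.2 ≠ y) → y.death ≤ ((y.birth + 2 * ε : ℝ) : EReal))

section

variable {a b : ℝ}

/-- The support of a one-parameter family of diagrams with at most one point. -/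
def supp (γ : Icc a b → Option Bar) : Set (Icc a b) := {t | γ t ≠ none}

/-- A vine: a family of persistence diagrams with at most one point, continuous for the bottleneck
distance, whose support is a non-empty interval. -/
structure IsVine (γ : Icc a b → Option Bar) : Prop where
  continuous : ∀ t : Icc a b, ∀ ε > (0 : ℝ), ∃ δ > (0 : ℝ), ∀ s : Icc a b,
    |(s : ℝ) - t| < δ → BottleneckLE {I | γ t = some I} {I | γ s = some I} ε
  nonempty : (supp γ).Nonempty
  ordConnected : (supp γ).OrdConnected

/-- The set of labels of the vines that are present at the time `t`. -/
def present {N : ℕ} (γ : Fin N → Icc a b → Option Bar) (t : Icc a b) : Set (Fin N) :=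
  {i | γ i t ≠ none}

/-- `γ` is the family of vines of the vineyard module `V`: each persistence module is isomorphic to
the direct sum of the interval modules of the vines at that time, without repeated intervals. -/
structure IsVineFamily {K : Type u} [Field K] {N : ℕ} (V : VineyardModule.{u, v} K a b)
    (γ : Fin N → Icc a b → Option Bar) : Prop where
  isVine : ∀ i, IsVine (γ i)
  decomposition : ∀ t, IsIsomorphic (V.mod t) (directSum fun i => barModule K (γ i t))
  distinct : ∀ t i j, γ i t ≠ none → γ i t = γ j t → i = j

/-- The real number `p` is the birth value (`e = (i, false)`) or death value (`e = (i, true)`) of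
the vine `i` at the time `t`. If the vine appears or disappears at `t`, it is the limiting value. An
infinite death is not a value. -/
def IsValue {N : ℕ} (γ : Fin N → Icc a b → Option Bar) (t : Icc a b) :
    Fin N × Bool → ℝ → Prop
  | (i, false), p =>
      (∃ I, γ i t = some I ∧ I.birth = p) ∨
      (t ∈ closure (supp (γ i)) \ supp (γ i) ∧
        Tendsto (fun s => birthOf (γ i s)) (𝓝[supp (γ i)] t) (𝓝 p))
  | (i, true), p =>
      (∃ I, γ i t = some I ∧ I.death = (p : EReal)) ∨
      (t ∈ closure (supp (γ i)) \ supp (γ i) ∧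
        Tendsto (fun s => deathOf (γ i s)) (𝓝[supp (γ i)] t) (𝓝 (p : EReal)))

/-- The two labelled critical values coincide at the time `t`. -/
def Coincide {N : ℕ} (γ : Fin N → Icc a b → Option Bar) (t : Icc a b)
    (e e' : Fin N × Bool) : Prop :=
  e ≠ e' ∧ ∃ p, IsValue γ t e p ∧ IsValue γ t e' p

/-- A critical time: two birth or death values coincide, or a vine appears or disappears. -/
def IsCritical {N : ℕ} (γ : Fin N → Icc a b → Option Bar) (t : Icc a b) : Prop :=
  (∃ e e', Coincide γ t e e') ∨ ∃ i, t ∈ closure (supp (γ i)) \ supp (γ i)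

/-- The genericity assumptions: finitely many critical times, and at most one pair of coinciding
critical values at any time. -/
structure IsGeneric {N : ℕ} (γ : Fin N → Icc a b → Option Bar) : Prop where
  finite_critical : {t | IsCritical γ t}.Finite
  unique_coincidence : ∀ t e e' f f', Coincide γ t e e' → Coincide γ t f f' →
    (e = f ∧ e' = f') ∨ (e = f' ∧ e' = f)

/-- `h` is at most a quarter of each distance between distinct critical values at the time `t`. -/
def QuarterGap {N : ℕ} (γ : Fin N → Icc a b → Option Bar) (t : Icc a b) (h : ℝ) : Prop :=
  ∀ e e' p q, IsValue γ t e p → IsValue γ t e' q → p ≠ q → h ≤ |p - q| / 4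

/-- The restriction of the vineyard module to `[T₀, T₁]` is a segment. -/
def IsSegment {N : ℕ} (γ : Fin N → Icc a b → Option Bar) (T₀ T₁ : Icc a b) : Prop :=
  T₀ < T₁ ∧ (∀ t, T₀ < t → t < T₁ → ¬ IsCritical γ t) ∧
  ((¬ IsCritical γ T₀ ∧ ¬ IsCritical γ T₁ ∧
      (QuarterGap γ T₀ ((T₁ : ℝ) - T₀) ∨ QuarterGap γ T₁ ((T₁ : ℝ) - T₀))) ∨
    (IsCritical γ T₀ ∧ ¬ IsCritical γ T₁ ∧ QuarterGap γ T₀ ((T₁ : ℝ) - T₀)) ∨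
    (¬ IsCritical γ T₀ ∧ IsCritical γ T₁ ∧ QuarterGap γ T₁ ((T₁ : ℝ) - T₀)))

/-- The vineyard module is forwards incompatible at the time `s` by the vines `k` and `l`. -/
def ForwardsIncompatible {N : ℕ} (γ : Fin N → Icc a b → Option Bar) (s : Icc a b)
    (k l : Fin N) : Prop :=
  (∃ I J, γ l s = some I ∧ γ k s = some J ∧ I ≤ J) ∧
  ∃ δ > (0 : ℝ), ∀ t : Icc a b, s < t → (t : ℝ) < s + δ →
    ∀ I J, γ l t = some I → γ k t = some J → ¬ I ≤ J

/-- The vineyard module is forwards compatible at the time `s`. -/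
def ForwardsCompatible {N : ℕ} (γ : Fin N → Icc a b → Option Bar) (s : Icc a b) : Prop :=
  ∀ k l, ¬ ForwardsIncompatible γ s k l

/-- `P s t` holds for all `T₀ < s < t ≤ T₁` with `s` and `t` sufficiently close: for all `s < t` near
any given time strictly between `T₀` and `T₁`, and for `t = T₁` and all `s < T₁` near `T₁`. -/
def ForCloseTimes (T₀ T₁ : Icc a b) (P : ∀ s t : Icc a b, s < t → Prop) : Prop :=
  (∀ r, T₀ < r → r < T₁ → ∃ δ > (0 : ℝ), ∀ (s t : Icc a b) (h : s < t),
    T₀ < s → t < T₁ → |(s : ℝ) - r| < δ → |(t : ℝ) - r| < δ → P s t h) ∧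
  (∃ δ > (0 : ℝ), ∀ (s : Icc a b) (h : s < T₁), T₀ < s → (T₁ : ℝ) - δ < s → P s T₁ h)

/-- `P t` holds for all `T₀ < t < T₁` sufficiently close to `T₀`. -/
def ForTimesAfter (T₀ T₁ : Icc a b) (P : ∀ t : Icc a b, T₀ < t → Prop) : Prop :=
  ∃ δ > (0 : ℝ), ∀ (t : Icc a b) (h : T₀ < t), t < T₁ → (t : ℝ) < T₀ + δ → P t h

/-- A family of extended bases of the persistence modules of `V`, labelled by the vines. -/
abbrev BasisFamily {K : Type u} [Field K] {N : ℕ} (V : VineyardModule.{u, v} K a b)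
    (γ : Fin N → Icc a b → Option Bar) :=
  ∀ t, ExtBasis (V.mod t) fun i => γ i t

/-- `Bnew` is a forwards simplified family of bases over `[T₀, T₁]`, for the initial family of bases
`Bold`. -/
def IsForwardSimplified {K : Type u} [Field K] {N : ℕ} (V : VineyardModule.{u, v} K a b)
    (γ : Fin N → Icc a b → Option Bar) {T₀ T₁ : Icc a b} (hT : T₀ < T₁)
    (Bold Bnew : BasisFamily V γ) : Prop :=
  let A : Matrix (Fin N) (Fin N) K := matrixOf (Bnew T₀) (Bold T₁) (V.α hT)
  Bnew T₀ = Bold T₀ ∧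
  ForCloseTimes T₀ T₁ (fun s t h =>
    matrixOf (Bnew s) (Bnew t) (V.α h) = projMatrix (present γ s ∩ present γ t)) ∧
  (ForwardsCompatible γ T₀ →
    IsTransformOf (Bnew T₁) (fillDiagonal A) (Bold T₁) ∧
    ForTimesAfter T₀ T₁ (fun t h =>
      matrixOf (Bnew T₀) (Bnew t) (V.α h) = projMatrix (present γ T₀ ∩ present γ t))) ∧
  (∀ k l, ForwardsIncompatible γ T₀ k l →
    IsTransformOf (Bnew T₁) (A * elemMatrix l k (-(A l k / A l l))) (Bold T₁) ∧
    ForTimesAfter T₀ T₁ (fun t h =>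
      matrixOf (Bnew T₀) (Bnew t) (V.α h) =
        elemMatrix l k (A l k / A l l) * projMatrix (present γ T₀)))

end

end Vineyards

end

open Vineyards

/-! A basis of a persistence module can be transported along an interleaving. Call an `ε`-morphism
*carrying* for two bases (`Carries`) if it maps each element of the first to the image of the
element of the second with the same label. Let the critical values of two modules move by at most
`h`, and let distinct critical values of the target be more than `2 * h` apart, where bars of the
target may have shrunk to length zero. Then for every basis of the source there is a basis of the
target to which it is carried (`IsInterleaving.exists_carries`). If the source satisfies the same
condition and no bar vanishes, carrying is a bijection between the bases of the source and of the
target (`IsInterleaving.existsUnique_carries`).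

On a segment the critical values are 1-Lipschitz functions of time, also if a vine appears or
disappears at one of its ends, where birth and death converge to a common value
(`exists_segmentValues`). Near a time that is not critical all values are distinct, so that a basis
at one time determines bases at all nearby times, which are carried to each other. As the transport
is unique, the local families can be glued (`exists_section`): a basis at one end of an interval
without critical times extends to a family of bases over the interval
(`SegmentValues.exists_forward_family`, `SegmentValues.exists_backward_family`). Within such a
family the matrices of the interleaving morphisms between close times are projections.

It remains to treat the two ends of the segment, only one of which can be critical.

If the values are well separated at the end `T₁`, the basis at `T₀` is transported forwards through
the segment and, in one step, to `T₁`; both ways lead to the same result, as the transition maps of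
the last module are injective between the relevant heights. Two bases of the same module differ by a
basis transformation, whose matrix is that of the interleaving morphism from `T₀` to `T₁`, apart
from zero diagonal entries of vines that disappear.

If the values are well separated at the start `T₀`, the matrix `A` of the interleaving morphism is
triangular for the product order on the bars at `T₀`, with nonzero diagonal
(`SegmentValues.matrixOf_triangular`), because the kernel of the morphism and the heights at which
classes die are controlled by that separation. Bars that are comparable at `T₀` remain comparable
unless `T₀` is forwards incompatible by them. Hence `A`, with its zero diagonal entries replaced by
`1`, is a basis transformation matrix at `T₁` in the compatible case. In the incompatible case there
is a single incompatible pair by genericity, and its entry in `A` is cleared by an elementary column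
operation. The transformed basis at `T₁` is transported backwards, and the matrix at `T₀` is the
inverse elementary matrix (`SegmentValues.exists_family_of_gap_start`). -/

noncomputable section

namespace Vineyards

/-! ### Bars -/

section

instance : PartialOrder Bar where
  le := (· ≤ ·)
  le_refl _ := ⟨le_rfl, le_rfl⟩
  le_trans _ _ _ h h' := ⟨h.1.trans h'.1, h.2.trans h'.2⟩
  le_antisymm _ _ h h' := Bar.ext (le_antisymm h.1 h'.1) (le_antisymm h.2 h'.2)

theorem Alive.ne_none {o : Option Bar} {r : ℝ} (h : Alive o r) : o ≠ none := by
  obtain ⟨I, rfl, -⟩ := h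
  simp

theorem alive_some {I : Bar} {r : ℝ} :
    Alive (some I) r ↔ I.birth ≤ r ∧ (r : EReal) < I.death := by
  simp [Alive]

theorem alive_iff {o : Option Bar} {r : ℝ} :
    Alive o r ↔ o ≠ none ∧ birthOf o ≤ r ∧ (r : EReal) < deathOf o := by
  cases o with
  | none => simp [Alive]
  | some I => simp [alive_some, birthOf, deathOf]

theorem alive_birthOf {o : Option Bar} (h : o ≠ none) : Alive o (birthOf o) := by
  cases o with
  | none => exact absurd rfl h
  | some I => exact alive_some.2 ⟨le_rfl, I.birth_lt_death⟩

/-! ### Triangular systems of vectors -/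

/-- In the Leibniz expansion only the identity contributes: a permutation `σ` with `σ i ≤ i` for
all `i` fixes every `i`, since its orbits are finite decreasing cycles. -/
theorem det_eq_prod_diag_of_le {ι P R : Type*} [Fintype ι] [DecidableEq ι] [PartialOrder P]
    [CommRing R] {f : ι → P} (hf : Function.Injective f) {M : Matrix ι ι R}
    (h : ∀ i j, M j i ≠ 0 → f j ≤ f i) : M.det = ∏ i, M i i := by
  rw [Matrix.det_apply, Finset.sum_eq_single 1]
  · simp
  · intro σ _ hσ
    have : ∃ i, M (σ i) i = 0 := by
      by_contra! hM
      have hle : ∀ i, f (σ i) ≤ f i := fun i => h _ _ (hM i)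
      have hpow : ∀ (n : ℕ) i, f ((σ ^ n) i) ≤ f i := by
        intro n
        induction n with
        | zero => simp
        | succ n ih =>
          intro i
          rw [pow_succ', Equiv.Perm.mul_apply]
          exact (hle _).trans (ih i)
      refine hσ (Equiv.ext fun i => hf (le_antisymm (hle i) ?_))
      have h1 : (σ ^ (orderOf σ - 1)) (σ i) = i := by
        rw [← Equiv.Perm.mul_apply, ← pow_succ, Nat.sub_add_cancel (orderOf_pos σ),
          pow_orderOf_eq_one, Equiv.Perm.one_apply]
      have h2 := hpow (orderOf σ - 1) (σ i)
      rwa [h1] at h2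
    obtain ⟨i, hi⟩ := this
    have h0 : ∏ i, M (σ i) i = 0 :=
      Finset.prod_eq_zero (f := fun i => M (σ i) i) (Finset.mem_univ i) hi
    rw [h0, smul_zero]
  · simp

/-- A family of vectors that is triangular with respect to a basis is itself a basis if and only if
its diagonal coordinates do not vanish. -/
theorem basis_iff_diag_ne_zero {ι P K W : Type*} [Finite ι] [PartialOrder P] [Field K]
    [AddCommGroup W] [Module K W] {f : ι → P} (hf : Function.Injective f)
    (e : Module.Basis ι K W) {w : ι → W} (h : ∀ i j, e.repr (w i) j ≠ 0 → f j ≤ f i) :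
    (LinearIndependent K w ∧ Submodule.span K (Set.range w) = ⊤) ↔
      ∀ i, e.repr (w i) i ≠ 0 := by
  classical
  have := Fintype.ofFinite ι
  rw [Module.Basis.is_basis_iff_det e, Module.Basis.det_apply,
    det_eq_prod_diag_of_le hf (M := e.toMatrix w) (by simpa [Module.Basis.toMatrix_apply] using h),
    isUnit_iff_ne_zero, Finset.prod_ne_zero_iff]
  simp [Module.Basis.toMatrix_apply]

/-! ### Extended bases -/

variable {K : Type u} [Field K] {N : ℕ} {X : PersistenceModule.{u, v} K} {c : Fin N → Option Bar}

namespace ExtBasis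

theorem ext_elt {B B' : ExtBasis X c} (h : ∀ i, B.elt i = B'.elt i) : B = B' := by
  have h' : B.elt = B'.elt := funext h
  cases B
  cases B'
  cases h'
  rfl

theorem basisAt_apply (B : ExtBasis X c) (r : ℝ) (i : {i // Alive (c i) r}) :
    B.basisAt r i = X.map i.2.birthOf_le (B.elt i.1) :=
  Module.Basis.mk_apply _ _ _

theorem finrank_obj (B : ExtBasis X c) (r : ℝ) :
    Module.finrank K (X.obj r) = Nat.card {i // Alive (c i) r} :=
  Module.finrank_eq_nat_card_basis (B.basisAt r)

/-- Transition maps are injective as long as no bar ends. -/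
theorem map_injective (B : ExtBasis X c) {p q : ℝ} (h : p ≤ q)
    (hpq : ∀ i, Alive (c i) p → Alive (c i) q) : Function.Injective (X.map h) := by
  set w : {i // Alive (c i) p} → X.obj q := fun i =>
    X.map (hpq i.1 i.2).birthOf_le (B.elt i.1)
  have hw : LinearIndependent K w :=
    (B.linearIndependent q).comp (fun i : {i // Alive (c i) p} => ⟨i.1, hpq i.1 i.2⟩)
      fun i j hij => Subtype.ext (congrArg Subtype.val hij :)
  have : X.map h = Finsupp.linearCombination K w ∘ₗ (B.basisAt p).repr.toLinearMap := by
    refine (B.basisAt p).ext fun i => ?_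
    simp only [LinearMap.comp_apply, LinearEquiv.coe_coe, Module.Basis.repr_self,
      Finsupp.linearCombination_single, one_smul]
    rw [basisAt_apply, X.map_map]
  rw [this]
  exact fun a b hab => (B.basisAt p).repr.injective (hw hab)

/-- Transition maps are surjective as long as no bar begins. -/
theorem map_surjective (B : ExtBasis X c) {p q : ℝ} (h : p ≤ q)
    (hpq : ∀ i, Alive (c i) q → Alive (c i) p) : Function.Surjective (X.map h) := by
  rw [← LinearMap.range_eq_top, eq_top_iff]
  refine (B.span_eq q).trans (Submodule.span_le.2 ?_)
  rintro _ ⟨i, rfl⟩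
  exact ⟨X.map (hpq i.1 i.2).birthOf_le (B.elt i.1), X.map_map _ _ _⟩

/-- A basis element vanishes as soon as its bar has ended. At the height of the death itself this
holds since the transition map to a slightly larger height is injective. -/
theorem map_elt_eq_zero (B : ExtBasis X c) {i : Fin N} {r : ℝ} (h : birthOf (c i) ≤ r)
    (hr : ¬ Alive (c i) r) : X.map h (B.elt i) = 0 := by
  by_cases hi : c i = none
  · rw [B.elt_zero i hi, map_zero]
  have hd : deathOf (c i) ≤ r := by
    by_contra! hlt
    exact hr (alive_iff.2 ⟨hi, h, hlt⟩)
  have hev : ∀ᶠ q in 𝓝[>] r, ∀ j, Alive (c j) r → Alive (c j) q := by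
    rw [eventually_all]
    intro j
    by_cases hj : Alive (c j) r
    · have hj' := alive_iff.1 hj
      have h1 : ∀ᶠ q : ℝ in 𝓝 r, (q : EReal) < deathOf (c j) :=
        (continuous_coe_real_ereal.tendsto r).eventually (gt_mem_nhds hj'.2.2)
      filter_upwards [nhdsWithin_le_nhds h1, self_mem_nhdsWithin] with q hq hq' _
      exact alive_iff.2 ⟨hj'.1, hj'.2.1.trans (le_of_lt hq'), hq⟩
    · simp [hj]
  obtain ⟨q, hq, hrq⟩ := (hev.and self_mem_nhdsWithin).exists
  have hrq : r < q := hrq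
  apply B.map_injective hrq.le hq
  rw [X.map_map, map_zero]
  have hlt : X.death (B.elt i) < (q : EReal) := by
    rw [B.death_eq i hi]
    exact hd.trans_lt (by exact_mod_cast hrq)
  obtain ⟨_, ⟨s, ⟨hs, hs0⟩, rfl⟩, hsq⟩ := sInf_lt_iff.1 hlt
  have hsq' : s < q := by simpa using hsq
  rw [← X.map_map hs.le hsq'.le, hs0, map_zero]

/-- Elements that vanish at the end of their bars and whose images form a basis at every height
constitute an extended basis: the conditions on births and deaths are automatic. -/
def ofBasis (elt : ∀ i, X.obj (birthOf (c i))) (elt_zero : ∀ i, c i = none → elt i = 0)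
    (dies : ∀ i r (h : birthOf (c i) ≤ r), ¬ Alive (c i) r → X.map h (elt i) = 0)
    (basis : ∀ r : ℝ,
      LinearIndependent K (fun i : {i // Alive (c i) r} => X.map i.2.birthOf_le (elt i.1)) ∧
      Submodule.span K
        (Set.range fun i : {i // Alive (c i) r} => X.map i.2.birthOf_le (elt i.1)) = ⊤) :
    ExtBasis X c where
  elt := elt
  elt_zero := elt_zero
  isBorn i hi s hs := by
    -- An element coming from an earlier height is a combination of elements alive there,
    -- which does not involve the `i`-th one.
    rintro ⟨z, hz⟩
    have hz' : z ∈ Submodule.span K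
        (Set.range fun i : {i // Alive (c i) s} => X.map i.2.birthOf_le (elt i.1)) := by
      rw [(basis s).2]; trivial
    have hai := alive_birthOf hi
    have key : elt i ∈ Submodule.span K
        ((fun j : {j // Alive (c j) (birthOf (c i))} => X.map j.2.birthOf_le (elt j.1)) ''
          {j | j ≠ ⟨i, hai⟩}) := by
      rw [← hz]
      have := Submodule.mem_map_of_mem (f := X.map hs.le) hz'
      rw [Submodule.map_span] at this
      refine Submodule.span_le.2 ?_ this
      rintro _ ⟨_, ⟨j, rfl⟩, rfl⟩
      simp only [X.map_map]
      by_cases hj : Alive (c j.1) (birthOf (c i))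
      · refine Submodule.subset_span ⟨⟨j.1, hj⟩, ?_, rfl⟩
        rintro hji
        have : j.1 = i := congrArg Subtype.val hji
        have h2 := j.2.birthOf_le
        rw [this] at h2
        exact absurd h2 (not_le.2 hs)
      · rw [dies _ _ _ hj]
        exact zero_mem _
    have hni := (basis (birthOf (c i))).1.notMem_span_image (x := ⟨i, hai⟩)
      (s := {j | j ≠ ⟨i, hai⟩}) (by simp)
    simp only [X.map_refl] at hni
    exact hni key
  death_eq i hi := by
    have hai := alive_iff.1 (alive_birthOf hi)
    have hset : {s : ℝ | ∃ h : birthOf (c i) < s, X.map h.le (elt i) = 0} =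
        {s : ℝ | deathOf (c i) ≤ s} := by
      ext s
      constructor
      · rintro ⟨hs, h0⟩
        by_contra hlt
        have hal : Alive (c i) s := alive_iff.2 ⟨hi, hs.le, not_le.1 hlt⟩
        exact (basis s).1.ne_zero ⟨i, hal⟩ h0
      · intro hs
        have hbs : birthOf (c i) < s := by exact_mod_cast hai.2.2.trans_le hs
        exact ⟨hbs, dies i s hbs.le fun hal => absurd (alive_iff.1 hal).2.2 (not_lt.2 hs)⟩
    rw [PersistenceModule.death, hset]
    refine le_antisymm ?_ (le_sInf ?_)
    · rcases eq_or_ne (deathOf (c i)) ⊤ with h | h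
      · rw [h]; exact le_top
      · have hbot : deathOf (c i) ≠ ⊥ := ne_bot_of_gt hai.2.2
        have hcoe := EReal.coe_toReal h hbot
        exact sInf_le ⟨(deathOf (c i)).toReal, hcoe.ge, hcoe⟩
    · rintro _ ⟨s, hs, rfl⟩
      exact hs
  linearIndependent r := (basis r).1
  span_eq r := (basis r).2.ge

open Classical in
/-- The combination at height `q` of the basis elements born by then, with coefficients `m`. -/
def combo (B : ExtBasis X c) (q : ℝ) : (Fin N → K) →ₗ[K] X.obj q where
  toFun m := ∑ j, if h : birthOf (c j) ≤ q then m j • X.map h (B.elt j) else 0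
  map_add' m m' := by
    rw [← Finset.sum_add_distrib]
    refine Finset.sum_congr rfl fun j _ => ?_
    split_ifs <;> simp [add_smul]
  map_smul' a m := by
    rw [RingHom.id_apply, Finset.smul_sum]
    refine Finset.sum_congr rfl fun j _ => ?_
    split_ifs <;> simp [mul_smul]

open Classical in
theorem combo_apply (B : ExtBasis X c) (q : ℝ) (m : Fin N → K) :
    B.combo q m = ∑ j, if h : birthOf (c j) ≤ q then m j • X.map h (B.elt j) else 0 := rfl

/-- Only the elements alive at height `q` contribute to a combination there. -/
theorem combo_eq_sum_basisAt (B : ExtBasis X c) (q : ℝ) [Fintype {i // Alive (c i) q}]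
    (m : Fin N → K) : B.combo q m = ∑ j, m j.1 • B.basisAt q j := by
  classical
  rw [combo_apply]
  have h1 : ∀ j, (if h : birthOf (c j) ≤ q then m j • X.map h (B.elt j) else 0) =
      if h : Alive (c j) q then m j • B.basisAt q ⟨j, h⟩ else 0 := by
    intro j
    by_cases hj : Alive (c j) q
    · rw [dif_pos hj.birthOf_le, dif_pos hj, basisAt_apply]
    · rw [dif_neg hj]
      split_ifs with h
      · rw [B.map_elt_eq_zero h hj, smul_zero]
      · rfl
  rw [Finset.sum_congr rfl fun j _ => h1 j]
  symm
  rw [← Finset.sum_subset (Finset.subset_univ (Finset.univ.filter fun j => Alive (c j) q))]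
  · rw [Finset.sum_subtype (p := fun j => Alive (c j) q) _ (by simp)]
    exact Finset.sum_congr rfl fun j _ => by rw [dif_pos j.2]
  · intro j _ hj
    rw [dif_neg (by simpa using hj)]

theorem repr_combo (B : ExtBasis X c) (q : ℝ) (m : Fin N → K) (j : {i // Alive (c i) q}) :
    (B.basisAt q).repr (B.combo q m) j = m j.1 := by
  have := Fintype.ofFinite {i // Alive (c i) q}
  rw [combo_eq_sum_basisAt, Module.Basis.repr_sum_self (B.basisAt q) fun j => m j.1]

theorem eq_combo (B : ExtBasis X c) {q : ℝ} {z : X.obj q} {m : Fin N → K}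
    (h : ∀ j : {i // Alive (c i) q}, (B.basisAt q).repr z j = m j.1) : z = B.combo q m := by
  refine (B.basisAt q).repr.injective (Finsupp.ext fun j => ?_)
  rw [h, repr_combo]

theorem map_combo (B : ExtBasis X c) {p q : ℝ} (h : p ≤ q) {m : Fin N → K}
    (hm : ∀ j, m j ≠ 0 → c j ≠ none → birthOf (c j) ≤ p) :
    X.map h (B.combo p m) = B.combo q m := by
  classical
  rw [combo_apply, combo_apply, map_sum]
  refine Finset.sum_congr rfl fun j _ => ?_
  by_cases hj : c j = none
  · rw [B.elt_zero j hj]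
    split_ifs <;> simp
  by_cases hmj : m j = 0
  · rw [hmj]
    split_ifs <;> simp
  have hp := hm j hmj hj
  rw [dif_pos hp, dif_pos (hp.trans h), map_smul, X.map_map]

theorem combo_single (B : ExtBasis X c) {q : ℝ} {i : Fin N} (h : birthOf (c i) ≤ q) (a : K) :
    B.combo q (Pi.single i a) = a • X.map h (B.elt i) := by
  classical
  rw [combo_apply, Finset.sum_eq_single i]
  · rw [dif_pos h, Pi.single_eq_same]
  · intro j _ hj
    rw [Pi.single_eq_of_ne hj]
    split_ifs <;> simp
  · simp

theorem combo_congr (B : ExtBasis X c) {q : ℝ} {m m' : Fin N → K}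
    (h : ∀ j, Alive (c j) q → m j = m' j) : B.combo q m = B.combo q m' :=
  B.eq_combo fun j => by rw [repr_combo, h j.1 j.2]

end ExtBasis

/-! ### Basis transformations -/

theorem transform_eq_combo {M : Matrix (Fin N) (Fin N) K} {B : ExtBasis X c} {i : Fin N}
    (hi : c i ≠ none) : transform M B i = B.combo (birthOf (c i)) fun j => M j i := by
  rw [transform, if_neg hi, ExtBasis.combo_apply]

/-- Only the entries of a matrix between labels that carry a bar matter. -/
theorem transform_congr {M M' : Matrix (Fin N) (Fin N) K} {B : ExtBasis X c}
    (h : ∀ i j, c i ≠ none → c j ≠ none → M j i = M' j i) (i : Fin N) :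
    transform M B i = transform M' B i := by
  by_cases hi : c i = none
  · simp [transform, hi]
  · rw [transform_eq_combo hi, transform_eq_combo hi]
    exact B.combo_congr fun j hj => h i j hi hj.ne_none

theorem IsBasisTransformation.congr {M M' : Matrix (Fin N) (Fin N) K}
    (hM : IsBasisTransformation c M)
    (h : ∀ i j, c i ≠ none → c j ≠ none → M j i = M' j i) : IsBasisTransformation c M' := by
  refine ⟨fun i hi => h i i hi hi ▸ hM.1 i hi, fun i j I J hI hJ hji => hM.2 i j I J hI hJ ?_⟩
  rwa [h i j (by simp [hI]) (by simp [hJ])]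

/-- The bars of the labels alive at a given height, as an injective labelling by a partial order. -/
theorem bar_injective (hc : ∀ i j, c i ≠ none → c i = c j → i = j) (r : ℝ) :
    Function.Injective fun i : {i // Alive (c i) r} =>
      (c i.1).get (Option.isSome_iff_ne_none.2 i.2.ne_none) := by
  intro i j hij
  refine Subtype.ext (hc _ _ i.2.ne_none ?_)
  exact Option.get_inj.1 hij

theorem map_transform {M : Matrix (Fin N) (Fin N) K} (hM : IsBasisTransformation c M)
    (B : ExtBasis X c) {i : Fin N} (hi : c i ≠ none) {q : ℝ} (h : birthOf (c i) ≤ q) :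
    X.map h (transform M B i) = B.combo q fun j => M j i := by
  rw [transform_eq_combo hi]
  refine B.map_combo h fun j hj hcj => ?_
  obtain ⟨I, hI⟩ := Option.ne_none_iff_exists'.1 hi
  obtain ⟨J, hJ⟩ := Option.ne_none_iff_exists'.1 hcj
  have := (hM.2 i j I J hI hJ hj).1
  simpa [hI, hJ, birthOf] using this

/-- Basis transformation matrices transform extended bases into extended bases. -/
theorem exists_isTransformOf (hc : ∀ i j, c i ≠ none → c i = c j → i = j)
    {M : Matrix (Fin N) (Fin N) K} (hM : IsBasisTransformation c M) (B : ExtBasis X c) :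
    ∃ B' : ExtBasis X c, IsTransformOf B' M B := by
  refine ⟨ExtBasis.ofBasis (transform M B) (fun i hi => by simp [transform, hi]) ?_ ?_, hM,
    fun i => rfl⟩
  · intro i r h hr
    by_cases hi : c i = none
    · simp [transform, hi]
    rw [map_transform hM B hi h, ← map_zero (B.combo r)]
    refine B.combo_congr fun j hj => ?_
    by_contra hji
    apply hr
    obtain ⟨I, hI⟩ := Option.ne_none_iff_exists'.1 hi
    obtain ⟨J, hJ, h1, h2⟩ := hj
    have hle := hM.2 i j I J hI hJ hji
    refine ⟨I, hI, ?_, h2.trans_le hle.2⟩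
    simpa [hI, birthOf] using h
  · intro r
    have hrepr : ∀ i j : {i // Alive (c i) r}, (B.basisAt r).repr
        (X.map i.2.birthOf_le (transform M B i.1)) j = M j.1 i.1 := by
      intro i j
      rw [map_transform hM B i.2.ne_none, ExtBasis.repr_combo]
    refine (basis_iff_diag_ne_zero (bar_injective hc r) (B.basisAt r) ?_).2 ?_
    · intro i j hij
      rw [hrepr] at hij
      exact hM.2 i.1 j.1 _ _ (Option.some_get _).symm (Option.some_get _).symm hij
    · intro i
      rw [hrepr]
      exact hM.1 i.1 i.2.ne_none

end

/-! ### Shift morphisms in extended bases -/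

section

variable {K : Type u} [Field K] {N : ℕ} {X Y : PersistenceModule.{u, v} K}
  {c c' : Fin N → Option Bar} {h : ℝ}

theorem matrixOf_apply_of_alive {B : ExtBasis X c} {B' : ExtBasis Y c'} {α : ShiftMorphism X Y h}
    {i j : Fin N} (hj : Alive (c' j) (birthOf (c i) + h)) :
    matrixOf B B' α j i =
      (B'.basisAt (birthOf (c i) + h)).repr (α.app (birthOf (c i)) (B.elt i)) ⟨j, hj⟩ := by
  simp [matrixOf, hj]

theorem matrixOf_apply_of_not_alive {B : ExtBasis X c} {B' : ExtBasis Y c'}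
    {α : ShiftMorphism X Y h} {i j : Fin N} (hj : ¬ Alive (c' j) (birthOf (c i) + h)) :
    matrixOf B B' α j i = 0 := by
  simp [matrixOf, hj]

theorem matrixOf_apply_of_eq_none {B : ExtBasis X c} {B' : ExtBasis Y c'}
    {α : ShiftMorphism X Y h} {i j : Fin N} (hi : c i = none) : matrixOf B B' α j i = 0 := by
  by_cases hj : Alive (c' j) (birthOf (c i) + h)
  · rw [matrixOf_apply_of_alive hj, B.elt_zero i hi]
    simp
  · exact matrixOf_apply_of_not_alive hj

theorem matrixOf_apply_of_eq_combo {B : ExtBasis X c} {B' : ExtBasis Y c'}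
    {α : ShiftMorphism X Y h} {i j : Fin N} {m : Fin N → K}
    (hm : α.app (birthOf (c i)) (B.elt i) = B'.combo (birthOf (c i) + h) m)
    (hj : Alive (c' j) (birthOf (c i) + h)) : matrixOf B B' α j i = m j := by
  rw [matrixOf_apply_of_alive hj, hm, ExtBasis.repr_combo]

theorem app_elt (B : ExtBasis X c) (B' : ExtBasis Y c') (α : ShiftMorphism X Y h) (i : Fin N) :
    α.app (birthOf (c i)) (B.elt i) =
      B'.combo (birthOf (c i) + h) fun j => matrixOf B B' α j i :=
  B'.eq_combo fun j => (matrixOf_apply_of_alive j.2).symm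

theorem app_map_elt (B : ExtBasis X c) (B' : ExtBasis Y c') (α : ShiftMorphism X Y h) (i : Fin N)
    {r : ℝ} (hr : birthOf (c i) ≤ r) :
    α.app r (X.map hr (B.elt i)) = B'.combo (r + h) fun j => matrixOf B B' α j i := by
  rw [α.naturality, app_elt B B']
  refine B'.map_combo _ fun j hj _ => ?_
  by_contra hlt
  exact hj (matrixOf_apply_of_not_alive fun hal => hlt hal.birthOf_le)

theorem IsInterleaving.symm {hh : 0 ≤ h} {α : ShiftMorphism X Y h} {β : ShiftMorphism Y X h}
    (H : IsInterleaving hh α β) : IsInterleaving hh β α := ⟨H.2, H.1⟩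

theorem IsInterleaving.app_injective {hh : 0 ≤ h} {α : ShiftMorphism X Y h}
    {β : ShiftMorphism Y X h} (H : IsInterleaving hh α β) (B : ExtBasis X c) {p : ℝ}
    (hp : ∀ i, Alive (c i) p → Alive (c i) (p + h + h)) : Function.Injective (α.app p) := by
  have hinj := B.map_injective (show p ≤ p + h + h by linarith) hp
  intro x y hxy
  apply hinj
  rw [← H.1, ← H.1, hxy]

theorem IsInterleaving.app_surjective {hh : 0 ≤ h} {α : ShiftMorphism X Y h}
    {β : ShiftMorphism Y X h} (H : IsInterleaving hh α β) (B : ExtBasis Y c) {p : ℝ}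
    (hp : ∀ i, Alive (c i) (p + h + h) → Alive (c i) p) : Function.Surjective (α.app (p + h)) := by
  intro y
  obtain ⟨z, rfl⟩ := B.map_surjective (show p ≤ p + h + h by linarith) hp y
  exact ⟨β.app p z, H.2 p z⟩

/-- An interleaving bounds the number of bars that are alive over a long enough range of heights. -/
theorem IsInterleaving.card_alive_le {hh : 0 ≤ h} {α : ShiftMorphism X Y h}
    {β : ShiftMorphism Y X h} (H : IsInterleaving hh α β) (B : ExtBasis X c) (B' : ExtBasis Y c')
    {p : ℝ} (hp : ∀ i, Alive (c i) p → Alive (c i) (p + h + h)) :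
    Nat.card {i // Alive (c i) p} ≤ Nat.card {i // Alive (c' i) (p + h)} := by
  rw [← B.finrank_obj, ← B'.finrank_obj]
  have : Module.Finite K (Y.obj (p + h)) := Module.Finite.of_basis (B'.basisAt (p + h))
  exact LinearMap.finrank_le_finrank_of_injective (H.app_injective B hp)

/-- If the target has no bars at `p + h` other than those at `p` in the source, it has all of them,
as there are at least as many. -/
theorem IsInterleaving.alive_of_forall_alive {hh : 0 ≤ h} {α : ShiftMorphism X Y h}
    {β : ShiftMorphism Y X h} (H : IsInterleaving hh α β) (B : ExtBasis X c) (B' : ExtBasis Y c')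
    {p : ℝ} (hp : ∀ i, Alive (c i) p → Alive (c i) (p + h + h))
    (hle : ∀ i, Alive (c' i) (p + h) → Alive (c i) p) {i : Fin N} (hi : Alive (c i) p) :
    Alive (c' i) (p + h) := by
  have hcard := H.card_alive_le B B' hp
  have hsub : {i | Alive (c' i) (p + h)} ⊆ {i | Alive (c i) p} := hle
  have := Set.eq_of_subset_of_ncard_le hsub hcard
  exact (this ▸ hi : i ∈ {i | Alive (c' i) (p + h)})

/-- If the critical values of the source are well separated compared to the shift `h`, the matrix
of an interleaving morphism is triangular for the order of the bars of the source, with non-zero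
diagonal entries. The hypotheses express the separation in terms of which bars are alive. -/
theorem IsInterleaving.matrixOf_triangular {hh : 0 ≤ h} {α : ShiftMorphism X Y h}
    {β : ShiftMorphism Y X h} (H : IsInterleaving hh α β) (B : ExtBasis X c) (B' : ExtBasis Y c')
    (hc : ∀ i j, c i ≠ none → c i = c j → i = j)
    (h_alive : ∀ i, c i ≠ none → ∀ j,
      Alive (c' j) (birthOf (c i) + h) ↔ Alive (c j) (birthOf (c i)))
    (h_long : ∀ i, c i ≠ none → ∀ j,
      Alive (c j) (birthOf (c i)) → Alive (c j) (birthOf (c i) + h + h))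
    (h_death : ∀ i, c i ≠ none → ∀ q : ℝ, deathOf (c i) = q → ∀ j,
      Alive (c j) q → Alive (c' j) (q + h)) :
    (∀ i j, matrixOf B B' α j i ≠ 0 → ∃ I J, c i = some I ∧ c j = some J ∧ J ≤ I) ∧
      ∀ i, c i ≠ none → matrixOf B B' α i i ≠ 0 := by
  have tri : ∀ i j, matrixOf B B' α j i ≠ 0 → ∃ I J, c i = some I ∧ c j = some J ∧ J ≤ I := by
    intro i j hji
    have hi : c i ≠ none := fun hi => hji (matrixOf_apply_of_eq_none hi)
    have hj' : Alive (c' j) (birthOf (c i) + h) := by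
      by_contra hj'
      exact hji (matrixOf_apply_of_not_alive hj')
    have hj := (h_alive i hi j).1 hj'
    obtain ⟨I, hI⟩ := Option.ne_none_iff_exists'.1 hi
    obtain ⟨J, hJ, hJb, hJd⟩ := id hj
    have hIb : birthOf (c i) = I.birth := by rw [hI]; rfl
    rw [hIb] at hJb hJd
    refine ⟨I, J, hI, hJ, hJb, ?_⟩
    by_contra! hlt
    have htop : I.death ≠ ⊤ := ne_top_of_lt hlt
    have hbot : I.death ≠ ⊥ := ne_bot_of_gt I.birth_lt_death
    have hq := EReal.coe_toReal htop hbot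
    set q := I.death.toReal
    have hbq : I.birth < q := by
      have := I.birth_lt_death
      rw [← hq] at this
      exact_mod_cast this
    have hjq : Alive (c' j) (q + h) :=
      h_death i hi q (by rw [hI, hq]; rfl) j ⟨J, hJ, hJb.trans hbq.le, by rwa [hq]⟩
    have hzero : X.map (show birthOf (c i) ≤ q by rw [hIb]; exact hbq.le) (B.elt i) = 0 := by
      refine B.map_elt_eq_zero _ fun hal => ?_
      rw [hI, alive_some, hq] at hal
      exact lt_irrefl _ hal.2
    have h0 := app_map_elt B B' α i (show birthOf (c i) ≤ q by rw [hIb]; exact hbq.le)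
    rw [hzero, map_zero] at h0
    apply hji
    rw [← B'.repr_combo (q + h) (fun j => matrixOf B B' α j i) ⟨j, hjq⟩, ← h0]
    simp
  refine ⟨tri, fun i hi => ?_⟩
  set p := birthOf (c i)
  have hal : ∀ j, Alive (c' j) (p + h) ↔ Alive (c j) p := h_alive i hi
  set w : {l // Alive (c' l) (p + h)} → Y.obj (p + h) := fun l =>
    α.app p (X.map ((hal l.1).1 l.2).birthOf_le (B.elt l.1))
  have hrepr : ∀ l j, (B'.basisAt (p + h)).repr (w l) j = matrixOf B B' α j.1 l.1 := by
    intro l j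
    simp only [w]
    rw [app_map_elt B B', ExtBasis.repr_combo]
  have hw : LinearIndependent K w :=
    ((B.linearIndependent p).comp
      (fun l : {l // Alive (c' l) (p + h)} => (⟨l.1, (hal l.1).1 l.2⟩ : {l // Alive (c l) p}))
      fun l m hlm => Subtype.ext (congrArg Subtype.val hlm :)).map'
        (α.app p) (LinearMap.ker_eq_bot.2 (H.app_injective B (h_long i hi)))
  have hspan : Submodule.span K (Set.range w) = ⊤ := by
    have := Fintype.ofFinite {l // Alive (c' l) (p + h)}
    have : Module.Finite K (Y.obj (p + h)) := Module.Finite.of_basis (B'.basisAt (p + h))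
    refine hw.span_eq_top_of_card_eq_finrank' ?_
    rw [B'.finrank_obj, Nat.card_eq_fintype_card]
  have key := (basis_iff_diag_ne_zero
    (f := fun l : {l // Alive (c' l) (p + h)} =>
      (c l.1).get (Option.isSome_iff_ne_none.2 ((hal l.1).1 l.2).ne_none)) ?_
    (B'.basisAt (p + h)) ?_).1 ⟨hw, hspan⟩ ⟨i, (hal i).2 (alive_birthOf hi)⟩
  · rwa [hrepr] at key
  · intro l m hlm
    exact Subtype.ext (hc _ _ ((hal l.1).1 l.2).ne_none (Option.get_inj.1 hlm))
  · intro l j hlj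
    rw [hrepr] at hlj
    obtain ⟨I, J, hI, hJ, hJI⟩ := tri _ _ hlj
    simpa [hI, hJ] using hJI

/-- The identity as a `0`-morphism. -/
def idShift (X : PersistenceModule.{u, v} K) : ShiftMorphism X X 0 where
  app r := X.map (by simp)
  naturality h x := by rw [X.map_map, X.map_map]

theorem isInterleaving_idShift (X : PersistenceModule.{u, v} K) :
    IsInterleaving le_rfl (idShift X) (idShift X) :=
  ⟨fun _ _ => X.map_map _ _ _, fun _ _ => X.map_map _ _ _⟩

/-- Any two extended bases for the same barcode differ by a basis transformation. -/
theorem isTransformOf_matrixOf_idShift (hc : ∀ i j, c i ≠ none → c i = c j → i = j)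
    (B' B : ExtBasis X c) : IsTransformOf B' (matrixOf B' B (idShift X)) B := by
  obtain ⟨h1, h2⟩ := (isInterleaving_idShift X).matrixOf_triangular B' B hc
    (fun i _ j => by rw [add_zero]) (fun i _ j hj => by rwa [add_zero, add_zero])
    (fun i _ q _ j hj => by rwa [add_zero])
  refine ⟨⟨h2, fun i j I J hI hJ hji => ?_⟩, fun i => ?_⟩
  · obtain ⟨I', J', hI', hJ', hle⟩ := h1 i j hji
    rw [hI] at hI'
    rw [hJ] at hJ'
    cases hI'
    cases hJ'
    exact hle
  · by_cases hi : c i = none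
    · rw [B'.elt_zero i hi, transform, if_pos hi]
    · rw [transform_eq_combo hi]
      apply B.map_injective (show birthOf (c i) ≤ birthOf (c i) + 0 by simp)
        (fun j hj => by rwa [add_zero])
      rw [B.map_combo]
      · exact app_elt B' B (idShift X) i
      · intro j hj _
        by_contra hlt
        exact hj (matrixOf_apply_of_not_alive fun hal => hlt (by simpa using hal.birthOf_le))

/-! ### Morphisms that carry one basis to another -/

/-- `α` sends each element of `B` to the image of the element of `B'` with the same label (to zero
if that label carries no bar). The image is expressed as a combination with a single coefficient,
which would be zero if the element of `B'` were born later; the last condition excludes this. -/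
def Carries (α : ShiftMorphism X Y h) (B : ExtBasis X c) (B' : ExtBasis Y c') : Prop :=
  ∀ i, c i ≠ none →
    α.app (birthOf (c i)) (B.elt i) = B'.combo (birthOf (c i) + h) (Pi.single i 1) ∧
    (c' i ≠ none → birthOf (c' i) ≤ birthOf (c i) + h)

theorem ExtBasis.combo_single_of_eq_none (B : ExtBasis X c) {q : ℝ} {i : Fin N} (hi : c i = none)
    (a : K) : B.combo q (Pi.single i a) = 0 := by
  rw [← map_zero (B.combo q)]
  refine B.combo_congr fun j hj => ?_
  have : j ≠ i := by
    rintro rfl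
    exact hj.ne_none hi
  simp [this]

/-- For a carried basis, the matrix is a projection once the bars are longer than the shift. -/
theorem Carries.matrixOf_eq {α : ShiftMorphism X Y h} {B : ExtBasis X c} {B' : ExtBasis Y c'}
    (H : Carries α B B')
    (hal : ∀ i, c i ≠ none → c' i ≠ none → Alive (c' i) (birthOf (c i) + h)) :
    matrixOf B B' α = projMatrix ({i | c i ≠ none} ∩ {i | c' i ≠ none}) := by
  classical
  ext j i
  rw [projMatrix, Matrix.diagonal_apply]
  by_cases hi : c i = none
  · rw [matrixOf_apply_of_eq_none hi]
    split_ifs with hji hj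
    · subst hji
      exact absurd hi hj.1
    · rfl
    · rfl
  by_cases hj : Alive (c' j) (birthOf (c i) + h)
  · rw [matrixOf_apply_of_eq_combo (H i hi).1 hj]
    by_cases hji : j = i
    · subst hji
      rw [if_pos rfl, if_pos ⟨hi, hj.ne_none⟩, Pi.single_eq_same]
    · rw [if_neg hji, Pi.single_eq_of_ne hji]
  · rw [matrixOf_apply_of_not_alive hj]
    split_ifs with hji hj'
    · subst hji
      exact absurd (hal j hj'.1 hj'.2) hj
    · rfl
    · rfl

/-! ### Critical values of a barcode -/

/-- The real numbers `x (i, false)`, `x (i, true)` are the births and the finite deaths of the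
labelled barcode `c`, where `S` is the set of the labels considered and `Inf` the set of those with
infinite death. A label of `S` may also have an empty bar, of length zero. -/
structure HasValues (S Inf : Set (Fin N)) (c : Fin N → Option Bar) (x : Fin N × Bool → ℝ) :
    Prop where
  birth : ∀ i I, c i = some I → I.birth = x (i, false)
  death : ∀ i I, c i = some I → i ∉ Inf → I.death = (x (i, true) : EReal)
  death_top : ∀ i I, c i = some I → i ∈ Inf → I.death = ⊤
  present_iff : ∀ i, c i ≠ none ↔ i ∈ S ∧ (i ∈ Inf ∨ x (i, false) < x (i, true))
  le : ∀ i, i ∈ S → i ∉ Inf → x (i, false) ≤ x (i, true)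

/-- The labels of critical values: births of the labels in `S` and deaths of those among them that
do not lie in `Inf`. -/
def valueLabels (S Inf : Set (Fin N)) : Set (Fin N × Bool) :=
  {e | e.1 ∈ S ∧ (e.2 = true → e.1 ∉ Inf)}

variable {S Inf : Set (Fin N)} {x y z : Fin N × Bool → ℝ}

theorem birth_mem_valueLabels {i : Fin N} (hi : i ∈ S) : (i, false) ∈ valueLabels S Inf :=
  ⟨hi, by simp⟩

theorem death_mem_valueLabels {i : Fin N} (hi : i ∈ S) (hi' : i ∉ Inf) :
    (i, true) ∈ valueLabels S Inf :=
  ⟨hi, fun _ => hi'⟩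

namespace HasValues

theorem birthOf_eq (hx : HasValues S Inf c x) {i : Fin N} (hi : c i ≠ none) :
    birthOf (c i) = x (i, false) := by
  obtain ⟨I, hI⟩ := Option.ne_none_iff_exists'.1 hi
  rw [hI]
  exact hx.birth i I hI

theorem alive_iff (hx : HasValues S Inf c x) {i : Fin N} {r : ℝ} :
    Alive (c i) r ↔ i ∈ S ∧ x (i, false) ≤ r ∧ (i ∈ Inf ∨ r < x (i, true)) := by
  constructor
  · rintro ⟨I, hI, h1, h2⟩
    have hi := (hx.present_iff i).1 (by simp [hI])
    refine ⟨hi.1, hx.birth i I hI ▸ h1, ?_⟩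
    by_cases hInf : i ∈ Inf
    · exact Or.inl hInf
    · rw [hx.death i I hI hInf] at h2
      exact Or.inr (by exact_mod_cast h2)
  · rintro ⟨hS, h1, h2⟩
    have hi : c i ≠ none := (hx.present_iff i).2 ⟨hS, h2.imp_right h1.trans_lt⟩
    obtain ⟨I, hI⟩ := Option.ne_none_iff_exists'.1 hi
    refine ⟨I, hI, hx.birth i I hI ▸ h1, ?_⟩
    by_cases hInf : i ∈ Inf
    · rw [hx.death_top i I hI hInf]
      exact EReal.coe_lt_top r
    · rw [hx.death i I hI hInf]
      exact_mod_cast h2.resolve_left hInf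

theorem mem_of_present (hx : HasValues S Inf c x) {i : Fin N} (hi : c i ≠ none) : i ∈ S :=
  ((hx.present_iff i).1 hi).1

/-- The order of bars in terms of their critical values. -/
theorem le_iff (hx : HasValues S Inf c x) {i j : Fin N} {I J : Bar} (hI : c i = some I)
    (hJ : c j = some J) :
    J ≤ I ↔ x (j, false) ≤ x (i, false) ∧
      (i ∈ Inf ∨ j ∉ Inf ∧ x (j, true) ≤ x (i, true)) := by
  change J.birth ≤ I.birth ∧ J.death ≤ I.death ↔ _
  rw [hx.birth i I hI, hx.birth j J hJ]
  refine and_congr_right fun _ => ?_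
  by_cases hi : i ∈ Inf
  · simp [hi, hx.death_top i I hI hi]
  · by_cases hj : j ∈ Inf
    · simp [hi, hj, hx.death i I hI hi, hx.death_top j J hJ hj]
    · simp [hi, hj, hx.death i I hI hi, hx.death j J hJ hj]

end HasValues

/-- If all critical values of both barcodes stay near pairwise well separated values, then an
interleaving with a small parameter `h` moves births up and deaths down by at most `h`. Otherwise
the rank of the interleaving morphism near the offending value would be too large. -/
theorem IsInterleaving.values_le {hh : 0 ≤ h} {α : ShiftMorphism X Y h} {β : ShiftMorphism Y X h}
    (H : IsInterleaving hh α β) (B : ExtBasis X c) (B' : ExtBasis Y c')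
    (hx : HasValues S Inf c x) (hy : HasValues S Inf c' y) {η : ℝ} (_ : h ≤ η)
    (hxz : ∀ e ∈ valueLabels S Inf, |x e - z e| ≤ η)
    (hyz : ∀ e ∈ valueLabels S Inf, |y e - z e| ≤ η)
    (hz : ∀ e ∈ valueLabels S Inf, ∀ e' ∈ valueLabels S Inf, e ≠ e' → 8 * η < |z e - z e'|)
    {i : Fin N} (hi : i ∈ S) :
    y (i, false) ≤ x (i, false) + h ∧ (i ∉ Inf → x (i, true) ≤ y (i, true) + h) := by
  simp only [abs_le] at hxz hyz
  constructor
  · by_contra! hlt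
    have hib := birth_mem_valueLabels (Inf := Inf) hi
    have hi1 := hxz _ hib
    have hi2 := hyz _ hib
    have hal : Alive (c i) (x (i, false)) := by
      refine hx.alive_iff.2 ⟨hi, le_rfl, ?_⟩
      by_cases hInf : i ∈ Inf
      · exact Or.inl hInf
      · have h1 := hx.le i hi hInf
        have hd := death_mem_valueLabels hi hInf
        have h2 := hz _ hib _ hd (by simp)
        have h3 := hxz _ hd
        rcases lt_abs.1 h2 with h2 | h2 <;> exact Or.inr (by linarith)
    have := H.alive_of_forall_alive B B' (p := x (i, false)) ?_ ?_ hal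
    · exact absurd (hy.alive_iff.1 this).2.1 (not_le.2 hlt)
    · intro j hj
      rw [hx.alive_iff] at hj ⊢
      refine ⟨hj.1, by linarith, ?_⟩
      by_cases hInf : j ∈ Inf
      · exact Or.inl hInf
      · have hd := death_mem_valueLabels hj.1 hInf
        have h1 := hj.2.2.resolve_left hInf
        have h2 := hz _ hib _ hd (by simp)
        have h3 := hxz _ hd
        rcases lt_abs.1 h2 with h2 | h2 <;> exact Or.inr (by linarith)
    · intro j hj
      rw [hy.alive_iff] at hj
      rw [hx.alive_iff]
      have hjb := birth_mem_valueLabels (Inf := Inf) hj.1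
      have hj1 := hxz _ hjb
      have hj2 := hyz _ hjb
      refine ⟨hj.1, ?_, ?_⟩
      · by_cases hji : j = i
        · rw [hji]
        · have h2 := hz _ hib _ hjb (by simpa using Ne.symm hji)
          rcases lt_abs.1 h2 with h2 | h2 <;> linarith
      · by_cases hInf : j ∈ Inf
        · exact Or.inl hInf
        · have hd := death_mem_valueLabels hj.1 hInf
          have h1 := hj.2.2.resolve_left hInf
          have h2 := hz _ hib _ hd (by simp)
          have h3 := hxz _ hd
          have h4 := hyz _ hd
          rcases lt_abs.1 h2 with h2 | h2 <;> exact Or.inr (by linarith)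
  · intro hiInf
    by_contra! hlt
    have hid := death_mem_valueLabels hi hiInf
    have hi1 := hxz _ hid
    have hi2 := hyz _ hid
    have hal : Alive (c i) (y (i, true) - h) := by
      refine hx.alive_iff.2 ⟨hi, ?_, Or.inr (by linarith)⟩
      have hib := birth_mem_valueLabels (Inf := Inf) hi
      have h1 := hx.le i hi hiInf
      have h2 := hz _ hib _ hid (by simp)
      have h3 := hxz _ hib
      rcases lt_abs.1 h2 with h2 | h2 <;> linarith
    have := H.alive_of_forall_alive B B' (p := y (i, true) - h) ?_ ?_ hal
    · have := (hy.alive_iff.1 this).2.2.resolve_left hiInf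
      linarith
    · intro j hj
      rw [hx.alive_iff] at hj ⊢
      refine ⟨hj.1, by linarith, ?_⟩
      by_cases hInf : j ∈ Inf
      · exact Or.inl hInf
      · have hd := death_mem_valueLabels hj.1 hInf
        have h1 := hj.2.2.resolve_left hInf
        by_cases hji : j = i
        · rw [hji]; exact Or.inr (by linarith)
        · have h2 := hz _ hid _ hd (by simpa using Ne.symm hji)
          have h3 := hxz _ hd
          rcases lt_abs.1 h2 with h2 | h2 <;> exact Or.inr (by linarith)
    · intro j hj
      rw [hy.alive_iff] at hj
      rw [hx.alive_iff]
      have hjb := birth_mem_valueLabels (Inf := Inf) hj.1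
      have hj1 := hxz _ hjb
      have hj2 := hyz _ hjb
      have hjne : j ≠ i := by
        rintro rfl
        have := hj.2.2.resolve_left hiInf
        linarith
      refine ⟨hj.1, ?_, ?_⟩
      · have h2 := hz _ hid _ hjb (by simp)
        rcases lt_abs.1 h2 with h2 | h2 <;> linarith
      · by_cases hInf : j ∈ Inf
        · exact Or.inl hInf
        · have hd := death_mem_valueLabels hj.1 hInf
          have h1 := hj.2.2.resolve_left hInf
          have h2 := hz _ hid _ hd (by simpa using Ne.symm hjne)
          have h3 := hxz _ hd
          have h4 := hyz _ hd
          rcases lt_abs.1 h2 with h2 | h2 <;> exact Or.inr (by linarith)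

end

/-! ### Transport of bases along interleaving morphisms -/

section

variable {K : Type u} [Field K] {N : ℕ} {X Y Z : PersistenceModule.{u, v} K}
  {c c' c'' : Fin N → Option Bar} {h : ℝ} {S Inf : Set (Fin N)} {x y : Fin N × Bool → ℝ}

theorem HasValues.alive_mono (hx : HasValues S Inf c x) {p q : ℝ} (hpq : p ≤ q)
    (hd : ∀ i ∈ S, i ∉ Inf → p < x (i, true) → q < x (i, true)) (i : Fin N)
    (hi : Alive (c i) p) : Alive (c i) q := by
  rw [hx.alive_iff] at hi ⊢
  refine ⟨hi.1, hi.2.1.trans hpq, ?_⟩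
  by_cases hInf : i ∈ Inf
  · exact Or.inl hInf
  · exact Or.inr (hd i hi.1 hInf (hi.2.2.resolve_left hInf))

theorem Carries.app_elt {α : ShiftMorphism X Y h} {B : ExtBasis X c} {B' : ExtBasis Y c'}
    (H : Carries α B B') {i : Fin N} (hi : c i ≠ none) (hi' : c' i ≠ none) :
    α.app (birthOf (c i)) (B.elt i) = Y.map ((H i hi).2 hi') (B'.elt i) := by
  have h2 := (H i hi).2 hi'
  have h1 : B'.combo (birthOf (c i) + h) (Pi.single i 1) = Y.map h2 (B'.elt i) := by
    rw [B'.combo_single h2, one_smul]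
  exact (H i hi).1.trans h1

theorem carries_iff {α : ShiftMorphism X Y h} {B : ExtBasis X c} {B' : ExtBasis Y c'} :
    Carries α B B' ↔ ∀ i, c i ≠ none →
      (c' i = none → α.app (birthOf (c i)) (B.elt i) = 0) ∧
      (c' i ≠ none → ∃ hle : birthOf (c' i) ≤ birthOf (c i) + h,
        α.app (birthOf (c i)) (B.elt i) = Y.map hle (B'.elt i)) := by
  refine forall₂_congr fun i hi => ?_
  by_cases hi' : c' i = none
  · simp [hi', B'.combo_single_of_eq_none hi']
  · constructor
    · rintro ⟨h1, h2⟩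
      refine ⟨fun h => absurd h hi', fun _ => ⟨h2 hi', ?_⟩⟩
      rw [h1, B'.combo_single (h2 hi'), one_smul]
    · rintro ⟨-, h2⟩
      obtain ⟨hle, h3⟩ := h2 hi'
      refine ⟨?_, fun _ => hle⟩
      rw [h3, B'.combo_single hle, one_smul]

theorem Carries.comp {h₁ h₂ h₃ : ℝ} {α : ShiftMorphism X Y h₁} {α' : ShiftMorphism Y Z h₂}
    {α'' : ShiftMorphism X Z h₃} {hle : ∀ r, r + h₁ + h₂ ≤ r + h₃}
    (hα : ∀ r (w : X.obj r), Z.map (hle r) (α'.app _ (α.app r w)) = α''.app r w)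
    {B : ExtBasis X c} {B' : ExtBasis Y c'} {B'' : ExtBasis Z c''} (H : Carries α B B')
    (H' : Carries α' B' B'') (hc : ∀ i, c i ≠ none → c' i ≠ none) : Carries α'' B B'' := by
  rw [carries_iff]
  intro i hi
  have hi' := hc i hi
  have hle₁ := (H i hi).2 hi'
  have key : α''.app (birthOf (c i)) (B.elt i) =
      Z.map ((add_le_add_left hle₁ h₂).trans (hle _)) (α'.app (birthOf (c' i)) (B'.elt i)) := by
    have happ : α.app (birthOf (c i)) (B.elt i) = Y.map hle₁ (B'.elt i) := H.app_elt hi hi'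
    rw [← hα, happ, α'.naturality, Z.map_map]
  have H'' := carries_iff.1 H' i hi'
  constructor
  · intro h0
    rw [key, H''.1 h0, map_zero]
  · intro h0
    obtain ⟨hle', h1⟩ := H''.2 h0
    refine ⟨hle'.trans ((add_le_add_left hle₁ h₂).trans (hle _)), ?_⟩
    rw [key, h1, Z.map_map]

/-- The target basis is determined by the source basis if no bar of the target ends between
the birth of a bar in the target and the height where it is compared with the source. -/
theorem Carries.unique_right {α : ShiftMorphism X Y h} {B : ExtBasis X c} {B' B'' : ExtBasis Y c'}
    (H : Carries α B B') (H' : Carries α B B'') (hc : ∀ i, c' i ≠ none → c i ≠ none)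
    (hal : ∀ i, c' i ≠ none → ∀ j,
      Alive (c' j) (birthOf (c' i)) → Alive (c' j) (birthOf (c i) + h)) : B' = B'' := by
  refine ExtBasis.ext_elt fun i => ?_
  by_cases hi : c' i = none
  · rw [B'.elt_zero i hi, B''.elt_zero i hi]
  · refine B'.map_injective ((H i (hc i hi)).2 hi) (hal i hi) ?_
    rw [← H.app_elt (hc i hi) hi, ← H'.app_elt (hc i hi) hi]

/-- The source basis is determined by the target basis if the morphism is injective at all births of
the source, which holds if no bar ends shortly after them. -/
theorem Carries.unique_left {hh : 0 ≤ h} {α : ShiftMorphism X Y h} {β : ShiftMorphism Y X h}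
    (HI : IsInterleaving hh α β) {B B'' : ExtBasis X c} {B' : ExtBasis Y c'}
    (H : Carries α B B') (H' : Carries α B'' B')
    (hal : ∀ i, c i ≠ none → ∀ j,
      Alive (c j) (birthOf (c i)) → Alive (c j) (birthOf (c i) + h + h)) : B = B'' := by
  refine ExtBasis.ext_elt fun i => ?_
  by_cases hi : c i = none
  · rw [B.elt_zero i hi, B''.elt_zero i hi]
  · refine HI.app_injective B (hal i hi) ?_
    rw [(H i hi).1, (H' i hi).1]

/-- A basis can be pushed along an interleaving morphism to a barcode whose critical values are
well separated compared to the shift `h`: the image of a basis element is pulled back to the birth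
height of the corresponding bar, where the transition map is surjective. -/
theorem IsInterleaving.exists_carries {hh : 0 ≤ h} {α : ShiftMorphism X Y h}
    {β : ShiftMorphism Y X h} (H : IsInterleaving hh α β) (B : ExtBasis X c) (B₀ : ExtBasis Y c')
    (hx : HasValues S Inf c x) (hy : HasValues S Inf c' y) (hS : ∀ i ∈ S, c i ≠ none)
    (hxy : ∀ e ∈ valueLabels S Inf, |x e - y e| ≤ h)
    (hgap : ∀ e ∈ valueLabels S Inf, ∀ e' ∈ valueLabels S Inf, y e ≠ y e' →
      2 * h < |y e - y e'|) :
    ∃ B' : ExtBasis Y c', Carries α B B' := by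
  simp only [abs_le] at hxy
  have hgap' : ∀ e ∈ valueLabels S Inf, ∀ e' ∈ valueLabels S Inf, y e < y e' →
      y e + 2 * h < y e' := by
    intro e he e' he' hlt
    rcases lt_abs.1 (hgap e he e' he' hlt.ne) with h1 | h1 <;> linarith
  have hpos : ∀ i ∈ S, birthOf (c i) = x (i, false) := fun i hi => hx.birthOf_eq (hS i hi)
  have hle : ∀ i, c' i ≠ none → birthOf (c' i) ≤ birthOf (c i) + h := by
    intro i hi
    have hiS := hy.mem_of_present hi
    rw [hy.birthOf_eq hi, hpos i hiS]
    have := hxy _ (birth_mem_valueLabels (Inf := Inf) hiS)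
    linarith
  have hchoice : ∀ i, ∃ z : Y.obj (birthOf (c' i)), (c' i = none → z = 0) ∧
      ∀ hi : c' i ≠ none, Y.map (hle i hi) z = α.app _ (B.elt i) := by
    intro i
    by_cases hi : c' i = none
    · exact ⟨0, fun _ => rfl, fun hi' => absurd hi hi'⟩
    · have hiS := hy.mem_of_present hi
      have hib := birth_mem_valueLabels (Inf := Inf) hiS
      obtain ⟨z, hz⟩ := B₀.map_surjective (hle i hi) (by
        intro j hj
        rw [hy.alive_iff] at hj ⊢
        rw [hy.birthOf_eq hi]
        rw [hpos i hiS] at hj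
        have h1 := hxy _ hib
        refine ⟨hj.1, ?_, ?_⟩
        · by_contra! hlt
          have h2 := hgap' _ hib _ (birth_mem_valueLabels hj.1) hlt
          linarith
        · exact hj.2.2.imp_right fun h2 => by linarith) (α.app _ (B.elt i))
      exact ⟨z, fun h => absurd h hi, fun _ => hz⟩
  choose elt elt_zero helt using hchoice
  -- No bar of the target ends in a window of length `2 * h` above a critical value.
  have window : ∀ e ∈ valueLabels S Inf, ∀ p q, y e ≤ p → p ≤ q → q ≤ y e + 2 * h → ∀ i,
      Alive (c' i) p → Alive (c' i) q := by
    intro e he p q hp hpq hq i hi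
    refine hy.alive_mono hpq (fun j hjS hj hlt => ?_) i hi
    have := hgap' e he _ (death_mem_valueLabels hjS hj) (hp.trans_lt hlt)
    linarith
  have hmap : ∀ i (hi : c' i ≠ none) (q : ℝ) (hq : birthOf (c i) ≤ q),
      α.app q (X.map hq (B.elt i)) =
        Y.map ((hle i hi).trans (add_le_add_left hq h)) (elt i) := by
    intro i hi q hq
    rw [α.naturality, ← helt i hi, Y.map_map]
  have dies : ∀ i r (hr : birthOf (c' i) ≤ r), ¬ Alive (c' i) r → Y.map hr (elt i) = 0 := by
    intro i r hr hal
    by_cases hi : c' i = none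
    · rw [elt_zero i hi, map_zero]
    have hiS := hy.mem_of_present hi
    have hib := birth_mem_valueLabels (Inf := Inf) hiS
    rw [hy.alive_iff, ← hy.birthOf_eq hi] at hal
    have hal' : i ∉ Inf ∧ y (i, true) ≤ r := by
      by_contra hcon
      exact hal ⟨hiS, hr, by by_cases hInf : i ∈ Inf <;> simp_all⟩
    have hid := death_mem_valueLabels hiS hal'.1
    have hd := hxy _ hid
    have hbd : birthOf (c' i) ≤ y (i, true) := by
      rw [hy.birthOf_eq hi]
      exact hy.le i hiS hal'.1
    have hbx : birthOf (c i) ≤ x (i, true) := by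
      rw [hpos i hiS]
      exact hx.le i hiS hal'.1
    have h0 : Y.map hbd (elt i) = 0 := by
      apply B₀.map_injective (show y (i, true) ≤ x (i, true) + h by linarith)
        (window _ hid _ _ le_rfl (by linarith) (by linarith))
      rw [Y.map_map, map_zero, ← hmap i hi _ hbx, B.map_elt_eq_zero, map_zero]
      intro hal''
      exact lt_irrefl _ ((hx.alive_iff.1 hal'').2.2.resolve_left hal'.1)
    rw [← Y.map_map hbd hal'.2, h0, map_zero]
  -- At heights with no critical value in a window of length `2 * h` below, `α` is onto and the
  -- images of the basis elements of the source that are alive span.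
  have basis₀ : ∀ p : ℝ, (∀ e ∈ valueLabels S Inf, ¬ (p < y e ∧ y e ≤ p + h + h)) →
      LinearIndependent K (fun i : {i // Alive (c' i) (p + h + h)} =>
        Y.map i.2.birthOf_le (elt i.1)) := by
    intro p hp
    have := Fintype.ofFinite {l // Alive (c' l) (p + h + h)}
    refine linearIndependent_of_top_le_span_of_card_eq_finrank ?_
      (by rw [B₀.finrank_obj, Nat.card_eq_fintype_card])
    have hsurj : Function.Surjective (α.app (p + h)) := by
      refine H.app_surjective B₀ fun i hi => ?_
      rw [hy.alive_iff] at hi ⊢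
      refine ⟨hi.1, ?_, hi.2.2.imp_right fun h2 => by linarith⟩
      by_contra! hlt
      exact hp _ (birth_mem_valueLabels hi.1) ⟨hlt, hi.2.1⟩
    have htop : (⊤ : Submodule K (Y.obj (p + h + h))) = (⊤ : Submodule K (X.obj (p + h))).map
        (α.app (p + h)) := by
      rw [Submodule.map_top, LinearMap.range_eq_top.2 hsurj]
    rw [htop]
    refine (Submodule.map_mono (B.span_eq (p + h))).trans ?_
    rw [Submodule.map_span]
    refine Submodule.span_le.2 ?_
    rintro _ ⟨_, ⟨l, rfl⟩, rfl⟩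
    have hl := hx.alive_iff.1 l.2
    have hl' : Alive (c' l.1) (p + h + h) := by
      have h1 := hxy _ (birth_mem_valueLabels (Inf := Inf) hl.1)
      refine hy.alive_iff.2 ⟨hl.1, by linarith, ?_⟩
      by_cases hInf : l.1 ∈ Inf
      · exact Or.inl hInf
      · have hd := death_mem_valueLabels hl.1 hInf
        have h2 := hxy _ hd
        have h3 := hl.2.2.resolve_left hInf
        by_contra! hcon
        exact hp _ hd ⟨by linarith, hcon.2⟩
    refine Submodule.subset_span ⟨⟨l.1, hl'⟩, ?_⟩
    exact (hmap l.1 hl'.ne_none _ _).symm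
  have li : ∀ r : ℝ, LinearIndependent K (fun i : {i // Alive (c' i) r} =>
      Y.map i.2.birthOf_le (elt i.1)) := by
    intro r
    obtain ⟨p, hrp, hal, hp⟩ : ∃ p, r ≤ p + h + h ∧
        (∀ i, Alive (c' i) r → Alive (c' i) (p + h + h)) ∧
        ∀ e ∈ valueLabels S Inf, ¬ (p < y e ∧ y e ≤ p + h + h) := by
      by_cases hr : ∃ e ∈ valueLabels S Inf, r - h - h < y e ∧ y e ≤ r
      · obtain ⟨e, he, h1, h2⟩ := hr
        refine ⟨y e, by linarith, window e he r _ h2 (by linarith) (by linarith), ?_⟩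
        rintro e' he' ⟨h3, h4⟩
        have := hgap' e he e' he' h3
        linarith
      · refine ⟨r - h - h, by linarith, fun i hi => ?_, fun e he hcon => hr ⟨e, he, ?_⟩⟩
        · rwa [show r - h - h + h + h = r by ring]
        · exact ⟨hcon.1, by linarith [hcon.2]⟩
    have h1 := (basis₀ p hp).comp
      (fun i : {i // Alive (c' i) r} => ⟨i.1, hal i.1 i.2⟩)
      fun i j hij => Subtype.ext (congrArg Subtype.val hij :)
    refine LinearIndependent.of_comp (Y.map hrp) ?_
    convert h1 using 1
    exact funext fun i => Y.map_map _ _ _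
  refine ⟨ExtBasis.ofBasis elt elt_zero dies fun r => ⟨li r, ?_⟩, ?_⟩
  · have := Fintype.ofFinite {l // Alive (c' l) r}
    have : Module.Finite K (Y.obj r) := Module.Finite.of_basis (B₀.basisAt r)
    refine (li r).span_eq_top_of_card_eq_finrank' ?_
    rw [B₀.finrank_obj, Nat.card_eq_fintype_card]
  · refine carries_iff.2 fun i hi => ⟨fun hi' => ?_, fun hi' => ⟨hle i hi', (helt i hi').symm⟩⟩
    -- The bar has shrunk to a point in the target, where no other bar ends nearby.
    have hiS := hx.mem_of_present hi
    have hiInf : i ∉ Inf := fun hInf => (hy.present_iff i).2 ⟨hiS, Or.inl hInf⟩ hi'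
    have hyi : y (i, true) ≤ y (i, false) := by
      by_contra! hlt
      exact (hy.present_iff i).2 ⟨hiS, Or.inr hlt⟩ hi'
    have hib := birth_mem_valueLabels (Inf := Inf) hiS
    have h1 := hxy _ hib
    have h2 := hxy _ (death_mem_valueLabels hiS hiInf)
    have hbd : birthOf (c i) ≤ x (i, true) := by
      rw [hpos i hiS]
      exact hx.le i hiS hiInf
    apply B₀.map_injective (add_le_add_left hbd h)
      (window _ hib _ _ (by rw [hpos i hiS]; linarith) (by linarith) (by linarith))
    rw [map_zero, ← α.naturality hbd, B.map_elt_eq_zero, map_zero]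
    intro hal
    exact lt_irrefl _ ((hx.alive_iff.1 hal).2.2.resolve_left hiInf)

/-- If the critical values of both barcodes are pairwise well separated, then carrying along an
interleaving morphism is a bijection between the bases of source and target. -/
theorem IsInterleaving.existsUnique_carries {hh : 0 ≤ h} {α : ShiftMorphism X Y h}
    {β : ShiftMorphism Y X h} (H : IsInterleaving hh α β) (B₀ : ExtBasis X c) (B₀' : ExtBasis Y c')
    (hx : HasValues S Inf c x) (hy : HasValues S Inf c' y)
    (hS : ∀ i ∈ S, c i ≠ none) (hS' : ∀ i ∈ S, c' i ≠ none)
    (hxy : ∀ e ∈ valueLabels S Inf, |x e - y e| ≤ h)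
    (hgap : ∀ e ∈ valueLabels S Inf, ∀ e' ∈ valueLabels S Inf, x e ≠ x e' →
      2 * h < |x e - x e'|)
    (hgap' : ∀ e ∈ valueLabels S Inf, ∀ e' ∈ valueLabels S Inf, y e ≠ y e' →
      2 * h < |y e - y e'|) :
    (∀ B : ExtBasis X c, ∃! B' : ExtBasis Y c', Carries α B B') ∧
      ∀ B' : ExtBasis Y c', ∃! B : ExtBasis X c, Carries α B B' := by
  have window : ∀ e ∈ valueLabels S Inf, ∀ p q, y e ≤ p → p ≤ q → q ≤ y e + 2 * h → ∀ i,
      Alive (c' i) p → Alive (c' i) q := by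
    intro e he p q hp hpq hq i hi
    refine hy.alive_mono hpq (fun j hjS hj hlt => ?_) i hi
    have hne : y e < y (j, true) := hp.trans_lt hlt
    rcases lt_abs.1 (hgap' e he _ (death_mem_valueLabels hjS hj) hne.ne) with h1 | h1 <;> linarith
  have window' : ∀ i, c i ≠ none → ∀ j,
      Alive (c j) (birthOf (c i)) → Alive (c j) (birthOf (c i) + h + h) := by
    intro i hi j hj
    refine hx.alive_mono (by linarith) (fun k hkS hk hlt => ?_) j hj
    rw [hx.birthOf_eq hi] at hlt ⊢
    rcases lt_abs.1 (hgap _ (birth_mem_valueLabels (hx.mem_of_present hi)) _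
      (death_mem_valueLabels hkS hk) hlt.ne) with h1 | h1 <;> linarith
  refine ⟨fun B => ?_, fun B' => ?_⟩
  · obtain ⟨B', hB'⟩ := H.exists_carries B B₀' hx hy hS hxy hgap'
    refine ⟨B', hB', fun B'' hB'' => hB''.unique_right hB'
      (fun i hi => hS i (hy.mem_of_present hi)) fun i hi j => ?_⟩
    have hiS := hy.mem_of_present hi
    have hib := birth_mem_valueLabels (Inf := Inf) hiS
    have h1 := abs_le.1 (hxy _ hib)
    rw [hy.birthOf_eq hi, hx.birthOf_eq (hS i hiS)]
    exact window _ hib _ _ le_rfl (by linarith) (by linarith) j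
  · obtain ⟨B, hB⟩ := H.symm.exists_carries B' B₀ hy hx hS'
      (fun e he => by rw [abs_sub_comm]; exact hxy e he) hgap
    refine ⟨B, ?_, fun B'' hB'' => hB''.unique_left H (B'' := B) ?_ window'⟩
    -- The morphism `β` carries `B'` to `B`; this implies that `α` carries `B` to `B'`.
    all_goals
      refine carries_iff.2 fun i hi => ?_
      have hiS := hx.mem_of_present hi
      have hi' := hS' i hiS
      have hib := birth_mem_valueLabels (Inf := Inf) hiS
      have h1 := abs_le.1 (hxy _ hib)
      have e1 := hx.birthOf_eq hi
      have e2 := hy.birthOf_eq hi'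
      refine ⟨fun h0 => absurd h0 hi', fun _ => ⟨by linarith, ?_⟩⟩
      have h2 := (hB i hi').2 hi
      apply B₀'.map_injective (add_le_add_left h2 h)
        (window _ hib _ _ (by linarith) (by linarith) (by linarith))
      have happ : β.app _ (B'.elt i) = X.map h2 (B.elt i) := hB.app_elt hi' hi
      rw [← α.naturality h2, ← happ, H.2, Y.map_map]

/-! ### Gluing of local transports -/

/-- Consider sets `F t` for `t` in a linear order, and a transitive relation `R` between elements
of `F s` and `F t` for `s < t`. Suppose that on a preconnected set `I` with least element `t₀` the
relation is locally the graph of maps `F s → F t`. Then each element of `F t₀` extends to a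
family of elements that are related to one another. -/
theorem exists_section {ι : Type*} [LinearOrder ι] [TopologicalSpace ι] {F : ι → Type*}
    [∀ t, Nonempty (F t)] (R : ∀ s t, s < t → F s → F t → Prop) {I : Set ι} (hI : IsPreconnected I)
    {t₀ : ι} (ht₀ : t₀ ∈ I) (hmin : ∀ t ∈ I, t₀ ≤ t)
    (trans : ∀ r s t (h : r < s) (h' : s < t), r ∈ I → s ∈ I → t ∈ I → ∀ x y z,
      R r s h x y → R s t h' y z → R r t (h.trans h') x z)
    (loc : ∀ r ∈ I, ∃ U : Set ι, IsOpen U ∧ U.OrdConnected ∧ r ∈ U ∧ ∀ s t (h : s < t),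
      s ∈ U ∩ I → t ∈ U ∩ I → ∀ x, ∃! y, R s t h x y)
    (x₀ : F t₀) :
    ∃ σ : ∀ t, F t, σ t₀ = x₀ ∧ ∀ s t (h : s < t), s ∈ I → t ∈ I → R s t h (σ s) (σ t) := by
  classical
  -- Partial families: defined on an initial part `D` of `I`.
  let Good : Set ι × (∀ t, F t) → Prop := fun P =>
    t₀ ∈ P.1 ∧ P.1 ⊆ I ∧ (∀ s ∈ I, ∀ t ∈ P.1, s < t → s ∈ P.1) ∧ P.2 t₀ = x₀ ∧
      ∀ s t (h : s < t), s ∈ P.1 → t ∈ P.1 → R s t h (P.2 s) (P.2 t)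
  let le : {P // Good P} → {P // Good P} → Prop := fun P Q =>
    P.1.1 ⊆ Q.1.1 ∧ ∀ t ∈ P.1.1, P.1.2 t = Q.1.2 t
  have base : Good ({t₀}, Function.update (fun t => Classical.arbitrary (F t)) t₀ x₀) := by
    refine ⟨rfl, by simpa using ht₀, ?_, by simp, ?_⟩
    · intro s hs t ht hlt
      exact absurd (hmin s hs) (not_le.2 (mem_singleton_iff.1 ht ▸ hlt))
    · intro s t hlt hs ht
      exact absurd (mem_singleton_iff.1 hs ▸ mem_singleton_iff.1 ht ▸ hlt) (lt_irrefl _)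
  obtain ⟨⟨⟨D, σ⟩, hD₀, hDI, hDl, hσ₀, hσ⟩, hmax⟩ :
      ∃ m : {P // Good P}, ∀ a, le m a → le a m := by
    refine exists_maximal_of_chains_bounded (fun C hC => ?_) fun {P Q W} h1 h2 =>
      ⟨h1.1.trans h2.1, fun t ht => (h1.2 t ht).trans (h2.2 t (h1.1 ht))⟩
    rcases C.eq_empty_or_nonempty with rfl | ⟨P₀, hP₀⟩
    · exact ⟨⟨_, base⟩, by simp⟩
    let τ : ∀ t, F t := fun t =>
      if ht : ∃ P ∈ C, t ∈ P.1.1 then ht.choose.1.2 t else Classical.arbitrary _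
    have hτ : ∀ P ∈ C, ∀ t ∈ P.1.1, P.1.2 t = τ t := by
      intro P hP t ht
      have ht' : ∃ P ∈ C, t ∈ P.1.1 := ⟨P, hP, ht⟩
      simp only [τ, dif_pos ht']
      have hQ := ht'.choose_spec
      by_cases hPQ : P = ht'.choose
      · rw [← hPQ]
      · rcases hC hP hQ.1 hPQ with h1 | h1
        · exact h1.2 t ht
        · exact (h1.2 t hQ.2).symm
    refine ⟨⟨(⋃ P ∈ C, P.1.1, τ), ?_, ?_, ?_, ?_, ?_⟩, fun P hP => ⟨?_, hτ P hP⟩⟩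
    · exact mem_biUnion hP₀ P₀.2.1
    · exact iUnion₂_subset fun P _ => P.2.2.1
    · intro s hs t ht hlt
      obtain ⟨P, hP, ht⟩ := mem_iUnion₂.1 ht
      exact mem_biUnion hP (P.2.2.2.1 s hs t ht hlt)
    · exact (hτ P₀ hP₀ t₀ P₀.2.1).symm.trans P₀.2.2.2.2.1
    · intro s t hlt hs ht
      obtain ⟨P, hP, ht⟩ := mem_iUnion₂.1 ht
      obtain ⟨Q, hQ, hs⟩ := mem_iUnion₂.1 hs
      have hs' : s ∈ P.1.1 := P.2.2.2.1 s (Q.2.2.1 hs) t ht hlt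
      have := P.2.2.2.2.2 s t hlt hs' ht
      rwa [hτ P hP s hs', hτ P hP t ht] at this
    · exact subset_biUnion_of_mem (u := fun P : {P // Good P} => P.1.1) hP
  -- A maximal family extends over each neighbourhood that it meets.
  have extend : ∀ U : Set ι, U.OrdConnected → (∀ s t (h : s < t), s ∈ U ∩ I → t ∈ U ∩ I →
      ∀ x, ∃! y, R s t h x y) → ∀ p ∈ D, p ∈ U → U ∩ I ⊆ D := by
    intro U hU hUR p hpD hpU t ht
    by_contra htD
    have hpt : ∀ t ∈ I, t ∉ D → p < t := by
      intro t htI htD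
      by_contra! hle
      rcases hle.eq_or_lt with rfl | hlt
      · exact htD hpD
      · exact htD (hDl t htI p hpD hlt)
    have hex : ∀ t, ∃ y, ∀ (_ : t ∈ U ∩ I) (h : p < t), R p t h (σ p) y := by
      intro t
      by_cases h : t ∈ U ∩ I ∧ p < t
      · obtain ⟨y, hy, -⟩ := hUR p t h.2 ⟨hpU, hDI hpD⟩ h.1 (σ p)
        exact ⟨y, fun _ _ => hy⟩
      · exact ⟨Classical.arbitrary _, fun h1 h2 => absurd ⟨h1, h2⟩ h⟩
    choose ρ hρ using hex
    let σ' : ∀ t, F t := fun t => if t ∈ D then σ t else ρ t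
    have hσ' : ∀ t ∈ D, σ t = σ' t := fun t ht => by simp [σ', ht]
    have hpR : ∀ t (h : p < t), t ∈ D ∪ U ∩ I → R p t h (σ p) (σ' t) := by
      intro t hlt ht
      by_cases htD : t ∈ D
      · rw [← hσ' t htD]
        exact hσ p t hlt hpD htD
      · simp only [σ', if_neg htD]
        exact hρ t (ht.resolve_left htD) hlt
    have good : Good (D ∪ {t | t ∈ U ∩ I ∧ p ≤ t}, σ') := by
      refine ⟨Or.inl hD₀, union_subset hDI fun t ht => ht.1.2, ?_, ?_, ?_⟩
      · rintro s hs t (ht | ht) hlt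
        · exact Or.inl (hDl s hs t ht hlt)
        · rcases lt_or_ge s p with hsp | hsp
          · exact Or.inl (hDl s hs p hpD hsp)
          · exact Or.inr ⟨⟨hU.out hpU ht.1.1 ⟨hsp, hlt.le⟩, hs⟩, hsp⟩
      · exact (hσ' t₀ hD₀).symm.trans hσ₀
      · intro s t hlt hs ht
        by_cases htD : t ∈ D
        · have hsD : s ∈ D := by
            refine hs.elim id fun hs => hDl s hs.1.2 t htD hlt
          change R s t hlt (σ' s) (σ' t)
          rw [← hσ' s hsD, ← hσ' t htD]
          exact hσ s t hlt hsD htD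
        · have ht := ht.resolve_left htD
          have hpt' := hpt t ht.1.2 htD
          have hpt'' := hpR t hpt' (Or.inr ht.1)
          have hsI : s ∈ I := hs.elim (fun h => hDI h) fun h => h.1.2
          change R s t hlt (σ' s) (σ' t)
          rcases lt_trichotomy s p with hsp | rfl | hsp
          · have hsD := hDl s hsI p hpD hsp
            rw [← hσ' s hsD]
            exact trans s p t hsp hpt' hsI (hDI hpD) ht.1.2 _ _ _ (hσ s p hsp hsD hpD) hpt''
          · rw [← hσ' s hpD]
            exact hpt''
          · have hsU : s ∈ U ∩ I := ⟨hU.out hpU ht.1.1 ⟨hsp.le, hlt.le⟩, hsI⟩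
            obtain ⟨y, hy, -⟩ := hUR s t hlt hsU ht.1 (σ' s)
            have := trans p s t hsp hlt (hDI hpD) hsI ht.1.2 _ _ _ (hpR s hsp (Or.inr hsU)) hy
            have hy' := (hUR p t hpt' ⟨hpU, hDI hpD⟩ ht.1 (σ p)).unique this hpt''
            exact hy' ▸ hy
    have := (hmax ⟨_, good⟩ ⟨subset_union_left, hσ'⟩).1
    exact htD (this (Or.inr ⟨ht, (hpt t ht.2 htD).le⟩))
  have hID : I ⊆ D := by
    choose! U hUo hUc hmem hUR using loc
    have := Subtype.preconnectedSpace hI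
    have hclopen : IsClopen (Subtype.val ⁻¹' D : Set I) := by
      refine ⟨⟨isOpen_iff_forall_mem_open.2 ?_⟩, isOpen_iff_forall_mem_open.2 ?_⟩
      · rintro ⟨q, hq⟩ hqD
        refine ⟨Subtype.val ⁻¹' U q, ?_, (hUo q hq).preimage continuous_subtype_val, hmem q hq⟩
        exact fun t ht htD => hqD (extend (U q) (hUc q hq) (hUR q hq) t htD ht ⟨hmem q hq, hq⟩)
      · rintro ⟨q, hq⟩ hqD
        refine ⟨Subtype.val ⁻¹' U q, ?_, (hUo q hq).preimage continuous_subtype_val, hmem q hq⟩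
        exact fun t ht => extend (U q) (hUc q hq) (hUR q hq) q hqD (hmem q hq) ⟨ht, t.2⟩
    have huniv := hclopen.eq_univ ⟨⟨t₀, ht₀⟩, hD₀⟩
    exact fun t ht => (huniv ▸ mem_univ _ : (⟨t, ht⟩ : I) ∈ (Subtype.val ⁻¹' D : Set I))
  exact ⟨σ, hσ₀, fun s t hlt hs ht => hσ s t hlt (hID hs) (hID ht)⟩

end

/-! ### Vines as continuous families of critical values -/

section

variable {a b : ℝ} {N : ℕ}

theorem isPreconnected_of_ordConnected {I : Set (Icc a b)} (hI : I.OrdConnected) :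
    IsPreconnected I := by
  rw [← Topology.IsInducing.subtypeVal.isPreconnected_image]
  refine OrdConnected.isPreconnected ⟨?_⟩
  rintro _ ⟨p, hp, rfl⟩ _ ⟨q, hq, rfl⟩ x hx
  exact ⟨⟨x, p.2.1.trans hx.1, hx.2.trans q.2.2⟩, hI.out hp hq hx, rfl⟩

/-- Distinct values of a function on a finite type have a positive minimal distance. -/
theorem exists_pos_lt_abs_sub {ι : Type*} [Finite ι] (f : ι → ℝ) :
    ∃ η > 0, ∀ e e', f e ≠ f e' → η < |f e - f e'| := by
  have h : ∀ᶠ η : ℝ in 𝓝[>] 0, ∀ e e', f e ≠ f e' → η < |f e - f e'| := by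
    rw [eventually_all]
    intro e
    rw [eventually_all]
    intro e'
    by_cases hee : f e = f e'
    · simp [hee]
    · have : (0 : ℝ) < |f e - f e'| := abs_pos.2 (sub_ne_zero.2 hee)
      filter_upwards [nhdsWithin_le_nhds (gt_mem_nhds this)] with η hη _ using hη
  obtain ⟨η, hη, hpos⟩ := (h.and self_mem_nhdsWithin).exists
  exact ⟨η, hpos, hη⟩

/-- A function that is locally 1-Lipschitz on an interval is 1-Lipschitz there. -/
theorem abs_sub_le_of_locally {f : Icc a b → ℝ} {T₀ T₁ : Icc a b}
    (hf : ∀ r ∈ Ioo T₀ T₁, ∃ U ∈ 𝓝 r, ∀ s ∈ U, ∀ t ∈ U, |f s - f t| ≤ |(s : ℝ) - t|)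
    {p q : Icc a b} (hp : p ∈ Ioo T₀ T₁) (hq : q ∈ Ioo T₀ T₁) : |f p - f q| ≤ |(p : ℝ) - q| := by
  wlog hpq : p ≤ q generalizing p q
  · rw [abs_sub_comm, abs_sub_comm (p : ℝ)]
    exact this hq hp (le_of_not_ge hpq)
  have hab : a ≤ b := p.2.1.trans p.2.2
  set g : ℝ → ℝ := fun x => f (projIcc a b hab x)
  have hproj : ∀ x ∈ Icc (p : ℝ) q, ((projIcc a b hab x : Icc a b) : ℝ) = x := fun x hx => by
    rw [projIcc_of_mem hab ⟨p.2.1.trans hx.1, hx.2.trans q.2.2⟩]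
  have hmem : ∀ x ∈ Icc (p : ℝ) q, projIcc a b hab x ∈ Ioo T₀ T₁ := by
    intro x hx
    have h1 := hproj x hx
    exact ⟨hp.1.trans_le (Subtype.coe_le_coe.1 (h1.symm ▸ hx.1)),
      (Subtype.coe_le_coe.1 (h1.symm ▸ hx.2)).trans_lt hq.2⟩
  have hloc : ∀ x ∈ Icc (p : ℝ) q, ∀ᶠ y in 𝓝[Icc (p : ℝ) q] x, |g y - g x| ≤ |y - x| := by
    intro x hx
    obtain ⟨U, hU, h⟩ := hf _ (hmem x hx)
    have h2 : ∀ᶠ y in 𝓝 x, projIcc a b hab y ∈ U := continuous_projIcc.continuousAt hU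
    filter_upwards [nhdsWithin_le_nhds h2, self_mem_nhdsWithin] with y hy hyI
    have := h _ hy _ (mem_of_mem_nhds hU)
    rwa [hproj y hyI, hproj x hx] at this
  have hcont : ContinuousOn g (Icc (p : ℝ) q) := by
    intro x hx
    rw [ContinuousWithinAt, tendsto_iff_norm_sub_tendsto_zero]
    have hlim : Tendsto (fun y => |y - x|) (𝓝[Icc (p : ℝ) q] x) (𝓝 0) := by
      have : Continuous fun y : ℝ => |y - x| := by fun_prop
      have h3 := this.tendsto x
      rw [sub_self, abs_zero] at h3
      exact h3.mono_left nhdsWithin_le_nhds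
    refine squeeze_zero' (Eventually.of_forall fun y => norm_nonneg _) ?_ hlim
    filter_upwards [hloc x hx] with y hy using hy
  have hclosed : IsClosed ({x | |g x - g p| ≤ x - p} ∩ Icc (p : ℝ) q) := by
    have h1 : ContinuousOn (fun x => |g x - g p| - (x - p)) (Icc (p : ℝ) q) := by fun_prop
    have h2 := h1.preimage_isClosed_of_isClosed isClosed_Icc (isClosed_Iic (a := (0 : ℝ)))
    convert h2 using 1
    ext x
    simp [and_comm]
  have hsub := hclosed.Icc_subset_of_forall_exists_gt (by simp) (by
    rintro x ⟨hx, hx1, hx2⟩ y hy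
    have h1 : ∀ᶠ z in 𝓝[>] x, |g z - g x| ≤ |z - x| := by
      have h2 : Icc (p : ℝ) q ∈ 𝓝[>] x :=
        mem_of_superset (Ioc_mem_nhdsGT hx2) fun z hz => ⟨hx1.trans hz.1.le, hz.2⟩
      exact (nhdsWithin_le_of_mem h2) (hloc x ⟨hx1, hx2.le⟩)
    obtain ⟨z, hz, hzy⟩ := (h1.and (Ioc_mem_nhdsGT hy)).exists
    refine ⟨z, ?_, hzy⟩
    have h3 : |g z - g p| ≤ |g z - g x| + |g x - g p| := abs_sub_le _ _ _
    rw [abs_of_pos (sub_pos.2 hzy.1)] at hz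
    simp only [mem_ofPred_eq] at hx ⊢
    linarith)
  have hpq' : (p : ℝ) ≤ q := hpq
  have := hsub (right_mem_Icc.2 hpq')
  simp only [g, mem_ofPred_eq, projIcc_val] at this
  rw [abs_sub_comm, abs_sub_comm (p : ℝ), abs_of_nonneg (sub_nonneg.2 hpq')]
  exact this

/-- The bar of a vine that is present at `t` moves continuously at `t`. -/
theorem IsVine.eventually_near {γ : Icc a b → Option Bar} (hγ : IsVine γ) {t : Icc a b} {I : Bar}
    (hI : γ t = some I) {ε : ℝ} (hε : 0 < ε) : ∀ᶠ s in 𝓝 t, ∃ J, γ s = some J ∧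
      |I.birth - J.birth| ≤ ε ∧ I.death ≤ J.death + (ε : EReal) ∧
        J.death ≤ I.death + (ε : EReal) := by
  -- A transportation plan of cost less than half the length of `I` has to match `I`.
  obtain ⟨m, hm1, hm2⟩ := EReal.lt_iff_exists_real_btwn.1 I.birth_lt_death
  have hm1 : I.birth < m := by exact_mod_cast hm1
  set ε' := min ε ((m - I.birth) / 2)
  have hε' : 0 < ε' := lt_min hε (by linarith)
  obtain ⟨δ, hδ, h⟩ := hγ.continuous t ε' hε'
  filter_upwards [Metric.ball_mem_nhds t hδ] with s hs
  obtain ⟨M, hM, -, hcost, hX, -⟩ := h s (by rwa [Metric.mem_ball, Subtype.dist_eq,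
    Real.dist_eq] at hs)
  by_cases hex : ∃ p ∈ M, p.1 = I
  · obtain ⟨p, hp, rfl⟩ := hex
    have hle : (ε' : EReal) ≤ ε := by exact_mod_cast min_le_left _ _
    obtain ⟨h1, h2, h3⟩ := hcost p hp
    exact ⟨p.2, (hM hp).2, h1.trans (min_le_left _ _), h2.trans (by gcongr),
      h3.trans (by gcongr)⟩
  · push Not at hex
    have h1 := hX I hI hex
    have h2 := hm2.trans_le h1
    have h3 : m < I.birth + 2 * ε' := by exact_mod_cast h2
    have h4 : ε' ≤ (m - I.birth) / 2 := min_le_right _ _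
    linarith

/-- If a vine is missing at `t`, its bars at nearby times are short. -/
theorem IsVine.eventually_short {γ : Icc a b → Option Bar} (hγ : IsVine γ) {t : Icc a b}
    (ht : γ t = none) {ε : ℝ} (hε : 0 < ε) : ∀ᶠ s in 𝓝 t, ∀ J, γ s = some J →
      J.death ≤ ((J.birth + 2 * ε : ℝ) : EReal) := by
  obtain ⟨δ, hδ, h⟩ := hγ.continuous t ε hε
  filter_upwards [Metric.ball_mem_nhds t hδ] with s hs J hJ
  obtain ⟨M, hM, -, -, -, hY⟩ := h s (by rwa [Metric.mem_ball, Subtype.dist_eq,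
    Real.dist_eq] at hs)
  refine hY J hJ fun p hp => ?_
  have : γ t = some p.1 := (hM hp).1
  simp [ht] at this

/-- The birth and death values of a family of vines as real numbers, with dummy values for missing
bars and infinite deaths. -/
def rawValue (γ : Fin N → Icc a b → Option Bar) : Fin N × Bool → Icc a b → ℝ
  | (i, false), t => birthOf (γ i t)
  | (i, true), t => (deathOf (γ i t)).toReal

theorem IsVine.eventually_present {γ : Icc a b → Option Bar} (hγ : IsVine γ) {t : Icc a b}
    (ht : γ t ≠ none) :
    ∀ᶠ s in 𝓝 t, γ s ≠ none ∧ (deathOf (γ s) = ⊤ ↔ deathOf (γ t) = ⊤) := by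
  obtain ⟨I, hI⟩ := Option.ne_none_iff_exists'.1 ht
  filter_upwards [hγ.eventually_near hI one_pos] with s ⟨J, hJ, _, h1, h2⟩
  refine ⟨by simp [hJ], ?_⟩
  rw [hI, hJ]
  change J.death = ⊤ ↔ I.death = ⊤
  constructor
  · intro h
    rw [h, top_le_iff] at h2
    by_contra hne
    exact EReal.add_ne_top hne (EReal.coe_ne_top _) h2
  · intro h
    rw [h, top_le_iff] at h1
    by_contra hne
    exact EReal.add_ne_top hne (EReal.coe_ne_top _) h1

theorem continuousAt_rawValue {γ : Fin N → Icc a b → Option Bar} {e : Fin N × Bool}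
    (hγ : IsVine (γ e.1)) {t : Icc a b} (ht : γ e.1 t ≠ none) :
    ContinuousAt (rawValue γ e) t := by
  obtain ⟨I, hI⟩ := Option.ne_none_iff_exists'.1 ht
  rw [Metric.continuousAt_iff']
  intro ε hε
  filter_upwards [hγ.eventually_near hI (half_pos hε), hγ.eventually_present ht]
    with s ⟨J, hJ, h1, h2, h3⟩ ⟨_, h4⟩
  rw [Real.dist_eq]
  obtain ⟨i, k⟩ := e
  cases k with
  | false =>
    simp only [rawValue] at hI hJ ⊢
    rw [hI, hJ, abs_sub_comm]
    exact h1.trans_lt (half_lt_self hε)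
  | true =>
    simp only [rawValue] at hI hJ h4 ⊢
    rw [hI, hJ] at h4 ⊢
    change J.death = ⊤ ↔ I.death = ⊤ at h4
    change |J.death.toReal - I.death.toReal| < ε
    by_cases htop : I.death = ⊤
    · rw [htop, h4.2 htop, sub_self, abs_zero]
      exact hε
    · have e1 := EReal.coe_toReal htop (ne_bot_of_gt I.birth_lt_death)
      have e2 := EReal.coe_toReal (fun h => htop (h4.1 h)) (ne_bot_of_gt J.birth_lt_death)
      rw [← e1, ← e2] at h2 h3
      have h2' : I.death.toReal ≤ J.death.toReal + ε / 2 := by exact_mod_cast h2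
      have h3' : J.death.toReal ≤ I.death.toReal + ε / 2 := by exact_mod_cast h3
      rw [abs_lt]
      constructor <;> linarith

variable {K : Type u} [Field K]

/-- Over an open interval without critical times the same vines are present all the time, and the
same among them have infinite death. -/
theorem exists_present_iff {γ : Fin N → Icc a b → Option Bar} (hγ : ∀ i, IsVine (γ i))
    {T₀ T₁ : Icc a b} (hcrit : ∀ t, T₀ < t → t < T₁ → ¬ IsCritical γ t) :
    ∃ S Inf : Set (Fin N), ∀ t ∈ Ioo T₀ T₁, ∀ i,
      (γ i t ≠ none ↔ i ∈ S) ∧ (deathOf (γ i t) = ⊤ ↔ i ∈ Inf) := by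
  rcases (Ioo T₀ T₁).eq_empty_or_nonempty with h0 | ⟨m, hm⟩
  · exact ⟨∅, ∅, by simp [h0]⟩
  refine ⟨{i | γ i m ≠ none}, {i | deathOf (γ i m) = ⊤}, fun t ht i => ?_⟩
  refine (isPreconnected_of_ordConnected (ordConnected_Ioo (a := T₀) (b := T₁))).induction₂
    (fun s t => (γ i s ≠ none ↔ γ i t ≠ none) ∧ (deathOf (γ i s) = ⊤ ↔ deathOf (γ i t) = ⊤))
    (fun s hs => ?_) (fun x y z _ _ _ h h' => ⟨h.1.trans h'.1, h.2.trans h'.2⟩)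
    (fun x y _ _ h => ⟨h.1.symm, h.2.symm⟩) ht hm
  refine nhdsWithin_le_nhds ?_
  by_cases hsi : γ i s = none
  · have hncl : s ∉ closure (supp (γ i)) := fun hcl =>
      hcrit s hs.1 hs.2 (Or.inr ⟨i, hcl, fun h => h hsi⟩)
    have hev : ∀ᶠ t in 𝓝 s, t ∈ (closure (supp (γ i)))ᶜ :=
      isClosed_closure.isOpen_compl.mem_nhds hncl
    filter_upwards [hev] with t ht
    have : γ i t = none := by
      by_contra hne
      exact ht (subset_closure hne)
    simp [hsi, this]
  · filter_upwards [(hγ i).eventually_present hsi] with t ht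
    exact ⟨by simp [hsi, ht.1], ht.2.symm⟩

theorem isValue_rawValue {γ : Fin N → Icc a b → Option Bar} {S Inf : Set (Fin N)} {t : Icc a b}
    (hS : ∀ i, i ∈ S → γ i t ≠ none) (hInf : ∀ i, deathOf (γ i t) = ⊤ ↔ i ∈ Inf)
    {e : Fin N × Bool} (he : e ∈ valueLabels S Inf) : IsValue γ t e (rawValue γ e t) := by
  obtain ⟨i, k⟩ := e
  obtain ⟨I, hI⟩ := Option.ne_none_iff_exists'.1 (hS i he.1)
  cases k with
  | false => exact Or.inl ⟨I, hI, by simp [rawValue, hI, birthOf]⟩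
  | true =>
    refine Or.inl ⟨I, hI, ?_⟩
    have htop : I.death ≠ ⊤ := by
      intro h
      refine he.2 rfl ((hInf i).1 ?_)
      rw [hI]
      exact h
    simp only [rawValue, hI, deathOf]
    exact (EReal.coe_toReal htop (ne_bot_of_gt I.birth_lt_death)).symm

theorem hasValues_rawValue {γ : Fin N → Icc a b → Option Bar} {S Inf : Set (Fin N)} {t : Icc a b}
    (hS : ∀ i, γ i t ≠ none ↔ i ∈ S) (hInf : ∀ i, deathOf (γ i t) = ⊤ ↔ i ∈ Inf) :
    HasValues S Inf (fun i => γ i t) fun e => rawValue γ e t := by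
  have hdeath : ∀ i I, γ i t = some I → i ∉ Inf → I.death = (rawValue γ (i, true) t : EReal) := by
    intro i I hI hi
    have htop : I.death ≠ ⊤ := by
      intro h
      refine hi ((hInf i).1 ?_)
      rw [hI]
      exact h
    simp only [rawValue, hI, deathOf]
    exact (EReal.coe_toReal htop (ne_bot_of_gt I.birth_lt_death)).symm
  have hlt : ∀ i ∈ S, i ∉ Inf → rawValue γ (i, false) t < rawValue γ (i, true) t := by
    intro i hi hiInf
    obtain ⟨I, hI⟩ := Option.ne_none_iff_exists'.1 ((hS i).2 hi)
    have h1 := I.birth_lt_death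
    rw [hdeath i I hI hiInf] at h1
    have h2 : rawValue γ (i, false) t = I.birth := by simp [rawValue, hI, birthOf]
    rw [h2]
    exact_mod_cast h1
  refine ⟨fun i I hI => by simp [rawValue, hI, birthOf], hdeath, fun i I hI hi => ?_, fun i => ?_,
    fun i hi hi' => (hlt i hi hi').le⟩
  · have h := (hInf i).2 hi
    rw [hI] at h
    exact h
  · rw [hS i]
    refine ⟨fun hi => ⟨hi, ?_⟩, And.left⟩
    by_cases hiInf : i ∈ Inf
    · exact Or.inl hiInf
    · exact Or.inr (hlt i hi hiInf)

/-- Between critical times the critical values of a vineyard module are 1-Lipschitz. -/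
theorem rawValue_lipschitz {V : VineyardModule.{u, v} K a b} {γ : Fin N → Icc a b → Option Bar}
    (hγ : ∀ i, IsVine (γ i)) (B : BasisFamily V γ) {T₀ T₁ : Icc a b}
    (hcrit : ∀ t, T₀ < t → t < T₁ → ¬ IsCritical γ t) {S Inf : Set (Fin N)}
    (hSI : ∀ t ∈ Ioo T₀ T₁, ∀ i, (γ i t ≠ none ↔ i ∈ S) ∧ (deathOf (γ i t) = ⊤ ↔ i ∈ Inf))
    {e : Fin N × Bool} (he : e ∈ valueLabels S Inf) {p q : Icc a b} (hp : p ∈ Ioo T₀ T₁)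
    (hq : q ∈ Ioo T₀ T₁) : |rawValue γ e p - rawValue γ e q| ≤ |(p : ℝ) - q| := by
  refine abs_sub_le_of_locally (fun r hr => ?_) hp hq
  obtain ⟨η, hη, hgap⟩ := exists_pos_lt_abs_sub fun e => rawValue γ e r
  have hgap' : ∀ e ∈ valueLabels S Inf, ∀ e' ∈ valueLabels S Inf, e ≠ e' →
      8 * (η / 8) < |rawValue γ e r - rawValue γ e' r| := by
    intro e he e' he' hne
    rw [mul_div_cancel₀ _ (by norm_num)]
    refine hgap e e' fun heq => hcrit r hr.1 hr.2 (Or.inl ⟨e, e', hne, rawValue γ e r, ?_, ?_⟩)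
    · exact isValue_rawValue (fun i => (hSI r hr i).1.2) (fun i => (hSI r hr i).2) he
    · rw [heq]
      exact isValue_rawValue (fun i => (hSI r hr i).1.2) (fun i => (hSI r hr i).2) he'
  have hclose : ∀ᶠ s in 𝓝 r, ∀ e ∈ valueLabels S Inf,
      |rawValue γ e s - rawValue γ e r| ≤ η / 8 := by
    rw [eventually_all]
    intro e
    by_cases he : e ∈ valueLabels S Inf
    · have hc := continuousAt_rawValue (hγ e.1) ((hSI r hr e.1).1.2 he.1)
      filter_upwards [Metric.continuousAt_iff'.1 hc (η / 8) (by positivity)] with s hs _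
      exact (Real.dist_eq _ _ ▸ hs).le
    · simp [he]
  have hIoo : ∀ᶠ s in 𝓝 r, s ∈ Ioo T₀ T₁ := Ioo_mem_nhds hr.1 hr.2
  have hball : ∀ᶠ s in 𝓝 r, s ∈ Metric.ball r (η / 16) := Metric.ball_mem_nhds r (by positivity)
  refine ⟨_, hclose.and (hIoo.and hball), ?_⟩
  rintro s ⟨hs1, hs2, hs3⟩ t ⟨ht1, ht2, ht3⟩
  rw [Metric.mem_ball, Subtype.dist_eq, Real.dist_eq, abs_lt] at hs3 ht3
  clear hp hq p q
  wlog hst : s < t generalizing s t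
  · rcases (not_lt.1 hst).eq_or_lt with rfl | hlt
    · simp
    · rw [abs_sub_comm, abs_sub_comm (s : ℝ)]
      exact this t ht1 ht2 ht3 s hs1 hs2 hs3 hlt
  have hst' : (s : ℝ) < t := hst
  have vs := hasValues_rawValue (fun i => (hSI s hs2 i).1) (fun i => (hSI s hs2 i).2)
  have vt := hasValues_rawValue (fun i => (hSI t ht2 i).1) (fun i => (hSI t ht2 i).2)
  have h1 := (V.interleaving hst).values_le (B s) (B t) vs vt (η := η / 8)
    (z := fun e => rawValue γ e r) (by linarith) hs1 ht1 hgap' (i := e.1) he.1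
  have h2 := (V.interleaving hst).symm.values_le (B t) (B s) vt vs (η := η / 8)
    (z := fun e => rawValue γ e r) (by linarith) ht1 hs1 hgap' (i := e.1) he.1
  rw [abs_sub_comm (s : ℝ), abs_of_pos (sub_pos.2 hst'), abs_le]
  obtain ⟨i, k⟩ := e
  cases k with
  | false => constructor <;> linarith [h1.1, h2.1]
  | true => constructor <;> linarith [h1.2 (he.2 rfl), h2.2 (he.2 rfl)]

/-- Critical values `x` over a segment, extended to its end points. `S` is the set of the vines that
are present between its ends and `Inf` the set of those with infinite death. Outside the segment
`x` is an arbitrary Lipschitz extension. -/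
structure SegmentValues (γ : Fin N → Icc a b → Option Bar) (T₀ T₁ : Icc a b) (S Inf : Set (Fin N))
    (x : Fin N × Bool → Icc a b → ℝ) : Prop where
  lipschitz : ∀ e ∈ valueLabels S Inf, ∀ s t, |x e s - x e t| ≤ |(s : ℝ) - t|
  hasValues : ∀ t ∈ Icc T₀ T₁, HasValues S Inf (fun i => γ i t) fun e => x e t
  isValue : ∀ t ∈ Icc T₀ T₁, ∀ e ∈ valueLabels S Inf, IsValue γ t e (x e t)
  present_of_not_critical : ∀ t ∈ Icc T₀ T₁, ¬ IsCritical γ t → ∀ i ∈ S, γ i t ≠ none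

/-- A vineyard module has critical values over a segment: inside they are 1-Lipschitz and thus have
limits at the ends. Where a vine is missing, its birth and death have the same limit, since the
bottleneck distance to the empty diagram tends to zero. -/
theorem exists_segmentValues {V : VineyardModule.{u, v} K a b} {γ : Fin N → Icc a b → Option Bar}
    (hγ : ∀ i, IsVine (γ i)) (B : BasisFamily V γ) {T₀ T₁ : Icc a b} (hT : T₀ < T₁)
    (hcrit : ∀ t, T₀ < t → t < T₁ → ¬ IsCritical γ t) :
    ∃ S Inf x, SegmentValues γ T₀ T₁ S Inf x := by
  obtain ⟨S, Inf, hSI⟩ := exists_present_iff hγ hcrit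
  have hext : ∀ e, ∃ g : Icc a b → ℝ, e ∈ valueLabels S Inf → LipschitzWith 1 g ∧
      EqOn (rawValue γ e) g (Ioo T₀ T₁) := by
    intro e
    by_cases he : e ∈ valueLabels S Inf
    · have hlip : LipschitzOnWith 1 (rawValue γ e) (Ioo T₀ T₁) := by
        refine LipschitzOnWith.of_dist_le_mul fun p hp q hq => ?_
        rw [NNReal.coe_one, one_mul, Subtype.dist_eq, Real.dist_eq, Real.dist_eq]
        exact rawValue_lipschitz hγ B hcrit hSI he hp hq
      obtain ⟨g, hg⟩ := hlip.extend_real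
      exact ⟨g, fun _ => hg⟩
    · exact ⟨0, fun h => absurd h he⟩
  choose x hx using hext
  have hlim : ∀ t ∈ Icc T₀ T₁, (𝓝[Ioo T₀ T₁] t).NeBot := by
    intro t ht
    rw [← mem_closure_iff_nhdsWithin_neBot, closure_Ioo hT.ne]
    exact ht
  have hxc : ∀ t, ∀ e ∈ valueLabels S Inf, Tendsto (x e) (𝓝[Ioo T₀ T₁] t) (𝓝 (x e t)) :=
    fun t e he => (hx e he).1.continuous.continuousWithinAt
  have hxr : ∀ t, ∀ e ∈ valueLabels S Inf, x e =ᶠ[𝓝[Ioo T₀ T₁] t] rawValue γ e := fun t e he => by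
    filter_upwards [self_mem_nhdsWithin] with s hs using ((hx e he).2 hs).symm
  -- Where a vine is present, the extended values are its actual values.
  have hpres : ∀ t ∈ Icc T₀ T₁, ∀ i, γ i t ≠ none → i ∈ S ∧ (deathOf (γ i t) = ⊤ ↔ i ∈ Inf) := by
    intro t ht i hi
    have := hlim t ht
    have hev : ∀ᶠ s in 𝓝[Ioo T₀ T₁] t,
        γ i s ≠ none ∧ (deathOf (γ i s) = ⊤ ↔ deathOf (γ i t) = ⊤) :=
      nhdsWithin_le_nhds ((hγ i).eventually_present hi)
    obtain ⟨s, ⟨hs1, hs2⟩, hs3⟩ := (hev.and self_mem_nhdsWithin).exists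
    exact ⟨(hSI s hs3 i).1.1 hs1, hs2.symm.trans (hSI s hs3 i).2⟩
  have hval : ∀ t ∈ Icc T₀ T₁, ∀ e ∈ valueLabels S Inf, γ e.1 t ≠ none →
      x e t = rawValue γ e t := by
    intro t ht e he hi
    have := hlim t ht
    refine tendsto_nhds_unique (hxc t e he) ?_
    refine Tendsto.congr' (hxr t e he).symm ?_
    exact (continuousAt_rawValue (hγ e.1) hi).tendsto.mono_left nhdsWithin_le_nhds
  have hlt : ∀ s ∈ Ioo T₀ T₁, ∀ i ∈ S, i ∉ Inf → x (i, false) s < x (i, true) s := by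
    intro s hs i hi hiInf
    rw [← (hx _ (birth_mem_valueLabels hi)).2 hs, ← (hx _ (death_mem_valueLabels hi hiInf)).2 hs]
    have hv := hasValues_rawValue (fun i => (hSI s hs i).1) (fun i => (hSI s hs i).2)
    exact (((hv.present_iff i).1 ((hSI s hs i).1.2 hi)).2.resolve_left hiInf)
  have hle : ∀ t ∈ Icc T₀ T₁, ∀ i ∈ S, i ∉ Inf → x (i, false) t ≤ x (i, true) t := by
    intro t ht i hi hiInf
    have := hlim t ht
    refine le_of_tendsto_of_tendsto (hxc t _ (birth_mem_valueLabels hi))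
      (hxc t _ (death_mem_valueLabels hi hiInf)) ?_
    filter_upwards [self_mem_nhdsWithin] with s hs using (hlt s hs i hi hiInf).le
  -- Where a vine is missing, its limiting birth and death coincide.
  have habs : ∀ t ∈ Icc T₀ T₁, ∀ i ∈ S, γ i t = none →
      i ∉ Inf ∧ x (i, true) t = x (i, false) t := by
    intro t ht i hi hnone
    have := hlim t ht
    have hshort : ∀ ε > 0, ∀ᶠ s in 𝓝[Ioo T₀ T₁] t, i ∉ Inf ∧
        x (i, true) s ≤ x (i, false) s + 2 * ε := by
      intro ε hε
      filter_upwards [nhdsWithin_le_nhds ((hγ i).eventually_short hnone hε), self_mem_nhdsWithin]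
        with s hs1 hs
      obtain ⟨J, hJ⟩ := Option.ne_none_iff_exists'.1 ((hSI s hs i).1.2 hi)
      have h1 := hs1 J hJ
      have hv := hasValues_rawValue (fun i => (hSI s hs i).1) (fun i => (hSI s hs i).2)
      have hiInf : i ∉ Inf := by
        intro hiInf
        rw [hv.death_top i J hJ hiInf, top_le_iff] at h1
        exact EReal.coe_ne_top _ h1
      refine ⟨hiInf, ?_⟩
      rw [hv.death i J hJ hiInf, hv.birth i J hJ] at h1
      rw [← (hx _ (birth_mem_valueLabels hi)).2 hs, ← (hx _ (death_mem_valueLabels hi hiInf)).2 hs]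
      exact_mod_cast h1
    obtain ⟨s, hiInf, -⟩ := (hshort 1 one_pos).exists
    refine ⟨hiInf, le_antisymm (le_of_forall_pos_le_add fun ε hε => ?_) (hle t ht i hi hiInf)⟩
    refine le_of_tendsto_of_tendsto (hxc t _ (death_mem_valueLabels hi hiInf))
      ((hxc t _ (birth_mem_valueLabels hi)).add_const ε) ?_
    filter_upwards [hshort (ε / 2) (half_pos hε)] with s hs
    linarith [hs.2]
  refine ⟨S, Inf, x, ⟨fun e he s t => ?_, fun t ht => ?_, fun t ht e he => ?_,
    fun t ht hnc i hi hnone => ?_⟩⟩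
  · have := (hx e he).1.dist_le_mul s t
    rwa [NNReal.coe_one, one_mul, Subtype.dist_eq, Real.dist_eq, Real.dist_eq] at this
  · have hdeath : ∀ i I, γ i t = some I → i ∉ Inf → I.death = (x (i, true) t : EReal) := by
      intro i I hI hiInf
      have hi := hpres t ht i (by simp [hI])
      rw [hval t ht (i, true) (death_mem_valueLabels hi.1 hiInf) (by simp [hI])]
      have htop : I.death ≠ ⊤ := by
        intro h
        refine hiInf (hi.2.1 ?_)
        rw [hI]
        exact h
      simp only [rawValue, hI, deathOf]
      exact (EReal.coe_toReal htop (ne_bot_of_gt I.birth_lt_death)).symm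
    have hbirth : ∀ i I, γ i t = some I → I.birth = x (i, false) t := by
      intro i I hI
      have hi := hpres t ht i (by simp [hI])
      rw [hval t ht (i, false) (birth_mem_valueLabels hi.1) (by simp [hI])]
      simp [rawValue, hI, birthOf]
    refine ⟨hbirth, hdeath, fun i I hI hi => ?_, fun i => ⟨fun hi => ?_, ?_⟩, hle t ht⟩
    · have := (hpres t ht i (by simp [hI])).2.2 hi
      rw [hI] at this
      exact this
    · refine ⟨(hpres t ht i hi).1, ?_⟩
      by_cases hiInf : i ∈ Inf
      · exact Or.inl hiInf
      · obtain ⟨I, hI⟩ := Option.ne_none_iff_exists'.1 hi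
        have h1 := I.birth_lt_death
        rw [hdeath i I hI hiInf, hbirth i I hI] at h1
        exact Or.inr (by exact_mod_cast h1)
    · rintro ⟨hi, h1⟩ hnone
      obtain ⟨h2, h3⟩ := habs t ht i hi hnone
      exact (h1.resolve_left h2).ne' h3
  · by_cases hnone : γ e.1 t = none
    · -- The support lies on one side of `t`, so that limits along it are limits along `(T₀, T₁)`.
      obtain ⟨hiInf, heq⟩ := habs t ht e.1 he.1 hnone
      have hsub : Ioo T₀ T₁ ⊆ supp (γ e.1) := fun s hs => (hSI s hs e.1).1.2 he.1
      have hcl : t ∈ closure (supp (γ e.1)) \ supp (γ e.1) :=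
        ⟨closure_mono hsub (by rw [closure_Ioo hT.ne]; exact ht), fun h => h hnone⟩
      obtain ⟨m, hm⟩ : (Ioo T₀ T₁).Nonempty := exists_between hT
      have hside : Ioo T₀ T₁ ∈ 𝓝[supp (γ e.1)] t := by
        have hoc := (hγ e.1).ordConnected
        rcases ht.1.eq_or_lt with h0 | h0
        · rw [← h0]
          filter_upwards [nhdsWithin_le_nhds (gt_mem_nhds hT), self_mem_nhdsWithin] with s hs hs'
          refine ⟨?_, hs⟩
          by_contra! hle'
          exact hcl.2 (h0 ▸ hoc.out hs' (hsub hm) ⟨hle', hm.1.le⟩)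
        · rcases ht.2.eq_or_lt with h1 | h1
          · rw [h1]
            filter_upwards [nhdsWithin_le_nhds (lt_mem_nhds hT), self_mem_nhdsWithin]
              with s hs hs'
            refine ⟨hs, ?_⟩
            by_contra! hle'
            exact hcl.2 (h1 ▸ hoc.out (hsub hm) hs' ⟨hm.2.le, hle'⟩)
          · exact absurd hnone ((hSI t ⟨h0, h1⟩ e.1).1.2 he.1)
      have hraw : Tendsto (rawValue γ e) (𝓝[supp (γ e.1)] t) (𝓝 (x e t)) :=
        ((hxc t e he).congr' (hxr t e he)).mono_left (nhdsWithin_le_of_mem hside)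
      obtain ⟨i, k⟩ := e
      cases k with
      | false => exact Or.inr ⟨hcl, hraw⟩
      | true =>
        refine Or.inr ⟨hcl, ?_⟩
        have h1 := (continuous_coe_real_ereal.tendsto _).comp hraw
        refine h1.congr' ?_
        filter_upwards [hside] with s hs
        have htop : deathOf (γ i s) ≠ ⊤ := fun h => hiInf ((hSI s hs i).2.1 h)
        have hbot : deathOf (γ i s) ≠ ⊥ := by
          have := (alive_iff.1 (alive_birthOf ((hSI s hs i).1.2 he.1))).2.2
          exact ne_bot_of_gt this
        exact EReal.coe_toReal htop hbot
    · rw [hval t ht e he hnone]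
      obtain ⟨i, k⟩ := e
      obtain ⟨I, hI⟩ := Option.ne_none_iff_exists'.1 hnone
      have hI : γ i t = some I := hI
      cases k with
      | false => exact Or.inl ⟨I, hI, by simp [rawValue, hI, birthOf]⟩
      | true =>
        refine Or.inl ⟨I, hI, ?_⟩
        have htop : I.death ≠ ⊤ := by
          intro h
          refine he.2 rfl ((hpres t ht i hnone).2.1 ?_)
          rw [hI]
          exact h
        simp only [rawValue, hI, deathOf]
        exact (EReal.coe_toReal htop (ne_bot_of_gt I.birth_lt_death)).symm
  · refine hnc (Or.inr ⟨i, closure_mono (fun s hs => (hSI s hs i).1.2 hi)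
      (by rw [closure_Ioo hT.ne]; exact ht), fun h => h hnone⟩)

end

/-! ### Linear combinations under carrying morphisms and transformations -/

section

variable {K : Type u} [Field K] {N : ℕ} {X Y Z : PersistenceModule.{u, v} K}
  {c c' c'' : Fin N → Option Bar} {h h₁ h₂ h₃ : ℝ}

theorem ExtBasis.combo_eq_sum_single (B : ExtBasis X c) (q : ℝ) (m : Fin N → K) :
    B.combo q m = ∑ j, m j • B.combo q (Pi.single j 1) := by
  have hm : m = ∑ j, m j • (Pi.single j 1 : Fin N → K) := by
    ext i
    simp [Finset.sum_apply, Pi.single_apply]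
  conv_lhs => rw [hm, map_sum]
  simp

theorem Carries.app_combo {α : ShiftMorphism X Y h} {B : ExtBasis X c} {B' : ExtBasis Y c'}
    (H : Carries α B B') {r : ℝ} {m : Fin N → K}
    (hm : ∀ j, m j ≠ 0 → c j ≠ none ∧ birthOf (c j) ≤ r) :
    α.app r (B.combo r m) = B'.combo (r + h) m := by
  rw [B.combo_eq_sum_single, B'.combo_eq_sum_single, map_sum]
  refine Finset.sum_congr rfl fun j _ => ?_
  by_cases hj : m j = 0
  · simp [hj]
  obtain ⟨h1, h2⟩ := hm j hj
  rw [map_smul, B.combo_single h2, one_smul, α.naturality h2, (H j h1).1, B'.map_combo]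
  intro i hi hi'
  have : i = j := by
    by_contra hij
    exact hi (Pi.single_eq_of_ne hij _)
  exact this ▸ (H j h1).2 (this ▸ hi')

theorem IsTransformOf.combo_eq {B B' : ExtBasis X c} {M : Matrix (Fin N) (Fin N) K}
    (H : IsTransformOf B' M B) {q : ℝ} {m : Fin N → K}
    (hm : ∀ j, m j ≠ 0 → c j ≠ none ∧ birthOf (c j) ≤ q) :
    B'.combo q m = B.combo q (M.mulVec m) := by
  have hsum : M.mulVec m = ∑ j, m j • fun i => M i j := by
    ext i
    simp [Matrix.mulVec, dotProduct, Finset.sum_apply, mul_comm]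
  rw [B'.combo_eq_sum_single, hsum, map_sum]
  refine Finset.sum_congr rfl fun j _ => ?_
  by_cases hj : m j = 0
  · simp [hj]
  obtain ⟨h1, h2⟩ := hm j hj
  rw [map_smul, B'.combo_single h2, one_smul, H.2, map_transform H.1 B h1]

/-- If `B` is carried to `B'` and to `B''`, then `B'` is carried to `B''`, provided that no bar ends
between the heights where these carryings can be compared. -/
theorem Carries.of_comp {α : ShiftMorphism X Y h₁} {α' : ShiftMorphism Y Z h₂}
    {α'' : ShiftMorphism X Z h₃} {hle : ∀ r, r + h₁ + h₂ ≤ r + h₃}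
    (hα : ∀ r (w : X.obj r), Z.map (hle r) (α'.app _ (α.app r w)) = α''.app r w)
    {B : ExtBasis X c} {B' : ExtBasis Y c'} {B'' : ExtBasis Z c''} (H : Carries α B B')
    (H'' : Carries α'' B B'') (hc : ∀ i, c' i ≠ none → c i ≠ none)
    (hb : ∀ i, c' i ≠ none → c'' i ≠ none → birthOf (c'' i) ≤ birthOf (c' i) + h₂)
    (hal : ∀ i, c' i ≠ none → ∀ j,
      Alive (c'' j) (birthOf (c' i) + h₂) → Alive (c'' j) (birthOf (c i) + h₃)) :
    Carries α' B' B'' := by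
  rw [carries_iff]
  intro i hi'
  have hi := hc i hi'
  have hle₁ := (H i hi).2 hi'
  have hle₂ : birthOf (c' i) + h₂ ≤ birthOf (c i) + h₃ :=
    (add_le_add_left hle₁ h₂).trans (hle _)
  have key : α''.app (birthOf (c i)) (B.elt i) =
      Z.map hle₂ (α'.app (birthOf (c' i)) (B'.elt i)) := by
    have happ : α.app (birthOf (c i)) (B.elt i) = Y.map hle₁ (B'.elt i) := H.app_elt hi hi'
    rw [← hα, happ, α'.naturality, Z.map_map]
  have hinj := B''.map_injective hle₂ (hal i hi')
  have H₁ := carries_iff.1 H'' i hi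
  constructor
  · intro h0
    apply hinj
    rw [← key, H₁.1 h0, map_zero]
  · intro h0
    obtain ⟨h1, h2⟩ := H₁.2 h0
    refine ⟨hb i hi' h0, hinj ?_⟩
    rw [← key, h2, Z.map_map]

end

/-! ### Families of bases over a segment -/

section

variable {K : Type u} [Field K] {a b : ℝ} {N : ℕ} {V : VineyardModule.{u, v} K a b}
  {γ : Fin N → Icc a b → Option Bar} {T₀ T₁ : Icc a b} {S Inf : Set (Fin N)}
  {x : Fin N × Bool → Icc a b → ℝ}

theorem SegmentValues.close (hv : SegmentValues γ T₀ T₁ S Inf x) {s t : Icc a b} (hst : s ≤ t)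
    {e : Fin N × Bool} (he : e ∈ valueLabels S Inf) : |x e s - x e t| ≤ (t : ℝ) - s := by
  have h := hv.lipschitz e he s t
  rwa [abs_sub_comm (s : ℝ), abs_of_nonneg (sub_nonneg.2 (Subtype.coe_le_coe.2 hst))] at h

theorem SegmentValues.coincide (hv : SegmentValues γ T₀ T₁ S Inf x) {t : Icc a b}
    (ht : t ∈ Icc T₀ T₁) {e e' : Fin N × Bool} (he : e ∈ valueLabels S Inf)
    (he' : e' ∈ valueLabels S Inf) (hne : e ≠ e') (heq : x e t = x e' t) : Coincide γ t e e' :=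
  ⟨hne, x e t, hv.isValue t ht e he, heq ▸ hv.isValue t ht e' he'⟩

/-- The order of critical values does not change over an interval without critical times. -/
theorem SegmentValues.le_of_le (hv : SegmentValues γ T₀ T₁ S Inf x) {I : Set (Icc a b)}
    (hI : I.OrdConnected) (hIT : I ⊆ Icc T₀ T₁) (hcrit : ∀ t ∈ I, ¬ IsCritical γ t) {s t : Icc a b}
    (hs : s ∈ I) (ht : t ∈ I) {e e' : Fin N × Bool} (he : e ∈ valueLabels S Inf)
    (he' : e' ∈ valueLabels S Inf) (hle : x e s ≤ x e' s) : x e t ≤ x e' t := by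
  by_contra! hlt
  have hc : ∀ e ∈ valueLabels S Inf, ContinuousOn (x e) I := by
    intro e he
    have : LipschitzWith 1 (x e) := LipschitzWith.of_dist_le_mul fun p q => by
      rw [NNReal.coe_one, one_mul, Subtype.dist_eq, Real.dist_eq, Real.dist_eq]
      exact hv.lipschitz e he p q
    exact this.continuous.continuousOn
  obtain ⟨r, hr, heq⟩ := (isPreconnected_of_ordConnected hI).intermediate_value₂ hs ht
    (hc e he) (hc e' he') hle hlt.le
  have hne : e ≠ e' := by
    rintro rfl
    exact lt_irrefl _ hlt
  exact hcrit r hr (Or.inl ⟨e, e', hv.coincide (hIT hr) he he' hne heq⟩)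

theorem SegmentValues.bar_le_of_bar_le (hv : SegmentValues γ T₀ T₁ S Inf x) {I : Set (Icc a b)}
    (hI : I.OrdConnected) (hIT : I ⊆ Icc T₀ T₁) (hcrit : ∀ t ∈ I, ¬ IsCritical γ t) {s t : Icc a b}
    (hs : s ∈ I) (ht : t ∈ I) {i j : Fin N} {P Q P' Q' : Bar} (hP : γ i s = some P)
    (hQ : γ j s = some Q) (hP' : γ i t = some P') (hQ' : γ j t = some Q') (hle : Q ≤ P) :
    Q' ≤ P' := by
  have hvs := hv.hasValues s (hIT hs)
  have hvt := hv.hasValues t (hIT ht)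
  have hi : i ∈ S := hvs.mem_of_present (i := i) (by simp [hP])
  have hj : j ∈ S := hvs.mem_of_present (i := j) (by simp [hQ])
  rw [hvs.le_iff hP hQ] at hle
  rw [hvt.le_iff hP' hQ']
  refine ⟨hv.le_of_le hI hIT hcrit hs ht (birth_mem_valueLabels hj) (birth_mem_valueLabels hi)
    hle.1, ?_⟩
  by_cases hiInf : i ∈ Inf
  · exact Or.inl hiInf
  · obtain ⟨hjInf, hd⟩ := hle.2.resolve_left hiInf
    exact Or.inr ⟨hjInf, hv.le_of_le hI hIT hcrit hs ht (death_mem_valueLabels hj hjInf)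
      (death_mem_valueLabels hi hiInf) hd⟩

theorem VineyardModule.carries_comp {r s t : Icc a b} (h : r < s) (h' : s < t)
    {B : ExtBasis (V.mod r) fun i => γ i r} {B' : ExtBasis (V.mod s) fun i => γ i s}
    {B'' : ExtBasis (V.mod t) fun i => γ i t} (hp : ∀ i, γ i r ≠ none → γ i s ≠ none)
    (H : Carries (V.α h) B B') (H' : Carries (V.α h') B' B'') :
    Carries (V.α (h.trans h')) B B'' :=
  H.comp (V.α_comp h h') H' hp

/-- Near a time that is not critical, carrying gives bijections between the bases at all times. -/
theorem SegmentValues.exists_nhd (hv : SegmentValues γ T₀ T₁ S Inf x) (B : BasisFamily V γ)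
    {r : Icc a b} (hr : r ∈ Icc T₀ T₁) (hrc : ¬ IsCritical γ r) :
    ∃ U : Set (Icc a b), IsOpen U ∧ U.OrdConnected ∧ r ∈ U ∧
      ∀ (s t : Icc a b) (h : s < t), s ∈ U → t ∈ U → s ∈ Icc T₀ T₁ → t ∈ Icc T₀ T₁ →
        ¬ IsCritical γ s → ¬ IsCritical γ t →
        (∀ B : ExtBasis (V.mod s) fun i => γ i s,
          ∃! B' : ExtBasis (V.mod t) fun i => γ i t, Carries (V.α h) B B') ∧
        ∀ B' : ExtBasis (V.mod t) fun i => γ i t,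
          ∃! B : ExtBasis (V.mod s) fun i => γ i s, Carries (V.α h) B B' := by
  obtain ⟨η, hη, hgap⟩ := exists_pos_lt_abs_sub fun e => x e r
  refine ⟨Metric.ball r (η / 8), Metric.isOpen_ball, ⟨?_⟩, Metric.mem_ball_self (by positivity), ?_⟩
  · intro p hp q hq t ht
    rw [Metric.mem_ball, Subtype.dist_eq, Real.dist_eq, abs_lt] at hp hq ⊢
    have h1 : (p : ℝ) ≤ t := ht.1
    have h2 : (t : ℝ) ≤ q := ht.2
    constructor <;> linarith
  intro s t h hsU htU hs ht hsc htc
  rw [Metric.mem_ball, Subtype.dist_eq, Real.dist_eq] at hsU htU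
  have hgap' : ∀ p : Icc a b, |(p : ℝ) - r| < η / 8 → ∀ e ∈ valueLabels S Inf,
      ∀ e' ∈ valueLabels S Inf, x e p ≠ x e' p → 2 * ((t : ℝ) - s) < |x e p - x e' p| := by
    intro p hp e he e' he' hne
    have hne' : e ≠ e' := by
      rintro rfl
      exact hne rfl
    have h1 := hgap e e' fun heq => hrc (Or.inl ⟨e, e', hv.coincide hr he he' hne' heq⟩)
    have h2 := hv.lipschitz e he p r
    have h3 := hv.lipschitz e' he' p r
    rw [abs_lt] at hsU htU
    rw [abs_le] at h2 h3
    rcases lt_abs.1 h1 with h1 | h1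
    · refine lt_of_lt_of_le ?_ (le_abs_self _)
      linarith
    · refine lt_of_lt_of_le ?_ (neg_le_abs _)
      linarith
  exact (V.interleaving h).existsUnique_carries (B s) (B t) (hv.hasValues s hs)
    (hv.hasValues t ht) (hv.present_of_not_critical s hs hsc) (hv.present_of_not_critical t ht htc)
    (fun e he => hv.close h.le he) (hgap' s hsU) (hgap' t htU)

/-- A basis at the beginning of a segment extends over the times that are not critical. -/
theorem SegmentValues.exists_forward_family (hv : SegmentValues γ T₀ T₁ S Inf x)
    (B : BasisFamily V γ) (hT : T₀ < T₁) (hcrit : ∀ t ∈ Ico T₀ T₁, ¬ IsCritical γ t)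
    (B₀ : ExtBasis (V.mod T₀) fun i => γ i T₀) :
    ∃ σ : BasisFamily V γ, σ T₀ = B₀ ∧ ∀ s t (h : s < t), s ∈ Ico T₀ T₁ → t ∈ Ico T₀ T₁ →
      Carries (V.α h) (σ s) (σ t) := by
  have : ∀ t, Nonempty (ExtBasis (V.mod t) fun i => γ i t) := fun t => ⟨B t⟩
  refine exists_section (F := fun t => ExtBasis (V.mod t) fun i => γ i t)
    (fun s t h B B' => Carries (V.α h) B B')
    (isPreconnected_of_ordConnected ordConnected_Ico) (left_mem_Ico.2 hT) (fun t ht => ht.1)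
    (fun r s t h h' hr hs _ B B' B'' H H' => V.carries_comp h h' (fun i hi => ?_) H H') ?_ B₀
  · exact hv.present_of_not_critical s ⟨hs.1, hs.2.le⟩ (hcrit s hs) i
      ((hv.hasValues r ⟨hr.1, hr.2.le⟩).mem_of_present hi)
  · intro r hr
    obtain ⟨U, h1, h2, h3, h4⟩ := hv.exists_nhd B ⟨hr.1, hr.2.le⟩ (hcrit r hr)
    refine ⟨U, h1, h2, h3, fun s t h hs ht => ?_⟩
    exact (h4 s t h hs.1 ht.1 ⟨hs.2.1, hs.2.2.le⟩ ⟨ht.2.1, ht.2.2.le⟩ (hcrit s hs.2)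
      (hcrit t ht.2)).1

/-- A basis at the end of a segment extends backwards over the times that are not critical. -/
theorem SegmentValues.exists_backward_family (hv : SegmentValues γ T₀ T₁ S Inf x)
    (B : BasisFamily V γ) (hT : T₀ < T₁) (hcrit : ∀ t ∈ Ioc T₀ T₁, ¬ IsCritical γ t)
    (B₁ : ExtBasis (V.mod T₁) fun i => γ i T₁) :
    ∃ σ : BasisFamily V γ, σ T₁ = B₁ ∧ ∀ s t (h : s < t), s ∈ Ioc T₀ T₁ → t ∈ Ioc T₀ T₁ →
      Carries (V.α h) (σ s) (σ t) := by
  have : ∀ t : (Icc a b)ᵒᵈ,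
      Nonempty (ExtBasis (V.mod (OrderDual.ofDual t)) fun i => γ i (OrderDual.ofDual t)) :=
    fun t => ⟨B (OrderDual.ofDual t)⟩
  have hI' : IsPreconnected (Ioc T₀ T₁) := isPreconnected_of_ordConnected ordConnected_Ioc
  have hI : IsPreconnected (OrderDual.ofDual ⁻¹' Ioc T₀ T₁ : Set (Icc a b)ᵒᵈ) := hI'
  have hex : ∃ σ : ∀ t : (Icc a b)ᵒᵈ,
      ExtBasis (V.mod (OrderDual.ofDual t)) fun i => γ i (OrderDual.ofDual t),
      σ (OrderDual.toDual T₁) = B₁ ∧ ∀ s t (h : s < t), s ∈ OrderDual.ofDual ⁻¹' Ioc T₀ T₁ →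
        t ∈ OrderDual.ofDual ⁻¹' Ioc T₀ T₁ →
          Carries (V.α (OrderDual.ofDual_lt_ofDual.2 h)) (σ t) (σ s) := by
    refine exists_section (ι := (Icc a b)ᵒᵈ)
      (F := fun t => ExtBasis (V.mod (OrderDual.ofDual t)) fun i => γ i (OrderDual.ofDual t))
      (fun s t h B B' => Carries (V.α (OrderDual.ofDual_lt_ofDual.2 h)) B' B)
      hI (t₀ := OrderDual.toDual T₁) (right_mem_Ioc.2 hT) (fun t ht => ht.2)
      (fun r s t h h' hr hs ht B B' B'' H H' =>
        V.carries_comp (OrderDual.ofDual_lt_ofDual.2 h') (OrderDual.ofDual_lt_ofDual.2 h)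
          (fun i hi => ?_) H' H) ?_ B₁
    · exact hv.present_of_not_critical _ ⟨hs.1.le, hs.2⟩ (hcrit _ hs) i
        ((hv.hasValues _ ⟨ht.1.le, ht.2⟩).mem_of_present hi)
    · intro r hr
      obtain ⟨U, h1, h2, h3, h4⟩ := hv.exists_nhd B (r := OrderDual.ofDual r) ⟨hr.1.le, hr.2⟩
        (hcrit _ hr)
      refine ⟨OrderDual.ofDual ⁻¹' U, h1, h2.dual, h3, fun s t h hs ht => ?_⟩
      exact (h4 _ _ (OrderDual.ofDual_lt_ofDual.2 h) ht.1 hs.1 ⟨ht.2.1.le, ht.2.2⟩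
        ⟨hs.2.1.le, hs.2.2⟩ (hcrit _ ht.2) (hcrit _ hs.2)).2
  obtain ⟨σ, h1, h2⟩ := hex
  exact ⟨fun t => σ (OrderDual.toDual t), h1, fun s t h hs ht =>
    h2 (OrderDual.toDual t) (OrderDual.toDual s) h ht hs⟩

/-- For times near `r`, the bars present at `r` are longer than the shifts that occur. -/
theorem SegmentValues.exists_alive (hv : SegmentValues γ T₀ T₁ S Inf x) {r : Icc a b}
    (hr : r ∈ Icc T₀ T₁) : ∃ δ > (0 : ℝ), ∀ s t : Icc a b, s < t → s ∈ Icc T₀ T₁ →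
      t ∈ Icc T₀ T₁ → |(s : ℝ) - r| < δ → |(t : ℝ) - r| < δ → ∀ i, γ i r ≠ none →
        γ i s ≠ none → Alive (γ i t) (birthOf (γ i s) + ((t : ℝ) - s)) := by
  obtain ⟨η, hη, hgap⟩ := exists_pos_lt_abs_sub fun e => x e r
  refine ⟨η / 8, by positivity, fun s t hst hs ht hsr htr i hir his => ?_⟩
  have hi := (hv.hasValues s hs).mem_of_present his
  have hst' : (s : ℝ) < t := hst
  rw [(hv.hasValues s hs).birthOf_eq his, (hv.hasValues t ht).alive_iff]
  have hb := abs_le.1 (hv.close hst.le (birth_mem_valueLabels (Inf := Inf) hi))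
  have hbr := abs_le.1 (hv.lipschitz _ (birth_mem_valueLabels (Inf := Inf) hi) s r)
  refine ⟨hi, by linarith, ?_⟩
  by_cases hInf : i ∈ Inf
  · exact Or.inl hInf
  · have hlt := ((((hv.hasValues r hr).present_iff i).1 hir).2.resolve_left hInf)
    have h1 := hgap (i, false) (i, true) hlt.ne
    rw [abs_of_neg (sub_neg.2 hlt)] at h1
    have hdr := abs_le.1 (hv.lipschitz _ (death_mem_valueLabels hi hInf) t r)
    rw [abs_lt] at hsr htr
    have h2 : |(s : ℝ) - r| < η / 8 := abs_lt.2 hsr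
    have h3 : |(t : ℝ) - r| < η / 8 := abs_lt.2 htr
    exact Or.inr (by linarith)

/-- If a family of bases is carried along all morphisms after `T₀`, its matrices between close times
are projections. -/
theorem SegmentValues.forCloseTimes (hv : SegmentValues γ T₀ T₁ S Inf x) (hT : T₀ < T₁)
    (hcrit : ∀ t, T₀ < t → t < T₁ → ¬ IsCritical γ t) {B : BasisFamily V γ}
    (hB : ∀ s t (h : s < t), T₀ < s → t ≤ T₁ → Carries (V.α h) (B s) (B t)) :
    ForCloseTimes T₀ T₁ fun s t h =>
      matrixOf (B s) (B t) (V.α h) = projMatrix (present γ s ∩ present γ t) := by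
  constructor
  · intro r hr₀ hr₁
    obtain ⟨δ, hδ, hal⟩ := hv.exists_alive (r := r) ⟨hr₀.le, hr₁.le⟩
    refine ⟨δ, hδ, fun s t h hs ht hsr htr => ?_⟩
    have hs' : s ∈ Icc T₀ T₁ := ⟨hs.le, (h.trans ht).le⟩
    refine (hB s t h hs ht.le).matrixOf_eq fun i hi _ => ?_
    refine hal s t h hs' ⟨(hs.trans h).le, ht.le⟩ hsr htr i ?_ hi
    exact hv.present_of_not_critical r ⟨hr₀.le, hr₁.le⟩ (hcrit r hr₀ hr₁) i
      ((hv.hasValues s hs').mem_of_present hi)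
  · obtain ⟨δ, hδ, hal⟩ := hv.exists_alive (r := T₁) ⟨hT.le, le_rfl⟩
    refine ⟨δ, hδ, fun s h hs hsδ => ?_⟩
    have hs' : (s : ℝ) < T₁ := h
    refine (hB s T₁ h hs le_rfl).matrixOf_eq fun i hi hi' => ?_
    refine hal s T₁ h ⟨hs.le, h.le⟩ ⟨hT.le, le_rfl⟩ ?_ (by simpa using hδ) i hi' hi
    rw [abs_lt]
    constructor <;> linarith

end

/-! ### Segments with separated critical values at one end -/

section

variable {K : Type u} [Field K] {a b : ℝ} {N : ℕ} {V : VineyardModule.{u, v} K a b}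
  {γ : Fin N → Icc a b → Option Bar} {T₀ T₁ : Icc a b} {S Inf : Set (Fin N)}
  {x : Fin N × Bool → Icc a b → ℝ}

theorem SegmentValues.add_le_of_quarterGap (hv : SegmentValues γ T₀ T₁ S Inf x) {t : Icc a b}
    (ht : t ∈ Icc T₀ T₁) {h : ℝ} (hq : QuarterGap γ t h) {e e' : Fin N × Bool}
    (he : e ∈ valueLabels S Inf) (he' : e' ∈ valueLabels S Inf) (hlt : x e t < x e' t) :
    x e t + 4 * h ≤ x e' t := by
  have h1 := hq e e' _ _ (hv.isValue t ht e he) (hv.isValue t ht e' he') hlt.ne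
  rw [abs_of_neg (sub_neg.2 hlt)] at h1
  linarith

theorem exists_time_after (hT : T₀ < T₁) {δ : ℝ} (hδ : 0 < δ) :
    ∃ t : Icc a b, T₀ < t ∧ t < T₁ ∧ (t : ℝ) < T₀ + δ := by
  have hT' : (T₀ : ℝ) < T₁ := hT
  obtain ⟨r, hr₀, hr₁⟩ := exists_between
    (show (T₀ : ℝ) < min (T₁ : ℝ) (T₀ + δ) from lt_min hT' (by linarith))
  obtain ⟨hr₁, hr₂⟩ := lt_min_iff.1 hr₁
  exact ⟨⟨r, T₀.2.1.trans hr₀.le, hr₁.le.trans T₁.2.2⟩, hr₀, hr₁, hr₂⟩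

/-- Over an interval without critical times the order of bars does not change, so that there is no
incompatibility at its beginning. -/
theorem SegmentValues.forwardsCompatible (hv : SegmentValues γ T₀ T₁ S Inf x) (hT : T₀ < T₁)
    (hcrit : ∀ t ∈ Ico T₀ T₁, ¬ IsCritical γ t) : ForwardsCompatible γ T₀ := by
  rintro k l ⟨⟨I, J, hI, hJ, hle⟩, δ, hδ, hinc⟩
  obtain ⟨t, ht₀, ht₁, htδ⟩ := exists_time_after hT hδ
  have ht : t ∈ Ico T₀ T₁ := ⟨ht₀.le, ht₁⟩
  have hT₀ : T₀ ∈ Ico T₀ T₁ := ⟨le_rfl, hT⟩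
  have hv₀ := hv.hasValues T₀ ⟨le_rfl, hT.le⟩
  have hp : ∀ i, γ i T₀ ≠ none → γ i t ≠ none := fun i hi =>
    hv.present_of_not_critical t ⟨ht.1, ht.2.le⟩ (hcrit t ht) i (hv₀.mem_of_present hi)
  obtain ⟨I', hI'⟩ := Option.ne_none_iff_exists'.1 (hp l (by simp [hI]))
  obtain ⟨J', hJ'⟩ := Option.ne_none_iff_exists'.1 (hp k (by simp [hJ]))
  exact hinc t ht₀ htδ I' J' hI' hJ' (hv.bar_le_of_bar_le ordConnected_Ico Ico_subset_Icc_self hcrit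
    hT₀ ht hJ hI hJ' hI' hle)

/-- If the critical values are well separated at the end of the segment, the basis at the beginning
is carried through the whole segment. At the end, the result differs from the old basis by a basis
transformation, whose matrix is that of the interleaving morphism. -/
theorem SegmentValues.exists_isForwardSimplified_of_gap_end (hv : SegmentValues γ T₀ T₁ S Inf x)
    (hdist : ∀ t i j, γ i t ≠ none → γ i t = γ j t → i = j) (hT : T₀ < T₁)
    (hcrit : ∀ t ∈ Ico T₀ T₁, ¬ IsCritical γ t) (hq : QuarterGap γ T₁ ((T₁ : ℝ) - T₀))
    (Bold : BasisFamily V γ) : ∃ Bnew, IsForwardSimplified V γ hT Bold Bnew := by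
  have hT' : (T₀ : ℝ) < T₁ := hT
  have m₀ : T₀ ∈ Icc T₀ T₁ := ⟨le_rfl, hT.le⟩
  have m₁ : T₁ ∈ Icc T₀ T₁ := ⟨hT.le, le_rfl⟩
  have v₀ := hv.hasValues T₀ m₀
  have v₁ := hv.hasValues T₁ m₁
  have pres : ∀ t ∈ Ico T₀ T₁, ∀ i ∈ S, γ i t ≠ none := fun t ht =>
    hv.present_of_not_critical t ⟨ht.1, ht.2.le⟩ (hcrit t ht)
  have gap : ∀ {e e'}, e ∈ valueLabels S Inf → e' ∈ valueLabels S Inf → x e T₁ < x e' T₁ →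
      x e T₁ + 4 * ((T₁ : ℝ) - T₀) ≤ x e' T₁ := hv.add_le_of_quarterGap m₁ hq
  have window : ∀ i ∈ S, ∀ p q, x (i, false) T₁ ≤ p → p ≤ q →
      q ≤ x (i, false) T₁ + 2 * ((T₁ : ℝ) - T₀) → ∀ j, Alive (γ j T₁) p → Alive (γ j T₁) q := by
    intro i hi p q hp hpq hq j hj
    refine v₁.alive_mono hpq (fun k hk hkInf hlt => ?_) j hj
    have := gap (birth_mem_valueLabels hi) (death_mem_valueLabels hk hkInf) (hp.trans_lt hlt)
    linarith
  obtain ⟨B₁, hB₁⟩ := (V.interleaving hT).exists_carries (Bold T₀) (Bold T₁) v₀ v₁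
    (pres T₀ ⟨le_rfl, hT⟩) (fun e he => hv.close hT.le he) (by
      intro e he e' he' hne
      rcases lt_or_gt_of_ne hne with hlt | hlt
      · have := gap he he' hlt
        rw [abs_sub_comm]
        exact lt_of_lt_of_le (by linarith) (le_abs_self _)
      · have := gap he' he hlt
        exact lt_of_lt_of_le (by linarith) (le_abs_self _))
  obtain ⟨σ, hσ₀, hσ⟩ := hv.exists_forward_family Bold hT hcrit (Bold T₀)
  set B : BasisFamily V γ := Function.update σ T₁ B₁
  have hB1 : B T₁ = B₁ := Function.update_self _ _ _
  have hBσ : ∀ t < T₁, B t = σ t := fun t ht => Function.update_of_ne ht.ne _ _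
  have hB0 : B T₀ = Bold T₀ := (hBσ T₀ hT).trans hσ₀
  have hend : ∀ t (h : t < T₁), T₀ ≤ t → Carries (V.α h) (B t) (B T₁) := by
    intro t h ht
    rw [hBσ t h, hB1]
    rcases ht.eq_or_lt with rfl | ht
    · rw [hσ₀]
      exact hB₁
    have ht' : t ∈ Ico T₀ T₁ := ⟨ht.le, h⟩
    have vt := hv.hasValues t ⟨ht.le, h.le⟩
    have hc := hσ T₀ t ht ⟨le_rfl, hT⟩ ht'
    rw [hσ₀] at hc
    have e1 : ∀ i ∈ S, birthOf (γ i t) = x (i, false) t := fun i hi =>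
      vt.birthOf_eq (pres t ht' i hi)
    have e0 : ∀ i ∈ S, birthOf (γ i T₀) = x (i, false) T₀ := fun i hi =>
      v₀.birthOf_eq (pres T₀ ⟨le_rfl, hT⟩ i hi)
    have c1 : ∀ i ∈ S, _ := fun i hi =>
      abs_le.1 (hv.close h.le (birth_mem_valueLabels (Inf := Inf) (i := i) hi))
    have c2 : ∀ i ∈ S, _ := fun i hi =>
      abs_le.1 (hv.close ht.le (birth_mem_valueLabels (Inf := Inf) (i := i) hi))
    have c3 : ∀ i ∈ S, _ := fun i hi =>
      abs_le.1 (hv.close hT.le (birth_mem_valueLabels (Inf := Inf) (i := i) hi))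
    refine hc.of_comp (V.α_comp ht h) hB₁
      (fun i hi => pres T₀ ⟨le_rfl, hT⟩ i (vt.mem_of_present hi)) (fun i hi hi' => ?_)
      fun i hi => ?_
    · have hiS := vt.mem_of_present hi
      rw [v₁.birthOf_eq hi', e1 i hiS]
      linarith [c1 i hiS]
    · have hiS := vt.mem_of_present hi
      refine window i hiS _ _ ?_ ?_ ?_
      · rw [e1 i hiS]
        linarith [c1 i hiS]
      · rw [e1 i hiS, e0 i hiS]
        linarith [c2 i hiS]
      · rw [e0 i hiS]
        linarith [c3 i hiS]
  have hall : ∀ s t (h : s < t), T₀ ≤ s → t ≤ T₁ → Carries (V.α h) (B s) (B t) := by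
    intro s t h hs ht
    rcases ht.eq_or_lt with rfl | ht
    · exact hend s h hs
    · rw [hBσ s (h.trans ht), hBσ t ht]
      exact hσ s t h ⟨hs, h.trans ht⟩ ⟨hs.trans h.le, ht⟩
  have hcompat := hv.forwardsCompatible hT hcrit
  refine ⟨B, hB0, hv.forCloseTimes hT (fun t h h' => hcrit t ⟨h.le, h'⟩)
    fun s t h hs ht => hall s t h hs.le ht, fun _ => ⟨?_, ?_⟩,
    fun k l hinc => absurd hinc (hcompat k l)⟩
  · set M := matrixOf (B T₁) (Bold T₁) (idShift (V.mod T₁))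
    have hM : IsTransformOf (B T₁) M (Bold T₁) :=
      isTransformOf_matrixOf_idShift (hdist T₁) _ _
    have hMA : ∀ i j, γ i T₁ ≠ none → γ j T₁ ≠ none →
        M j i = fillDiagonal (matrixOf (B T₀) (Bold T₁) (V.α hT)) j i := by
      intro i j hi hj
      have hiS := v₁.mem_of_present hi
      have hi₀ := pres T₀ ⟨le_rfl, hT⟩ i hiS
      have hc := hend T₀ hT le_rfl
      have hle := (hc i hi₀).2 hi
      have happ : (V.α hT).app _ ((B T₀).elt i) = (Bold T₁).combo _ fun j => M j i := by
        rw [← map_transform hM.1 (Bold T₁) hi hle, ← hM.2 i]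
        exact hc.app_elt hi₀ hi
      have hal : M j i ≠ 0 → Alive (γ j T₁) (birthOf (γ i T₀) + ((T₁ : ℝ) - T₀)) := by
        intro hji
        have h1 : Alive (γ j T₁) (birthOf (γ i T₁) + 0) := by
          by_contra hna
          exact hji (matrixOf_apply_of_not_alive hna)
        have c3 := abs_le.1 (hv.close hT.le (birth_mem_valueLabels (Inf := Inf) hiS))
        have e0 := v₀.birthOf_eq hi₀
        have e1 := v₁.birthOf_eq hi
        exact window i hiS _ _ (by linarith) (by linarith) (by linarith) j h1
      have hA : matrixOf (B T₀) (Bold T₁) (V.α hT) j i = M j i := by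
        by_cases hji : M j i = 0
        · by_cases h1 : Alive (γ j T₁) (birthOf (γ i T₀) + ((T₁ : ℝ) - T₀))
          · exact matrixOf_apply_of_eq_combo (c := fun i => γ i T₀) (c' := fun i => γ i T₁) happ h1
          · rw [hji, matrixOf_apply_of_not_alive h1]
        · exact matrixOf_apply_of_eq_combo (c := fun i => γ i T₀) (c' := fun i => γ i T₁) happ
            (hal hji)
      rw [fillDiagonal, Matrix.add_apply, Matrix.diagonal_apply, hA]
      by_cases hji : j = i
      · subst hji
        rw [if_pos rfl, if_neg (by rw [hA]; exact hM.1.1 j hi), add_zero]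
      · rw [if_neg hji, add_zero]
    exact ⟨hM.1.congr hMA, fun i => (hM.2 i).trans (transform_congr hMA i)⟩
  · obtain ⟨δ, hδ, hal⟩ := hv.exists_alive m₀
    refine ⟨δ, hδ, fun t h ht htδ => ?_⟩
    have h' : (T₀ : ℝ) < t := h
    refine (hall T₀ t h le_rfl ht.le).matrixOf_eq fun i hi hi' => ?_
    refine hal T₀ t h m₀ ⟨h.le, ht.le⟩ (by simpa using hδ) ?_ i hi hi
    rw [abs_lt]
    constructor <;> linarith

/-- Let the critical values be well separated at the beginning of the segment, and let a basis
transformation matrix `M` at its end and a matrix `E` be such that `M * E` is the matrix of the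
interleaving morphism with respect to the old bases, up to irrelevant entries. Then the transformed
basis at the end is carried to by a family of bases, and `E` is the matrix of the passage from the
beginning to the times right after it.

Indeed, the interleaving morphisms from later times to the end of the segment are injective at the
relevant heights, so that the images of the first basis can be identified at the end. -/
theorem SegmentValues.exists_family_of_gap_start (hv : SegmentValues γ T₀ T₁ S Inf x)
    (hdist : ∀ t i j, γ i t ≠ none → γ i t = γ j t → i = j) (hT : T₀ < T₁)
    (hcrit : ∀ t ∈ Ioc T₀ T₁, ¬ IsCritical γ t) (hq : QuarterGap γ T₀ ((T₁ : ℝ) - T₀))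
    (Bold : BasisFamily V γ) {M E : Matrix (Fin N) (Fin N) K}
    (hM : IsBasisTransformation (fun i => γ i T₁) M)
    (hE : ∀ i j, γ i T₀ ≠ none → E j i ≠ 0 → Alive (γ j T₀) (birthOf (γ i T₀)))
    (hME : ∀ i j, γ i T₀ ≠ none → Alive (γ j T₁) (birthOf (γ i T₀) + ((T₁ : ℝ) - T₀)) →
      matrixOf (Bold T₀) (Bold T₁) (V.α hT) j i = (M * E) j i) :
    ∃ Bnew : BasisFamily V γ, Bnew T₀ = Bold T₀ ∧
      ForCloseTimes T₀ T₁ (fun s t h =>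
        matrixOf (Bnew s) (Bnew t) (V.α h) = projMatrix (present γ s ∩ present γ t)) ∧
      IsTransformOf (Bnew T₁) M (Bold T₁) ∧
      ForTimesAfter T₀ T₁ (fun t h =>
        matrixOf (Bnew T₀) (Bnew t) (V.α h) = E * projMatrix (present γ T₀)) := by
  classical
  have hT' : (T₀ : ℝ) < T₁ := hT
  have m₀ : T₀ ∈ Icc T₀ T₁ := ⟨le_rfl, hT.le⟩
  have m₁ : T₁ ∈ Icc T₀ T₁ := ⟨hT.le, le_rfl⟩
  have v₀ := hv.hasValues T₀ m₀
  have v₁ := hv.hasValues T₁ m₁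
  have pres : ∀ t ∈ Ioc T₀ T₁, ∀ i ∈ S, γ i t ≠ none := fun t ht =>
    hv.present_of_not_critical t ⟨ht.1.le, ht.2⟩ (hcrit t ht)
  have gap : ∀ {e e'}, e ∈ valueLabels S Inf → e' ∈ valueLabels S Inf → x e T₀ < x e' T₀ →
      x e T₀ + 4 * ((T₁ : ℝ) - T₀) ≤ x e' T₀ := hv.add_le_of_quarterGap m₀ hq
  obtain ⟨B₁, hB₁⟩ := exists_isTransformOf (hdist T₁) hM (Bold T₁)
  obtain ⟨σ, hσ₁, hσ⟩ := hv.exists_backward_family Bold hT hcrit B₁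
  set B : BasisFamily V γ := Function.update σ T₀ (Bold T₀)
  have hB0 : B T₀ = Bold T₀ := Function.update_self _ _ _
  have hBσ : ∀ t, T₀ < t → B t = σ t := fun t ht => Function.update_of_ne ht.ne' _ _
  have hB1 : B T₁ = B₁ := (hBσ T₁ hT).trans hσ₁
  refine ⟨B, hB0, hv.forCloseTimes hT (fun t h h' => hcrit t ⟨h, h'.le⟩) fun s t h hs ht => ?_,
    hB1 ▸ hB₁, 1, one_pos, fun t h ht _ => ?_⟩
  · rw [hBσ s hs, hBσ t (hs.trans h)]
    exact hσ s t h ⟨hs, h.le.trans ht⟩ ⟨hs.trans h, ht⟩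
  have h' : (T₀ : ℝ) < t := h
  have ht' : (t : ℝ) < T₁ := ht
  have vt := hv.hasValues t ⟨h.le, ht.le⟩
  change matrixOf (B T₀) (B t) (V.α h) = _
  rw [hB0, hBσ t h]
  -- The bars that occur in column `i` of `E` are alive at the relevant heights.
  have halive : ∀ i j, γ i T₀ ≠ none → E j i ≠ 0 → ∀ s (hs : s ∈ Ioc T₀ T₁),
      Alive (γ j s) (birthOf (γ i T₀) + ((s : ℝ) - T₀)) := by
    intro i j hi hji s hs
    have hs₀ : (T₀ : ℝ) < s := hs.1
    have hs₁ : (s : ℝ) ≤ T₁ := hs.2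
    have hj := v₀.alive_iff.1 (hE i j hi hji)
    rw [v₀.birthOf_eq hi] at hj ⊢
    have hc := abs_le.1 (hv.close hs.1.le (birth_mem_valueLabels (Inf := Inf) hj.1))
    refine (hv.hasValues s ⟨hs.1.le, hs.2⟩).alive_iff.2 ⟨hj.1, by linarith, ?_⟩
    by_cases hInf : j ∈ Inf
    · exact Or.inl hInf
    · have h1 := gap (birth_mem_valueLabels (v₀.mem_of_present hi))
        (death_mem_valueLabels hj.1 hInf) (hj.2.2.resolve_left hInf)
      have hd := abs_le.1 (hv.close hs.1.le (death_mem_valueLabels hj.1 hInf))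
      exact Or.inr (by linarith)
  have happ : ∀ i, γ i T₀ ≠ none → (V.α h).app (birthOf (γ i T₀)) ((Bold T₀).elt i) =
      (σ t).combo (birthOf (γ i T₀) + ((t : ℝ) - T₀)) fun j => E j i := by
    intro i hi
    have hb := v₀.birthOf_eq hi
    have hiS := v₀.mem_of_present hi
    have hmul : (fun j => (M * E) j i) = M.mulVec fun j => E j i := by
      ext j
      rw [Matrix.mul_apply]
      rfl
    have h1 : (V.α hT).app (birthOf (γ i T₀)) ((Bold T₀).elt i) =
        B₁.combo (birthOf (γ i T₀) + ((T₁ : ℝ) - T₀)) fun j => E j i := by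
      rw [hB₁.combo_eq fun j hj => ?_, ← hmul, app_elt (Bold T₀) (Bold T₁)]
      · exact (Bold T₁).combo_congr fun j hj => hME i j hi hj
      · have := halive i j hi hj T₁ ⟨hT, le_rfl⟩
        exact ⟨this.ne_none, this.birthOf_le⟩
    have hc := hσ t T₁ ht ⟨h, ht.le⟩ ⟨hT, le_rfl⟩
    rw [hσ₁] at hc
    apply (V.interleaving ht).app_injective (σ t) (fun j hj => ?_)
    · apply B₁.map_injective (show birthOf (γ i T₀) + ((t : ℝ) - T₀) + ((T₁ : ℝ) - t) ≤
        birthOf (γ i T₀) + ((T₁ : ℝ) - T₀) by linarith) (fun j hj => ?_)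
      · rw [V.α_comp h ht, h1, hc.app_combo fun j hj => ?_, B₁.map_combo]
        · intro j hj _
          have := (halive i j hi hj T₁ ⟨hT, le_rfl⟩).birthOf_le
          linarith
        · have := halive i j hi hj t ⟨h, ht.le⟩
          exact ⟨this.ne_none, this.birthOf_le⟩
      · rwa [show birthOf (γ i T₀) + ((T₁ : ℝ) - T₀) =
          birthOf (γ i T₀) + ((t : ℝ) - T₀) + ((T₁ : ℝ) - t) by ring]
    · refine vt.alive_mono (by linarith) (fun k hk hkInf hlt => ?_) j hj
      have hd := abs_le.1 (hv.close h.le (death_mem_valueLabels hk hkInf))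
      have := gap (birth_mem_valueLabels hiS) (death_mem_valueLabels hk hkInf) (by linarith)
      linarith
  ext j i
  rw [projMatrix, Matrix.mul_diagonal]
  by_cases hi : γ i T₀ = none
  · rw [matrixOf_apply_of_eq_none hi, if_neg (fun h => h hi), mul_zero]
  · rw [if_pos (show i ∈ present γ T₀ from hi), mul_one]
    by_cases hj : Alive (γ j t) (birthOf (γ i T₀) + ((t : ℝ) - T₀))
    · exact matrixOf_apply_of_eq_combo (c := fun i => γ i T₀) (c' := fun i => γ i t) (happ i hi) hj
    · rw [matrixOf_apply_of_not_alive hj]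
      by_contra hne
      exact hj (halive i j hi (Ne.symm hne) t ⟨h, ht.le⟩)

/-- If the critical values are well separated at the beginning of the segment, the matrix of the
interleaving morphism over the whole segment is triangular for the order of bars at the
beginning. -/
theorem SegmentValues.matrixOf_triangular (hv : SegmentValues γ T₀ T₁ S Inf x)
    (hdist : ∀ t i j, γ i t ≠ none → γ i t = γ j t → i = j) (hT : T₀ < T₁)
    (hq : QuarterGap γ T₀ ((T₁ : ℝ) - T₀)) (B : BasisFamily V γ) :
    (∀ i j, matrixOf (B T₀) (B T₁) (V.α hT) j i ≠ 0 →
      ∃ I J, γ i T₀ = some I ∧ γ j T₀ = some J ∧ J ≤ I) ∧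
      ∀ i, γ i T₀ ≠ none → matrixOf (B T₀) (B T₁) (V.α hT) i i ≠ 0 := by
  have hT' : (T₀ : ℝ) < T₁ := hT
  have m₀ : T₀ ∈ Icc T₀ T₁ := ⟨le_rfl, hT.le⟩
  have v₀ := hv.hasValues T₀ m₀
  have v₁ := hv.hasValues T₁ ⟨hT.le, le_rfl⟩
  have gap : ∀ {e e'}, e ∈ valueLabels S Inf → e' ∈ valueLabels S Inf → x e T₀ < x e' T₀ →
      x e T₀ + 4 * ((T₁ : ℝ) - T₀) ≤ x e' T₀ := hv.add_le_of_quarterGap m₀ hq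
  have close : ∀ {e}, e ∈ valueLabels S Inf → _ := fun {e} he => abs_le.1 (hv.close hT.le he)
  -- Bars alive at a critical value of `T₀` are alive at the shifted height at `T₁`.
  have alive₁ : ∀ e ∈ valueLabels S Inf, ∀ j, Alive (γ j T₀) (x e T₀) →
      Alive (γ j T₁) (x e T₀ + ((T₁ : ℝ) - T₀)) := by
    intro e he j hj
    obtain ⟨hjS, h1, h2⟩ := v₀.alive_iff.1 hj
    have hc := close (birth_mem_valueLabels hjS)
    refine v₁.alive_iff.2 ⟨hjS, by linarith, ?_⟩
    by_cases hInf : j ∈ Inf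
    · exact Or.inl hInf
    · have hd := death_mem_valueLabels hjS hInf
      have := gap he hd (h2.resolve_left hInf)
      exact Or.inr (by linarith [close hd])
  refine (V.interleaving hT).matrixOf_triangular (B T₀) (B T₁) (hdist T₀) (fun i hi j => ?_)
    (fun i hi j hj => ?_) fun i hi q hqd j hj => ?_
  · have hib := birth_mem_valueLabels (Inf := Inf) (v₀.mem_of_present hi)
    rw [v₀.birthOf_eq hi]
    refine ⟨fun hj => ?_, alive₁ _ hib j⟩
    obtain ⟨hjS, h1, h2⟩ := v₁.alive_iff.1 hj
    have hjb := birth_mem_valueLabels (Inf := Inf) hjS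
    refine v₀.alive_iff.2 ⟨hjS, ?_, ?_⟩
    · by_contra! hlt
      linarith [gap hib hjb hlt, close hjb]
    · by_cases hInf : j ∈ Inf
      · exact Or.inl hInf
      · have hd := close (death_mem_valueLabels hjS hInf)
        exact Or.inr (by linarith [h2.resolve_left hInf])
  · have hib := birth_mem_valueLabels (Inf := Inf) (v₀.mem_of_present hi)
    rw [v₀.birthOf_eq hi] at hj ⊢
    refine v₀.alive_mono (by linarith) (fun k hk hkInf hlt => ?_) j hj
    linarith [gap hib (death_mem_valueLabels hk hkInf) hlt]
  · obtain ⟨I, hI⟩ := Option.ne_none_iff_exists'.1 hi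
    rw [hI] at hqd
    have hqd : I.death = (q : EReal) := hqd
    have hInf : i ∉ Inf := by
      intro hInf
      rw [v₀.death_top i I hI hInf] at hqd
      exact EReal.coe_ne_top q hqd.symm
    have hqx : q = x (i, true) T₀ := by
      rw [v₀.death i I hI hInf] at hqd
      exact_mod_cast hqd.symm
    rw [hqx] at hj ⊢
    exact alive₁ _ (death_mem_valueLabels (v₀.mem_of_present hi) hInf) j hj

/-- A compatible pair of comparable bars at the beginning of a segment remains comparable. -/
theorem SegmentValues.bar_le_of_not_incompatible (hv : SegmentValues γ T₀ T₁ S Inf x) (hT : T₀ < T₁)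
    (hcrit : ∀ t ∈ Ioc T₀ T₁, ¬ IsCritical γ t) {i j : Fin N}
    (hinc : ¬ ForwardsIncompatible γ T₀ i j) {I J I' J' : Bar} (hI : γ i T₀ = some I)
    (hJ : γ j T₀ = some J) (hI' : γ i T₁ = some I') (hJ' : γ j T₁ = some J') (hle : J ≤ I) :
    J' ≤ I' := by
  have hT' : (T₀ : ℝ) < T₁ := hT
  rw [ForwardsIncompatible] at hinc
  push Not at hinc
  obtain ⟨t, h1, h2, P, Q, hP, hQ, hPQ⟩ :=
    hinc ⟨J, I, hJ, hI, hle⟩ ((T₁ : ℝ) - T₀) (sub_pos.2 hT')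
  have h2' : t < T₁ := Subtype.coe_lt_coe.1 (by linarith)
  exact hv.bar_le_of_bar_le ordConnected_Ioc Ioc_subset_Icc_self hcrit ⟨h1, h2'.le⟩
    ⟨hT, le_rfl⟩ hQ hP hI' hJ' hPQ

/-- An incompatibility comes from coinciding births or coinciding deaths. -/
theorem SegmentValues.coincide_of_incompatible (hv : SegmentValues γ T₀ T₁ S Inf x) (hT : T₀ < T₁)
    (hcrit : ∀ t ∈ Ioc T₀ T₁, ¬ IsCritical γ t) (hq : QuarterGap γ T₀ ((T₁ : ℝ) - T₀))
    {k l : Fin N} (hinc : ForwardsIncompatible γ T₀ k l) :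
    k ≠ l ∧ ∃ d, Coincide γ T₀ (l, d) (k, d) := by
  have hT' : (T₀ : ℝ) < T₁ := hT
  obtain ⟨⟨I, J, hI, hJ, hle⟩, δ, hδ, hinc⟩ := hinc
  obtain ⟨t, ht₀, ht₁, htδ⟩ := exists_time_after hT hδ
  have ht : t ∈ Ioc T₀ T₁ := ⟨ht₀, ht₁.le⟩
  have ht' : (t : ℝ) < T₁ := ht₁
  have m₀ : T₀ ∈ Icc T₀ T₁ := ⟨le_rfl, hT.le⟩
  have v₀ := hv.hasValues T₀ m₀
  have vt := hv.hasValues t ⟨ht.1.le, ht.2⟩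
  have hl : l ∈ S := v₀.mem_of_present (i := l) (by simp [hI])
  have hk : k ∈ S := v₀.mem_of_present (i := k) (by simp [hJ])
  obtain ⟨I', hI'⟩ := Option.ne_none_iff_exists'.1
    (hv.present_of_not_critical t ⟨ht.1.le, ht.2⟩ (hcrit t ht) l hl)
  obtain ⟨J', hJ'⟩ := Option.ne_none_iff_exists'.1
    (hv.present_of_not_critical t ⟨ht.1.le, ht.2⟩ (hcrit t ht) k hk)
  have hnle := hinc t ht₀ htδ I' J' hI' hJ'
  have hkl : k ≠ l := by
    rintro rfl
    rw [hI'] at hJ'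
    cases hJ'
    exact hnle le_rfl
  refine ⟨hkl, ?_⟩
  by_contra! hco
  have strict : ∀ d, (l, d) ∈ valueLabels S Inf → (k, d) ∈ valueLabels S Inf →
      x (l, d) T₀ ≤ x (k, d) T₀ → x (l, d) t ≤ x (k, d) t := by
    intro d hld hkd hle
    have hlt : x (l, d) T₀ < x (k, d) T₀ := by
      refine hle.lt_of_ne fun heq => hco d (hv.coincide m₀ hld hkd ?_ heq)
      simpa using hkl.symm
    have h1 := hv.add_le_of_quarterGap m₀ hq hld hkd hlt
    have h2 := abs_le.1 (hv.close ht₀.le hld)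
    have h3 := abs_le.1 (hv.close ht₀.le hkd)
    linarith
  apply hnle
  have hle := (v₀.le_iff hJ hI).1 hle
  refine (vt.le_iff hJ' hI').2
    ⟨strict false (birth_mem_valueLabels hl) (birth_mem_valueLabels hk) hle.1, ?_⟩
  by_cases hkInf : k ∈ Inf
  · exact Or.inl hkInf
  · obtain ⟨hlInf, hd⟩ := hle.2.resolve_left hkInf
    exact Or.inr ⟨hlInf, strict true (death_mem_valueLabels hl hlInf)
      (death_mem_valueLabels hk hkInf) hd⟩

/-! ### Clearing the entry of the incompatible pair -/

theorem elemMatrix_neg_mul {l k : Fin N} (hlk : l ≠ k) (μ : K) :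
    (elemMatrix l k (-μ) : Matrix (Fin N) (Fin N) K) * elemMatrix l k μ = 1 := by
  rw [elemMatrix, elemMatrix, add_mul, mul_add, mul_add, one_mul, one_mul, mul_one,
    Matrix.single_mul_single_of_ne _ _ _ _ hlk.symm, add_zero, add_assoc, ← Matrix.single_add]
  simp

theorem mul_elemMatrix_apply (A : Matrix (Fin N) (Fin N) K) (l k : Fin N) (μ : K) (j i : Fin N) :
    (A * elemMatrix l k μ) j i = A j i + if i = k then A j l * μ else 0 := by
  rw [elemMatrix, mul_add, mul_one, Matrix.add_apply]
  split_ifs with h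
  · rw [h, Matrix.mul_single_apply_same]
  · rw [Matrix.mul_single_apply_of_ne _ _ _ _ _ h]

/-- If the critical values are well separated at the beginning of the segment, the old basis at its
end is transformed by the matrix of the interleaving morphism, from which the entry of an
incompatible pair is cleared, and transported backwards. -/
theorem SegmentValues.exists_isForwardSimplified_of_gap_start
    (hv : SegmentValues γ T₀ T₁ S Inf x)
    (hdist : ∀ t i j, γ i t ≠ none → γ i t = γ j t → i = j) (hgen : IsGeneric γ) (hT : T₀ < T₁)
    (hcrit : ∀ t ∈ Ioc T₀ T₁, ¬ IsCritical γ t) (hq : QuarterGap γ T₀ ((T₁ : ℝ) - T₀))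
    (Bold : BasisFamily V γ) : ∃ Bnew, IsForwardSimplified V γ hT Bold Bnew := by
  classical
  have m₀ : T₀ ∈ Icc T₀ T₁ := ⟨le_rfl, hT.le⟩
  have m₁ : T₁ ∈ Icc T₀ T₁ := ⟨hT.le, le_rfl⟩
  have v₀ := hv.hasValues T₀ m₀
  have v₁ := hv.hasValues T₁ m₁
  obtain ⟨tri, diag⟩ := hv.matrixOf_triangular hdist hT hq Bold
  set A := matrixOf (Bold T₀) (Bold T₁) (V.α hT) with hA
  by_cases hc : ForwardsCompatible γ T₀
  · have hfill : ∀ i j, fillDiagonal A j i = A j i + if j = i ∧ A j j = 0 then 1 else 0 := by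
      intro i j
      rw [fillDiagonal, Matrix.add_apply, Matrix.diagonal_apply]
      congr 1
      by_cases h1 : j = i <;> by_cases h2 : A j j = 0 <;> simp [h1, h2]
    have hM : IsBasisTransformation (fun i => γ i T₁) (fillDiagonal A) := by
      refine ⟨fun i hi => ?_, fun i j I J hI hJ hji => ?_⟩
      · rw [hfill]
        by_cases h1 : A i i = 0 <;> simp [h1]
      · by_cases hij : j = i
        · subst hij
          have hI : γ j T₁ = some I := hI
          have hJ : γ j T₁ = some J := hJ
          rw [hI] at hJ
          cases hJ
          exact le_refl I
        · rw [hfill, if_neg (fun h => hij h.1), add_zero] at hji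
          obtain ⟨I₀, J₀, hI₀, hJ₀, hle⟩ := tri i j hji
          exact hv.bar_le_of_not_incompatible hT hcrit (hc i j) hI₀ hJ₀ hI hJ hle
    obtain ⟨B, hB₀, hB₁, hB₂, δ, hδ, hB₃⟩ := hv.exists_family_of_gap_start hdist hT hcrit hq Bold
      (M := fillDiagonal A) (E := 1) hM
      (fun i j hi hji => by
        obtain rfl : j = i := by
          by_contra hij
          exact hji (Matrix.one_apply_ne hij)
        exact alive_birthOf hi)
      (fun i j hi hj => by
        rw [mul_one, hfill, if_neg, add_zero]
        rintro ⟨rfl, h0⟩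
        exact diag j hi h0)
    refine ⟨B, hB₀, hB₁, fun _ => ⟨?_, δ, hδ, fun t h ht htδ => ?_⟩, fun k l hinc =>
      absurd hinc (hc k l)⟩
    · rw [hB₀]
      exact hB₂
    · refine (hB₃ t h ht htδ).trans ?_
      rw [one_mul]
      congr 1
      refine (inter_eq_left.2 fun i hi => ?_).symm
      exact hv.present_of_not_critical t ⟨h.le, ht.le⟩ (hcrit t ⟨h, ht.le⟩) i (v₀.mem_of_present hi)
  · rw [ForwardsCompatible] at hc
    push Not at hc
    obtain ⟨k, l, hinc⟩ := hc
    obtain ⟨hkl, d, hco⟩ := hv.coincide_of_incompatible hT hcrit hq hinc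
    obtain ⟨⟨L₀, K₀, hL₀, hK₀, hLK⟩, -⟩ := id hinc
    -- By genericity there is only one coincidence, hence only one incompatible pair.
    have huniq : ∀ i j, ForwardsIncompatible γ T₀ i j → i = k ∧ j = l := by
      intro i j hij
      obtain ⟨-, d', hco'⟩ := hv.coincide_of_incompatible hT hcrit hq hij
      rcases hgen.unique_coincidence T₀ _ _ _ _ hco hco' with ⟨h1, h2⟩ | ⟨h1, h2⟩
      · exact ⟨(congrArg Prod.fst h2).symm, (congrArg Prod.fst h1).symm⟩
      · obtain rfl : l = i := congrArg Prod.fst h1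
        obtain rfl : k = j := congrArg Prod.fst h2
        obtain ⟨⟨P, Q, hP, hQ, hPQ⟩, -⟩ := hij
        rw [hK₀] at hP
        rw [hL₀] at hQ
        cases hP
        cases hQ
        have : K₀ = L₀ := le_antisymm hPQ hLK
        exact absurd (hdist T₀ k l (by simp [hK₀]) (by rw [hK₀, hL₀, this])) hkl
    -- For the same reason no vine appears at `T₀`.
    have hpres : ∀ i ∈ S, γ i T₀ ≠ none := by
      intro i hi hnone
      have hiInf : i ∉ Inf := fun h => (v₀.present_iff i).2 ⟨hi, Or.inl h⟩ hnone
      have heq : x (i, false) T₀ = x (i, true) T₀ := by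
        refine (v₀.le i hi hiInf).eq_of_not_lt fun h => ?_
        exact (v₀.present_iff i).2 ⟨hi, Or.inr h⟩ hnone
      have hco' := hv.coincide m₀ (birth_mem_valueLabels hi) (death_mem_valueLabels hi hiInf)
        (by simp) heq
      rcases hgen.unique_coincidence T₀ _ _ _ _ hco hco' with ⟨h1, h2⟩ | ⟨h1, h2⟩
      · exact hkl ((congrArg Prod.fst h2).trans (congrArg Prod.fst h1).symm)
      · exact hkl ((congrArg Prod.fst h2).trans (congrArg Prod.fst h1).symm)
    -- The bars of an incompatible pair overlap, as they have a common endpoint.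
    have hover : Alive (γ l T₀) (birthOf (γ k T₀)) := by
      refine ⟨L₀, hL₀, ?_, ?_⟩
      · rw [hK₀]
        exact hLK.1
      · have value : ∀ {i : Fin N} {I : Bar} {p : ℝ}, γ i T₀ = some I →
            (IsValue γ T₀ (i, false) p → I.birth = p) ∧
            (IsValue γ T₀ (i, true) p → I.death = (p : EReal)) := by
          intro i I p hI
          have hmem : T₀ ∈ supp (γ i) := by simp [supp, hI]
          constructor
          · rintro (⟨J, hJ, h⟩ | ⟨h, -⟩)
            · rw [hI] at hJ
              cases hJ
              exact h
            · exact absurd hmem h.2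
          · rintro (⟨J, hJ, h⟩ | ⟨h, -⟩)
            · rw [hI] at hJ
              cases hJ
              exact h
            · exact absurd hmem h.2
        obtain ⟨-, p, hl, hk⟩ := hco
        rw [hK₀]
        change (K₀.birth : EReal) < L₀.death
        cases d
        · rw [(value hK₀).1 hk, ← (value hL₀).1 hl]
          exact L₀.birth_lt_death
        · rw [(value hL₀).2 hl, ← (value hK₀).2 hk]
          exact K₀.birth_lt_death
    have hll : A l l ≠ 0 := diag l (by simp [hL₀])
    have hkl0 : A k l = 0 := by
      by_contra hne
      obtain ⟨P, Q, hP, hQ, hPQ⟩ := tri l k hne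
      rw [hL₀] at hP
      rw [hK₀] at hQ
      cases hP
      cases hQ
      have : K₀ = L₀ := le_antisymm hPQ hLK
      exact hkl (hdist T₀ k l (by simp [hK₀]) (by rw [hK₀, hL₀, this]))
    have hM : IsBasisTransformation (fun i => γ i T₁) (A * elemMatrix l k (-(A l k / A l l))) := by
      refine ⟨fun i hi => ?_, fun i j I J hI hJ hji => ?_⟩
      · rw [mul_elemMatrix_apply]
        split_ifs with hik
        · rw [hik, hkl0, zero_mul, add_zero]
          exact diag k (by simp [hK₀])
        · rw [add_zero]
          exact diag i (hpres i (v₁.mem_of_present hi))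
      · have hle : ∃ I₀ J₀, γ i T₀ = some I₀ ∧ γ j T₀ = some J₀ ∧ J₀ ≤ I₀ := by
          rw [mul_elemMatrix_apply] at hji
          by_cases h1 : A j i = 0
          · rw [h1, zero_add] at hji
            split_ifs at hji with hik
            · obtain ⟨P, Q, hP, hQ, hPQ⟩ := tri l j (left_ne_zero_of_mul hji)
              rw [hL₀] at hP
              cases hP
              exact ⟨K₀, Q, hik ▸ hK₀, hQ, hPQ.trans hLK⟩
            · exact absurd rfl hji
          · exact tri i j h1
        obtain ⟨I₀, J₀, hI₀, hJ₀, hle⟩ := hle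
        refine hv.bar_le_of_not_incompatible hT hcrit (fun hij => ?_) hI₀ hJ₀ hI hJ hle
        -- The entry of the incompatible pair has been cleared.
        obtain ⟨rfl, rfl⟩ := huniq i j hij
        apply hji
        rw [mul_elemMatrix_apply, if_pos rfl]
        field_simp
        ring
    obtain ⟨B, hB₀, hB₁, hB₂, hB₃⟩ := hv.exists_family_of_gap_start hdist hT hcrit hq Bold
      (M := A * elemMatrix l k (-(A l k / A l l))) (E := elemMatrix l k (A l k / A l l)) hM
      (fun i j hi hji => by
        by_cases hij : j = i
        · subst hij
          exact alive_birthOf hi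
        · rw [elemMatrix, Matrix.add_apply, Matrix.one_apply_ne hij, zero_add,
            Matrix.single_apply] at hji
          split_ifs at hji with h
          · rwa [← h.1, ← h.2]
          · exact absurd rfl hji)
      (fun i j hi hj => by
        rw [mul_assoc, elemMatrix_neg_mul hkl.symm, mul_one])
    refine ⟨B, hB₀, hB₁, fun hc' => absurd hinc (hc' k l), fun i j hij => ?_⟩
    obtain ⟨rfl, rfl⟩ := huniq i j hij
    have hA' : matrixOf (B T₀) (Bold T₁) (V.α hT) = A := by rw [hB₀]
    rw [hA']
    exact ⟨hB₂, hB₃⟩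

end

end Vineyards

end

theorem mainTheorem3 {K : Type u} [Field K] {a b : ℝ} {N : ℕ}
    (V : VineyardModule.{u, v} K a b) (γ : Fin N → Set.Icc a b → Option Bar)
    (hγ : IsVineFamily V γ) (hgen : IsGeneric γ)
    (T₀ T₁ : Set.Icc a b) (hT : T₀ < T₁) (hseg : IsSegment γ T₀ T₁)
    (Bold : BasisFamily V γ) :
    ∃ Bnew : BasisFamily V γ, IsForwardSimplified V γ hT Bold Bnew := by
  obtain ⟨-, hcrit, hends⟩ := hseg
  obtain ⟨S, Inf, x, hv⟩ := exists_segmentValues hγ.isVine Bold hT hcrit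
  have hIoc : ¬ IsCritical γ T₁ → ∀ t ∈ Set.Ioc T₀ T₁, ¬ IsCritical γ t := by
    rintro h₁ t ⟨ht₀, ht₁⟩
    rcases ht₁.eq_or_lt with rfl | ht₁
    exacts [h₁, hcrit t ht₀ ht₁]
  have hIco : ¬ IsCritical γ T₀ → ∀ t ∈ Set.Ico T₀ T₁, ¬ IsCritical γ t := by
    rintro h₀ t ⟨ht₀, ht₁⟩
    rcases ht₀.eq_or_lt with rfl | ht₀
    exacts [h₀, hcrit t ht₀ ht₁]
  rcases hends with ⟨h₀, h₁, hq | hq⟩ | ⟨-, h₁, hq⟩ | ⟨h₀, -, hq⟩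
  · exact hv.exists_isForwardSimplified_of_gap_start hγ.distinct hgen hT (hIoc h₁) hq Bold
  · exact hv.exists_isForwardSimplified_of_gap_end hγ.distinct hT (hIco h₀) hq Bold
  · exact hv.exists_isForwardSimplified_of_gap_start hγ.distinct hgen hT (hIoc h₁) hq Bold
  · exact hv.exists_isForwardSimplified_of_gap_end hγ.distinct hT (hIco h₀) hq Bold
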